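/- For $n\in\mathbb N_0$ and real $\alpha,\beta\ge 0$ let $P_n^{(\alpha,\beta)}$ be the Jacobi polynomial, $w(x)=(1-x)^\alpha(1+x)^\beta$, and $$\kappa=n+\tfrac12(\alpha+\beta+1),\qquad \sigma=\frac{\alpha+\beta}{2\kappa},\qquad \tau=\frac{\alpha-\beta}{2\kappa},\qquad x_\pm=-\sigma\tau\pm\sqrt{(1-\sigma^2)(1-\tau^2)} .$$ For $x\in(x_-,x_+)$ put $$U(x)=\sqrt{1-2\sigma\tau x-\tau^2-\sigma^2-x^2}=\sqrt{(x_+-x)(x-x_-)},$$ $$\psi=-\tfrac12(1-\tau)\ln(1-\tau)-\tfrac12(1+\tau)\ln(1+\tau)+\tfrac12(1+\sigma)\ln(1+\sigma)+\tfrac12(1-\sigma)\ln(1-\sigma),$$ $$\xi(x)=-\tfrac12(\sigma+\tau)\ln(1-x)-\tfrac12(\sigma-\tau)\ln(1+x),$$ $$\chi(x)=(\tau+1)\arctan\frac{U(x)}{1-x+\sigma+\tau}+(\tau-1)\arctan\frac{U(x)}{1+x+\sigma-\tau}+(1-\sigma)\,\mathrm{atan2}(-U(x),\tau+x\sigma),$$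 where $\mathrm{atan2}(b,a)\in(-\pi,\pi]$ is the argument of $a+ib$. Let $$\phi(z)=-(1+\tau)\ln(1-z)-(1-\tau)\ln(1+z)+(1-\sigma)\ln(x-z)$$ with principal logarithms, and let $z_+=\dfrac{x-\tau+iU(x)}{1+\sigma}$, the zero of $\phi'$ in the upper half plane. Coefficients. Let $z(w)$ be analytic near $w=0$ with $z(0)=z_+$ and $\phi(z(w))-\phi(z_+)=\tfrac12w^2$; there is such a $z(w)$, unique up to $w\mapsto-w$. Write $$\frac{1}{\sqrt{(1-z^2)(x-z)}}\,\frac{dz}{dw}=\sum_{k\ge0}f_kw^k,\qquad c_j=2^j\left(\tfrac12\right)_j\frac{f_{2j}}{f_0},\qquad p_j=\Re c_j,\quad q_j=\Im c_j ,$$ where $\left(\tfrac12\right)_j$ is the rising factorial and the square root is a branch analytic in the upper half plane (the $c_j$ depend neither on this branch nor on the choice of $z(w)$). Thus $c_j,p_j,q_j$ depend only on $j,\sigma,\tau,x$. Claim. There are real functions $P,Q$ of $(n,\alpha,\beta,x)$ with the following properties. (i) For all $n\in\mathbb N_0$, $\alpha,\beta\ge0$ and $x\in(x_-,x_+)$,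 $$P_n^{(\alpha,\beta)}(x)=\frac{2^{\frac12(\alpha+\beta+1)}e^{-\kappa\psi}}{\sqrt{\pi\kappa\,w(x)U(x)}}\Bigl[\cos\bigl(\kappa\chi(x)+\tfrac14\pi\bigr)P+\sin\bigl(\kappa\chi(x)+\tfrac14\pi\bigr)Q\Bigr],$$ $\phi(z_+)=-\ln2+\psi+\xi(x)+i\chi(x)$, $c_0=1$, $p_0=1$ and $q_0=0$. (ii) $P\sim\sum_j p_j/\kappa^j$ and $Q\sim\sum_j q_j/\kappa^j$ as $\kappa\to\infty$, and $$P_n^{(\alpha,\beta)}(x)\sim\Re\Bigl(A\sum_{j\ge0}\frac{c_j}{\kappa^j}\Bigr),\qquad A=\frac{e^{-\kappa\phi(z_+)-\frac14\pi i}}{2^n\,w(x)\sqrt{\pi\kappa U(x)}},$$ uniformly for $\sigma\in[0,\sigma_0]$, $|\tau|\le\tau_0$ and $x\in[x_-+\delta,\,x_+-\delta]$, for any fixed $\sigma_0,\tau_0\in(0,1)$ and $\delta>0$. That is, for all such $\sigma_0,\tau_0,\delta$ and every $N\in\mathbb N_0$ there are $C,\kappa_0$, depending only on $\sigma_0,\tau_0,\delta,N$,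 such that for all $n\in\mathbb N_0$ and $\alpha,\beta\ge0$ with $\kappa\ge\kappa_0$, $\sigma\in[0,\sigma_0]$, $|\tau|\le\tau_0$, and all $x\in[x_-+\delta,x_+-\delta]$, $$\Bigl|P-\sum_{j<N}\frac{p_j}{\kappa^j}\Bigr|\le\frac{C}{\kappa^N},\qquad \Bigl|Q-\sum_{j<N}\frac{q_j}{\kappa^j}\Bigr|\le\frac{C}{\kappa^N},\qquad \Bigl|P_n^{(\alpha,\beta)}(x)-\Re\Bigl(A\sum_{j<N}\frac{c_j}{\kappa^j}\Bigr)\Bigr|\le\frac{C\,|A|}{\kappa^N}.$$ -/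

import Mathlib

open Filter Topology

noncomputable section

namespace JacobiAsymptotics

/-- The Jacobi weight `w(x) = (1 - x)^α (1 + x)^β`. -/
def weight (α β x : ℝ) : ℝ := (1 - x) ^ α * (1 + x) ^ β

/-- The Jacobi polynomial `P_n^{(α,β)}(x)` for `-1 < x < 1`, by the Rodrigues formula. -/
def jacobiP (n : ℕ) (α β x : ℝ) : ℝ :=
  (-1) ^ n / (2 ^ n * (n.factorial : ℝ) * weight α β x) *
    iteratedDeriv n (fun t : ℝ => weight α β t * (1 - t ^ 2) ^ n) x

/-- The large parameter `κ = n + (α + β + 1) / 2`. -/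
def kappa (n : ℕ) (α β : ℝ) : ℝ := n + (α + β + 1) / 2

def sigma (n : ℕ) (α β : ℝ) : ℝ := (α + β) / (2 * kappa n α β)

def tau (n : ℕ) (α β : ℝ) : ℝ := (α - β) / (2 * kappa n α β)

/-- The left turning point `x₋`. -/
def xMinus (σ τ : ℝ) : ℝ := -σ * τ - Real.sqrt ((1 - σ ^ 2) * (1 - τ ^ 2))

/-- The right turning point `x₊`. -/
def xPlus (σ τ : ℝ) : ℝ := -σ * τ + Real.sqrt ((1 - σ ^ 2) * (1 - τ ^ 2))

def U (σ τ x : ℝ) : ℝ := Real.sqrt (1 - 2 * σ * τ * x - τ ^ 2 - σ ^ 2 - x ^ 2)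

def psi (σ τ : ℝ) : ℝ :=
  -(1 / 2) * (1 - τ) * Real.log (1 - τ) - (1 / 2) * (1 + τ) * Real.log (1 + τ)
    + (1 / 2) * (1 + σ) * Real.log (1 + σ) + (1 / 2) * (1 - σ) * Real.log (1 - σ)

def xi (σ τ x : ℝ) : ℝ :=
  -(1 / 2) * (σ + τ) * Real.log (1 - x) - (1 / 2) * (σ - τ) * Real.log (1 + x)

/-- `Complex.arg ⟨a, b⟩`, with values in `(-π, π]`, is `atan2 (b, a)`. -/
def chi (σ τ x : ℝ) : ℝ :=
  (τ + 1) * Real.arctan (U σ τ x / (1 - x + σ + τ))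
    + (τ - 1) * Real.arctan (U σ τ x / (1 + x + σ - τ))
    + (1 - σ) * Complex.arg ⟨τ + x * σ, -U σ τ x⟩

/-- The phase function of the Cauchy integral. The principal logarithms are analytic in the
upper half plane, which contains the saddle point `zPlus`. -/
def phi (σ τ x : ℝ) (z : ℂ) : ℂ :=
  -(1 + τ) * Complex.log (1 - z) - (1 - τ) * Complex.log (1 + z)
    + (1 - σ) * Complex.log (x - z)

/-- The saddle point of `phi` in the upper half plane. -/
def zPlus (σ τ x : ℝ) : ℂ := (x - τ + Complex.I * U σ τ x) / (1 + σ)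

/-- `z` is (near `w = 0`) an analytic solution of `φ(z(w)) - φ(z₊) = w² / 2` with `z(0) = z₊`.
There are two such germs, `z(w)` and `z(-w)`; `cCoeff` below is the same for both. -/
def IsSaddleBranch (σ τ x : ℝ) (z : ℂ → ℂ) : Prop :=
  AnalyticAt ℂ z 0 ∧ z 0 = zPlus σ τ x ∧
    ∀ᶠ w in 𝓝 (0 : ℂ), phi σ τ x (z w) - phi σ τ x (zPlus σ τ x) = w ^ 2 / 2

/-- `f₊(w) = ((1 - z²) (x - z))^{-1/2} dz/dw` along a saddle branch. The square root is the
product of the principal roots of the factors, hence analytic in the upper half plane. -/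
def fPlus (x : ℝ) (z : ℂ → ℂ) (w : ℂ) : ℂ :=
  deriv z w /
    ((1 - z w) ^ (1 / 2 : ℂ) * (1 + z w) ^ (1 / 2 : ℂ) * ((x : ℂ) - z w) ^ (1 / 2 : ℂ))

/-- The Taylor coefficient `f_k` of `fPlus` at `w = 0`. -/
def fCoeff (x : ℝ) (z : ℂ → ℂ) (k : ℕ) : ℂ :=
  iteratedDeriv k (fPlus x z) 0 / (k.factorial : ℂ)

/-- `c_j = 2^j (1/2)_j f_{2j} / f_0`, with `(1/2)_j` the rising factorial. -/
def cCoeff (x : ℝ) (z : ℂ → ℂ) (j : ℕ) : ℂ :=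
  2 ^ j * (ascPochhammer ℂ j).eval (1 / 2) * fCoeff x z (2 * j) / fCoeff x z 0

def pCoeff (x : ℝ) (z : ℂ → ℂ) (j : ℕ) : ℝ := (cCoeff x z j).re

def qCoeff (x : ℝ) (z : ℂ → ℂ) (j : ℕ) : ℝ := (cCoeff x z j).im

/-- The amplitude `e^{-κ φ(z₊) - π i / 4} / (2^n w(x) √(π κ U(x)))`. -/
def amplitude (n : ℕ) (α β x : ℝ) : ℂ :=
  Complex.exp (-(kappa n α β : ℂ) *
      phi (sigma n α β) (tau n α β) x (zPlus (sigma n α β) (tau n α β) x)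
      - (Real.pi / 4 : ℝ) * Complex.I) /
    ((2 ^ n * weight α β x *
      Real.sqrt (Real.pi * kappa n α β * U (sigma n α β) (tau n α β) x) : ℝ) : ℂ)

end JacobiAsymptotics

end

open JacobiAsymptotics

/-!
The Rodrigues formula turns `P_n^{(α,β)}(x)` into a Cauchy integral of
`(1 - z)^{n+α} (1 + z)^{n+β} (z - x)^{-n-1}`, that is, of `e^{-κ φ(z)}` times the algebraic factor
`((1 - z²)(x - z))^{-1/2}`. In the coordinate `z = x + e^s` the upper half of a circle about `x` is
a vertical segment of length `π`, and the lower half contributes the complex conjugate, so the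
polynomial is the real part of an integral over a small half circle (`jacobiP_eq`).

The saddle point `z₊` lies on the circle about `x` of radius `√((1 - σ)(1 - x²)/(1 + σ))`. On this
circle `|1 - z|²` and `|1 + z|²` are affine in `cos θ`, so `-Re φ` is strictly concave in `cos θ`
and has its maximum at `z₊`: the circle is a path of steepest-descent type without any tuning
(`Regular.rpow_mul_rpow_circlePt_le`). It may meet the cuts `z ≥ 1` and `z ≤ -1`, which prevents a
deformation of the small circle to it, but only the real part matters. Moving the half circle
outwards costs two integrals along the real axis, of which only the imaginary parts enter. These
vanish before the cuts, and beyond them the modulus of the integrand grows with the distance from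
`x`, so both are bounded by the values of the integrand at the end points of the half circle and
are exponentially smaller than `e^{-κ φ(z₊)}` (`abs_re_half_circle_sub_le`).

Near `z₊` a coordinate `w` with `φ = φ(z₊) + w²/2` exists on a ball whose radius depends only on a
lower bound `d` for the distances from the degenerate configurations (`exists_morse_coordinate`,
`exists_saddleChart`). In this coordinate the central arc becomes a path that can be replaced by a
real segment up to an exponentially small error, and Taylor's formula with Gaussian moments gives
the expansion with an error uniform in the parameters (`norm_integral_mul_gauss_sub_le`,
`exists_half_circle_expansion`). Any two saddle branches agree up to `w ↦ -w`, so the coefficients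
`c_j` can be computed from this chart (`SaddleChart.cCoeff_eq_of_isSaddleBranch`).

Finally `P` and `Q` are the real and imaginary parts of `S`, where `A S` is the integral over the
large half circle plus the real contribution of the cuts. Then `P_n^{(α,β)}(x) = Re (A S)` holds
exactly, and `S` has the expansion `∑ c_j / κ^j`, because the cut contribution is exponentially
small relative to `|A|` (`exists_norm_expansionSum_sub_le`).
-/

namespace JacobiAsymptotics

/-! ### Parameters and the saddle point -/

/-- The parameters stay at distance at least `d` from everything degenerate: `σ = 1`, `x = ±1`,
and the turning points (where `U` vanishes). All constants of the asymptotic analysis depend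
on `d` only. -/
structure Regular (d σ τ x : ℝ) : Prop where
  pos : 0 < d
  abs_tau_le : |τ| ≤ σ
  le_one_sub_sigma : d ≤ 1 - σ
  le_one_sub : d ≤ 1 - x
  le_one_add : d ≤ 1 + x
  le_U : d ≤ U σ τ x

namespace Regular

variable {d σ τ x : ℝ} (h : Regular d σ τ x)
include h

lemma U_pos : 0 < U σ τ x := h.pos.trans_le h.le_U

lemma U_sq : U σ τ x ^ 2 = 1 - 2 * σ * τ * x - τ ^ 2 - σ ^ 2 - x ^ 2 :=
  Real.sq_sqrt (Real.sqrt_pos.1 h.U_pos).le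

lemma sigma_nonneg : 0 ≤ σ := (abs_nonneg _).trans h.abs_tau_le
lemma tau_le : τ ≤ σ := (abs_le.1 h.abs_tau_le).2
lemma neg_tau_le : -τ ≤ σ := by linarith [(abs_le.1 h.abs_tau_le).1]
lemma le_one_add_tau : d ≤ 1 + τ := by linarith [h.neg_tau_le, h.le_one_sub_sigma]
lemma le_one_sub_tau : d ≤ 1 - τ := by linarith [h.tau_le, h.le_one_sub_sigma]
lemma one_add_sigma_pos : 0 < 1 + σ := by linarith [h.sigma_nonneg]
lemma one_sub_sigma_pos : 0 < 1 - σ := by linarith [h.pos, h.le_one_sub_sigma]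
lemma one_add_tau_pos : 0 < 1 + τ := by linarith [h.pos, h.le_one_add_tau]
lemma one_sub_tau_pos : 0 < 1 - τ := by linarith [h.pos, h.le_one_sub_tau]
lemma one_sub_pos : 0 < 1 - x := by linarith [h.pos, h.le_one_sub]
lemma one_add_pos : 0 < 1 + x := by linarith [h.pos, h.le_one_add]
lemma le_one : d ≤ 1 := by linarith [h.sigma_nonneg, h.le_one_sub_sigma]
lemma le_one_sub_sq : d ≤ 1 - x ^ 2 := by
  have h1 := h.le_one_sub
  have h2 := h.le_one_add
  rcases le_total 0 x with hx | hx
  · nlinarith [h.one_sub_pos]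
  · nlinarith [h.one_add_pos]

lemma U_le_one : U σ τ x ≤ 1 := by
  have := h.U_sq
  have h3 := h.U_pos
  -- `U² = 1 - (στ + x)² - τ² - σ² + σ²τ²` is at most `1`
  have h4 : τ ^ 2 ≤ 1 := by nlinarith [h.one_add_tau_pos, h.one_sub_tau_pos]
  nlinarith [sq_nonneg (σ * τ + x), sq_nonneg τ, sq_nonneg σ, mul_nonneg (sq_nonneg σ)
    (sub_nonneg.2 h4)]

lemma zPlus_eq : zPlus σ τ x =
    (((x - τ) / (1 + σ) : ℝ) : ℂ) + ((U σ τ x / (1 + σ) : ℝ) : ℂ) * Complex.I := by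
  have : (1 + σ : ℂ) ≠ 0 := by exact_mod_cast h.one_add_sigma_pos.ne'
  rw [zPlus]
  push_cast
  field_simp

lemma zPlus_re : (zPlus σ τ x).re = (x - τ) / (1 + σ) := by
  rw [h.zPlus_eq, Complex.add_re, Complex.re_ofReal_mul, Complex.ofReal_re, Complex.I_re,
    mul_zero, add_zero]

lemma zPlus_im : (zPlus σ τ x).im = U σ τ x / (1 + σ) := by
  rw [h.zPlus_eq, Complex.add_im, Complex.im_ofReal_mul, Complex.ofReal_im, Complex.I_im,
    mul_one, zero_add]

lemma zPlus_im_pos : 0 < (zPlus σ τ x).im := by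
  rw [h.zPlus_im]; exact div_pos h.U_pos h.one_add_sigma_pos

lemma le_zPlus_im : d / 2 ≤ (zPlus σ τ x).im := by
  rw [h.zPlus_im, div_le_div_iff₀ two_pos h.one_add_sigma_pos]
  nlinarith [h.le_U, h.pos, h.one_sub_sigma_pos]

lemma normSq_sub_zPlus :
    ‖(x : ℂ) - zPlus σ τ x‖ ^ 2 = (1 - σ) * (1 - x ^ 2) / (1 + σ) := by
  rw [← Complex.normSq_eq_norm_sq, Complex.normSq_apply]
  simp only [Complex.sub_re, Complex.sub_im, Complex.ofReal_re, Complex.ofReal_im, h.zPlus_re,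
    h.zPlus_im]
  have := h.one_add_sigma_pos.ne'
  field_simp
  linear_combination h.U_sq

lemma normSq_one_sub_zPlus :
    ‖1 - zPlus σ τ x‖ ^ 2 = 2 * (1 + τ) * (1 - x) / (1 + σ) := by
  rw [← Complex.normSq_eq_norm_sq, Complex.normSq_apply]
  simp only [Complex.sub_re, Complex.sub_im, Complex.one_re, Complex.one_im, h.zPlus_re,
    h.zPlus_im]
  have := h.one_add_sigma_pos.ne'
  field_simp
  linear_combination h.U_sq

lemma normSq_one_add_zPlus :
    ‖1 + zPlus σ τ x‖ ^ 2 = 2 * (1 - τ) * (1 + x) / (1 + σ) := by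
  rw [← Complex.normSq_eq_norm_sq, Complex.normSq_apply]
  simp only [Complex.add_re, Complex.add_im, Complex.one_re, Complex.one_im, h.zPlus_re,
    h.zPlus_im]
  have := h.one_add_sigma_pos.ne'
  field_simp
  linear_combination h.U_sq

omit h in
lemma log_norm_eq_half {z : ℂ} : Real.log ‖z‖ = 1 / 2 * Real.log (‖z‖ ^ 2) := by
  rw [Real.log_pow]; push_cast; ring

lemma arg_one_sub_zPlus :
    (1 - zPlus σ τ x).arg = -Real.arctan (U σ τ x / (1 - x + σ + τ)) := by
  have h1 := h.one_add_sigma_pos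
  have h0 : 0 < 1 - x + σ + τ := by linarith [h.neg_tau_le, h.one_sub_pos]
  have hre : (1 - zPlus σ τ x).re = (1 - x + σ + τ) / (1 + σ) := by
    rw [Complex.sub_re, h.zPlus_re, Complex.one_re]; field_simp; ring
  rw [Complex.arg_of_re_nonneg (by rw [hre]; positivity), ← Real.arctan_neg,
    Real.arctan_eq_arcsin, Complex.sub_im, h.zPlus_im, Complex.one_im]
  congr 1
  have h2 : ‖1 - zPlus σ τ x‖ =
      (1 - x + σ + τ) / (1 + σ) * √(1 + (-(U σ τ x / (1 - x + σ + τ))) ^ 2) := by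
    rw [← abs_of_pos (div_pos h0 h1), ← Real.sqrt_sq_eq_abs,
      ← Real.sqrt_mul (sq_nonneg _), Complex.norm_def, Complex.normSq_apply, hre]
    congr 1
    rw [Complex.sub_im, h.zPlus_im, Complex.one_im]
    field_simp; ring
  rw [h2]
  have : √(1 + (-(U σ τ x / (1 - x + σ + τ))) ^ 2) ≠ 0 := by positivity
  field_simp
  ring

lemma arg_one_add_zPlus :
    (1 + zPlus σ τ x).arg = Real.arctan (U σ τ x / (1 + x + σ - τ)) := by
  have h1 := h.one_add_sigma_pos
  have h0 : 0 < 1 + x + σ - τ := by linarith [h.tau_le, h.one_add_pos]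
  have hre : (1 + zPlus σ τ x).re = (1 + x + σ - τ) / (1 + σ) := by
    rw [Complex.add_re, h.zPlus_re, Complex.one_re]; field_simp; ring
  rw [Complex.arg_of_re_nonneg (by rw [hre]; positivity),
    Real.arctan_eq_arcsin, Complex.add_im, h.zPlus_im, Complex.one_im]
  congr 1
  have h2 : ‖1 + zPlus σ τ x‖ =
      (1 + x + σ - τ) / (1 + σ) * √(1 + (U σ τ x / (1 + x + σ - τ)) ^ 2) := by
    rw [← abs_of_pos (div_pos h0 h1), ← Real.sqrt_sq_eq_abs,
      ← Real.sqrt_mul (sq_nonneg _), Complex.norm_def, Complex.normSq_apply, hre]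
    congr 1
    rw [Complex.add_im, h.zPlus_im, Complex.one_im]
    field_simp; ring
  rw [h2]
  have : √(1 + (U σ τ x / (1 + x + σ - τ)) ^ 2) ≠ 0 := by positivity
  field_simp
  ring

lemma arg_sub_zPlus : ((x : ℂ) - zPlus σ τ x).arg = Complex.arg ⟨τ + x * σ, -U σ τ x⟩ := by
  have h1 := h.one_add_sigma_pos
  have : (x : ℂ) - zPlus σ τ x = (((1 + σ)⁻¹ : ℝ) : ℂ) * ⟨τ + x * σ, -U σ τ x⟩ := by
    apply Complex.ext
    · rw [Complex.re_ofReal_mul, Complex.sub_re, h.zPlus_re, Complex.ofReal_re]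
      field_simp; ring
    · rw [Complex.im_ofReal_mul, Complex.sub_im, h.zPlus_im, Complex.ofReal_im]
      field_simp; ring
  rw [this, Complex.arg_real_mul _ (by positivity)]

lemma phi_zPlus : phi σ τ x (zPlus σ τ x) =
    ((-Real.log 2 + psi σ τ + xi σ τ x : ℝ) : ℂ) + Complex.I * (chi σ τ x : ℂ) := by
  have e1 := h.one_add_sigma_pos
  have e2 := h.one_sub_sigma_pos
  have e3 := h.one_add_tau_pos
  have e4 := h.one_sub_tau_pos
  have e5 := h.one_sub_pos
  have e6 := h.one_add_pos
  have l1 : Real.log ‖1 - zPlus σ τ x‖ = 1 / 2 * (Real.log 2 + Real.log (1 + τ) +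
      Real.log (1 - x) - Real.log (1 + σ)) := by
    rw [log_norm_eq_half, h.normSq_one_sub_zPlus, Real.log_div (by positivity) (by positivity),
      Real.log_mul (by positivity) (by positivity), Real.log_mul (by positivity) (by positivity)]
  have l2 : Real.log ‖1 + zPlus σ τ x‖ = 1 / 2 * (Real.log 2 + Real.log (1 - τ) +
      Real.log (1 + x) - Real.log (1 + σ)) := by
    rw [log_norm_eq_half, h.normSq_one_add_zPlus, Real.log_div (by positivity) (by positivity),
      Real.log_mul (by positivity) (by positivity), Real.log_mul (by positivity) (by positivity)]
  have l3 : Real.log ‖(x : ℂ) - zPlus σ τ x‖ = 1 / 2 * (Real.log (1 - σ) + Real.log (1 - x) +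
      Real.log (1 + x) - Real.log (1 + σ)) := by
    rw [log_norm_eq_half, h.normSq_sub_zPlus, show 1 - x ^ 2 = (1 - x) * (1 + x) by ring,
      Real.log_div (by positivity) (by positivity),
      Real.log_mul (by positivity) (by positivity), Real.log_mul (by positivity) (by positivity)]
    ring
  rw [phi, Complex.log, Complex.log, Complex.log, l1, l2, l3, h.arg_one_sub_zPlus,
    h.arg_one_add_zPlus, h.arg_sub_zPlus, psi, xi, chi]
  push_cast
  ring

end Regular

/-! ### The phase function in the upper half plane -/

/-- The amplitude `((1 - z²)(x - z))^{-1/2}` of the Cauchy integral, with the branch of the square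
root used in `fPlus`. -/
noncomputable def saddleAmp (x : ℝ) (z : ℂ) : ℂ :=
  ((1 - z) ^ (1 / 2 : ℂ) * (1 + z) ^ (1 / 2 : ℂ) * ((x : ℂ) - z) ^ (1 / 2 : ℂ))⁻¹

/-- The quotient `φ'(z) / (z - z₊)`. -/
noncomputable def phiQuot (σ τ x : ℝ) (z : ℂ) : ℂ :=
  -(1 + σ) * (z - (starRingEnd ℂ) (zPlus σ τ x)) / ((1 - z) * (1 + z) * (x - z))

lemma fPlus_eq (x : ℝ) (z : ℂ → ℂ) (w : ℂ) : fPlus x z w = deriv z w * saddleAmp x (z w) :=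
  div_eq_mul_inv _ _

section UpperHalfPlane

variable {z : ℂ} (hz : 0 < z.im)
include hz

lemma ofReal_sub_mem_slitPlane (y : ℝ) : (y : ℂ) - z ∈ Complex.slitPlane :=
  Or.inr (by simpa using hz.ne')

lemma one_sub_mem_slitPlane : 1 - z ∈ Complex.slitPlane := by
  simpa using ofReal_sub_mem_slitPlane hz 1

lemma one_add_mem_slitPlane : 1 + z ∈ Complex.slitPlane :=
  Or.inr (by simpa using hz.ne')

lemma one_sub_ne_zero_of_im_pos : 1 - z ≠ 0 := Complex.slitPlane_ne_zero (one_sub_mem_slitPlane hz)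
lemma one_add_ne_zero_of_im_pos : 1 + z ≠ 0 := Complex.slitPlane_ne_zero (one_add_mem_slitPlane hz)
lemma ofReal_sub_ne_zero_of_im_pos (y : ℝ) : (y : ℂ) - z ≠ 0 :=
  Complex.slitPlane_ne_zero (ofReal_sub_mem_slitPlane hz y)

omit hz in
lemma saddleAmp_sq (x : ℝ) : saddleAmp x z ^ 2 = ((1 - z) * (1 + z) * (x - z))⁻¹ := by
  have key : ∀ a : ℂ, (a ^ (1 / 2 : ℂ)) ^ 2 = a := fun a => by
    rw [← Complex.cpow_nat_mul]; norm_num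
  rw [saddleAmp, inv_pow, mul_pow, mul_pow, key, key, key]

lemma saddleAmp_ne_zero (x : ℝ) : saddleAmp x z ≠ 0 := by
  have := saddleAmp_sq (z := z) x
  intro h0
  rw [h0, zero_pow two_ne_zero, eq_comm, inv_eq_zero] at this
  exact mul_ne_zero (mul_ne_zero (one_sub_ne_zero_of_im_pos hz) (one_add_ne_zero_of_im_pos hz))
    (ofReal_sub_ne_zero_of_im_pos hz x) this

lemma differentiableAt_saddleAmp (x : ℝ) : DifferentiableAt ℂ (saddleAmp x) z := by
  have h1 := one_sub_mem_slitPlane hz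
  have h2 := one_add_mem_slitPlane hz
  have h3 := ofReal_sub_mem_slitPlane hz x
  have h4 := saddleAmp_ne_zero hz x
  rw [saddleAmp, ne_eq, inv_eq_zero] at h4
  refine DifferentiableAt.fun_inv ?_ h4
  refine ((DifferentiableAt.cpow ?_ (by fun_prop) h1).fun_mul
    (DifferentiableAt.cpow ?_ (by fun_prop) h2)).fun_mul
    (DifferentiableAt.cpow ?_ (by fun_prop) h3) <;> fun_prop

lemma differentiableAt_phiQuot (σ τ x : ℝ) : DifferentiableAt ℂ (phiQuot σ τ x) z := by
  refine DifferentiableAt.fun_div (by fun_prop) (by fun_prop) ?_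
  exact mul_ne_zero (mul_ne_zero (one_sub_ne_zero_of_im_pos hz) (one_add_ne_zero_of_im_pos hz))
    (ofReal_sub_ne_zero_of_im_pos hz x)

omit hz in
lemma norm_inv_ofReal_sub_le {δ : ℝ} (hδ : 0 < δ) (h : δ ≤ z.im) (y : ℝ) :
    ‖((y : ℂ) - z)⁻¹‖ ≤ δ⁻¹ := by
  rw [norm_inv]
  refine inv_anti₀ hδ (h.trans ?_)
  have := Complex.abs_im_le_norm ((y : ℂ) - z)
  simp only [Complex.sub_im, Complex.ofReal_im, zero_sub, abs_neg] at this
  exact (le_abs_self _).trans this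

/-- `((x - z) / (1 - z²))^{1/2}` lies in the fourth quadrant when `z` is in the upper half plane.
This decides the sign of the square root in the leading term of the expansion. -/
lemma sub_mul_saddleAmp_mem_quadrant {x : ℝ} (h1 : 0 < 1 - x) (h2 : 0 < 1 + x) :
    0 < (((x : ℂ) - z) * saddleAmp x z).re ∧ (((x : ℂ) - z) * saddleAmp x z).im < 0 := by
  have n1 := one_sub_ne_zero_of_im_pos hz
  have n2 := one_add_ne_zero_of_im_pos hz
  have n3 := ofReal_sub_ne_zero_of_im_pos hz x
  set L : ℂ := Complex.log (x - z) - Complex.log (1 - z) - Complex.log (1 + z) with hL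
  have hq : ((x : ℂ) - z) * saddleAmp x z = Complex.exp (L / 2) := by
    have : ((x : ℂ) - z) = Complex.exp (Complex.log (x - z)) := (Complex.exp_log n3).symm
    rw [saddleAmp, Complex.cpow_def_of_ne_zero n1, Complex.cpow_def_of_ne_zero n2,
      Complex.cpow_def_of_ne_zero n3, ← Complex.exp_add, ← Complex.exp_add, ← Complex.exp_neg]
    nth_rw 1 [this]
    rw [← Complex.exp_add, hL]
    congr 1
    ring
  have hexp : Complex.exp L = ((x - z) / ((1 - z) * (1 + z)) : ℂ) := by
    rw [hL, Complex.exp_sub, Complex.exp_sub, Complex.exp_log n1, Complex.exp_log n2,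
      Complex.exp_log n3, div_div]
  have hpf : ((x - z) / ((1 - z) * (1 + z)) : ℂ) =
      ((-((1 - x) / 2) : ℝ) : ℂ) * (1 - z)⁻¹ + (((1 + x) / 2 : ℝ) : ℂ) * (1 + z)⁻¹ := by
    push_cast; field_simp; ring
  have him : (Complex.exp L).im < 0 := by
    rw [hexp, hpf, Complex.add_im, Complex.im_ofReal_mul, Complex.im_ofReal_mul, Complex.inv_im,
      Complex.inv_im, Complex.sub_im, Complex.add_im, Complex.one_im]
    have p1 : 0 < Complex.normSq (1 - z) := Complex.normSq_pos.2 n1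
    have p2 : 0 < Complex.normSq (1 + z) := Complex.normSq_pos.2 n2
    have : 0 < -(0 - z.im) / Complex.normSq (1 - z) := by
      apply div_pos _ p1; linarith
    have : -(0 + z.im) / Complex.normSq (1 + z) < 0 := by
      apply div_neg_of_neg_of_pos _ p2; linarith
    nlinarith
  have hLim : L.im = ((x : ℂ) - z).arg - (1 - z).arg - (1 + z).arg := by
    rw [hL]; simp [Complex.log_im]
  have a1 : ((x : ℂ) - z).arg < 0 := Complex.arg_neg_iff.2 (by simpa using hz)
  have a1' := Complex.neg_pi_lt_arg ((x : ℂ) - z)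
  have a2 : (1 - z).arg < 0 := Complex.arg_neg_iff.2 (by simpa using hz)
  have a2' := Complex.neg_pi_lt_arg (1 - z)
  have a3 : 0 ≤ (1 + z).arg := Complex.arg_nonneg_iff.2 (by simpa using hz.le)
  have a3' := Complex.arg_le_pi (1 + z)
  rw [Complex.exp_im] at him
  have hsin : Real.sin L.im < 0 := by
    by_contra hcon
    exact absurd him (not_lt.2 (mul_nonneg (Real.exp_pos _).le (not_lt.1 hcon)))
  have b1 : L.im < 0 := by
    by_contra hcon
    exact absurd (Real.sin_nonneg_of_nonneg_of_le_pi (not_lt.1 hcon) (by linarith))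
      (not_le.2 hsin)
  have b2 : -Real.pi < L.im := by
    by_contra hcon
    have : 0 ≤ Real.sin (L.im + 2 * Real.pi) :=
      Real.sin_nonneg_of_nonneg_of_le_pi (by linarith) (by linarith)
    rw [Real.sin_add_two_pi] at this
    linarith
  have hL2 : (L / 2).im = L.im / 2 := by simp
  rw [hq, Complex.exp_re, Complex.exp_im, hL2]
  constructor
  · exact mul_pos (Real.exp_pos _) (Real.cos_pos_of_mem_Ioo ⟨by linarith, by linarith⟩)
  · exact mul_neg_of_pos_of_neg (Real.exp_pos _)
      (Real.sin_neg_of_neg_of_neg_pi_lt (by linarith) (by linarith))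

end UpperHalfPlane

namespace Regular

variable {d σ τ x : ℝ} (h : Regular d σ τ x)
include h

lemma hasDerivAt_phi {z : ℂ} (hz : 0 < z.im) :
    HasDerivAt (phi σ τ x) ((z - zPlus σ τ x) * phiQuot σ τ x z) z := by
  have n1 := one_sub_ne_zero_of_im_pos hz
  have n2 := one_add_ne_zero_of_im_pos hz
  have n3 := ofReal_sub_ne_zero_of_im_pos hz x
  have d1 := ((hasDerivAt_id z).const_sub 1).clog (one_sub_mem_slitPlane hz)
  have d2 := ((hasDerivAt_id z).const_add 1).clog (one_add_mem_slitPlane hz)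
  have d3 := ((hasDerivAt_id z).const_sub (x : ℂ)).clog (ofReal_sub_mem_slitPlane hz x)
  have d4 := ((d1.const_mul (-(1 + τ : ℂ))).sub (d2.const_mul (1 - τ : ℂ))).add
    (d3.const_mul (1 - σ : ℂ))
  refine d4.congr_deriv ?_
  have hs : (1 + σ : ℂ) ≠ 0 := by exact_mod_cast h.one_add_sigma_pos.ne'
  have hsum : zPlus σ τ x + (starRingEnd ℂ) (zPlus σ τ x) = 2 * (x - τ) / (1 + σ) := by
    rw [Complex.add_conj, h.zPlus_re]; push_cast; ring
  have hprod : zPlus σ τ x * (starRingEnd ℂ) (zPlus σ τ x) =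
      (1 - 2 * τ * x - σ) / (1 + σ) := by
    rw [Complex.mul_conj, Complex.normSq_apply, h.zPlus_re, h.zPlus_im]
    have hU := h.U_sq
    have := h.one_add_sigma_pos.ne'
    have hr : (x - τ) / (1 + σ) * ((x - τ) / (1 + σ)) + U σ τ x / (1 + σ) * (U σ τ x / (1 + σ))
        = (1 - 2 * τ * x - σ) / (1 + σ) := by
      field_simp
      linear_combination hU
    rw [hr]; push_cast; ring
  have hsum' := (eq_div_iff hs).1 hsum
  have hprod' := (eq_div_iff hs).1 hprod
  simp only [phiQuot, id]
  field_simp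
  linear_combination -z * hsum' + hprod'

lemma phiQuot_zPlus :
    phiQuot σ τ x (zPlus σ τ x) = -2 * Complex.I * U σ τ x * saddleAmp x (zPlus σ τ x) ^ 2 := by
  have hs : (1 + σ : ℂ) ≠ 0 := by exact_mod_cast h.one_add_sigma_pos.ne'
  rw [saddleAmp_sq, phiQuot, Complex.sub_conj, h.zPlus_im, div_eq_mul_inv]
  congr 1
  push_cast
  field_simp

lemma norm_one_sub_zPlus_le : ‖1 - zPlus σ τ x‖ ≤ 2 := by
  refine le_of_sq_le_sq ?_ two_pos.le
  rw [h.normSq_one_sub_zPlus, div_le_iff₀ h.one_add_sigma_pos]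
  nlinarith [h.tau_le, h.one_add_tau_pos, h.one_add_pos, h.one_sub_pos]

lemma norm_one_add_zPlus_le : ‖1 + zPlus σ τ x‖ ≤ 2 := by
  refine le_of_sq_le_sq ?_ two_pos.le
  rw [h.normSq_one_add_zPlus, div_le_iff₀ h.one_add_sigma_pos]
  nlinarith [h.neg_tau_le, h.one_sub_tau_pos, h.one_add_pos, h.one_sub_pos]

lemma norm_sub_zPlus_le : ‖(x : ℂ) - zPlus σ τ x‖ ≤ 1 := by
  refine le_of_sq_le_sq ?_ zero_le_one
  rw [h.normSq_sub_zPlus, div_le_iff₀ h.one_add_sigma_pos]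
  nlinarith [h.one_sub_sigma_pos, h.sigma_nonneg, sq_nonneg x]

lemma le_norm_phiQuot_zPlus : d / 2 ≤ ‖phiQuot σ τ x (zPlus σ τ x)‖ := by
  have n1 := one_sub_ne_zero_of_im_pos h.zPlus_im_pos
  have n2 := one_add_ne_zero_of_im_pos h.zPlus_im_pos
  have n3 := ofReal_sub_ne_zero_of_im_pos h.zPlus_im_pos x
  rw [h.phiQuot_zPlus, saddleAmp_sq]
  simp only [norm_mul, norm_inv, norm_neg, Complex.norm_I, Complex.norm_ofNat, Complex.norm_real,
    Real.norm_of_nonneg h.U_pos.le]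
  have hden : ‖1 - zPlus σ τ x‖ * ‖1 + zPlus σ τ x‖ * ‖(x : ℂ) - zPlus σ τ x‖ ≤ 2 * 2 * 1 := by
    gcongr
    · exact h.norm_one_sub_zPlus_le
    · exact h.norm_one_add_zPlus_le
    · exact h.norm_sub_zPlus_le
  have hpos : 0 < ‖1 - zPlus σ τ x‖ * ‖1 + zPlus σ τ x‖ * ‖(x : ℂ) - zPlus σ τ x‖ := by positivity
  rw [← div_eq_mul_inv, le_div_iff₀ hpos]
  nlinarith [h.le_U, h.pos]

lemma im_of_mem_ball {z : ℂ} (hz : z ∈ Metric.ball (zPlus σ τ x) (d / 4)) : d / 4 ≤ z.im := by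
  have h1 := Complex.abs_im_le_norm (z - zPlus σ τ x)
  rw [Metric.mem_ball, dist_eq_norm] at hz
  rw [Complex.sub_im] at h1
  linarith [h.le_zPlus_im, (abs_le.1 (h1.trans hz.le)).1]

lemma im_pos_of_mem_ball {z : ℂ} (hz : z ∈ Metric.ball (zPlus σ τ x) (d / 4)) : 0 < z.im :=
  (by linarith [h.pos] : 0 < d / 4).trans_le (h.im_of_mem_ball hz)

lemma norm_inv_poly_le {z : ℂ} (hz : z ∈ Metric.ball (zPlus σ τ x) (d / 4)) :
    ‖((1 - z) * (1 + z) * (x - z))⁻¹‖ ≤ ((d / 4)⁻¹) ^ 3 := by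
  have h4 : 0 < d / 4 := by linarith [h.pos]
  have hi := h.im_of_mem_ball hz
  have e1 := norm_inv_ofReal_sub_le h4 hi 1
  have e2 := norm_inv_ofReal_sub_le h4 hi (-1)
  have e3 := norm_inv_ofReal_sub_le h4 hi x
  have e2' : ‖(1 + z)⁻¹‖ ≤ (d / 4)⁻¹ := by
    rw [norm_inv, ← norm_neg, ← norm_inv]; simpa [sub_eq_add_neg, add_comm] using e2
  rw [mul_inv, mul_inv, norm_mul, norm_mul, pow_succ, pow_two]
  push_cast at e1
  gcongr

lemma norm_phiQuot_le {z : ℂ} (hz : z ∈ Metric.ball (zPlus σ τ x) (d / 4)) :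
    ‖phiQuot σ τ x z‖ ≤ 6 * ((d / 4)⁻¹) ^ 3 := by
  rw [phiQuot, div_eq_mul_inv, norm_mul]
  refine mul_le_mul ?_ (h.norm_inv_poly_le hz) (norm_nonneg _) (by norm_num)
  rw [norm_mul, norm_neg]
  have e1 : ‖(1 + σ : ℂ)‖ ≤ 2 := by
    have : (1 + σ : ℂ) = ((1 + σ : ℝ) : ℂ) := by push_cast; ring
    rw [this, Complex.norm_real, Real.norm_of_nonneg h.one_add_sigma_pos.le]
    linarith [h.one_sub_sigma_pos]
  have e2 : ‖z - (starRingEnd ℂ) (zPlus σ τ x)‖ ≤ 3 := by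
    have : z - (starRingEnd ℂ) (zPlus σ τ x) =
        (z - zPlus σ τ x) + (zPlus σ τ x - (starRingEnd ℂ) (zPlus σ τ x)) := by ring
    rw [this, Complex.sub_conj]
    rw [Metric.mem_ball, dist_eq_norm] at hz
    refine (norm_add_le _ _).trans ?_
    have : ‖((2 * (zPlus σ τ x).im : ℝ) : ℂ) * Complex.I‖ ≤ 2 := by
      rw [norm_mul, Complex.norm_I, mul_one, Complex.norm_real,
        Real.norm_of_nonneg (by linarith [h.zPlus_im_pos]), h.zPlus_im]
      have : U σ τ x / (1 + σ) ≤ 1 := by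
        rw [div_le_one h.one_add_sigma_pos]; linarith [h.U_le_one, h.sigma_nonneg]
      linarith
    linarith [h.le_one]
  calc _ ≤ 2 * (3 : ℝ) := by gcongr
    _ = 6 := by norm_num

lemma norm_saddleAmp_sq_le {z : ℂ} (hz : z ∈ Metric.ball (zPlus σ τ x) (d / 4)) :
    ‖saddleAmp x z‖ ^ 2 ≤ ((d / 4)⁻¹) ^ 3 := by
  rw [← norm_pow, saddleAmp_sq]
  exact h.norm_inv_poly_le hz

end Regular

/-! ### The circle through the saddle point -/

/-- The distance from `x` to the saddle points `z₊` and its conjugate. -/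
noncomputable def saddleRadius (σ τ x : ℝ) : ℝ := ‖(x : ℂ) - zPlus σ τ x‖

/-- The polar angle of `z₊` as seen from `x`. -/
noncomputable def saddleAngle (σ τ x : ℝ) : ℝ := (zPlus σ τ x - x).arg

/-- The point at angle `θ` of the circle centred at `x` through the saddle points. -/
noncomputable def circlePt (σ τ x θ : ℝ) : ℂ :=
  x + saddleRadius σ τ x * Complex.exp (θ * Complex.I)

/-- The normalised height `t = R (1 + σ) (cos θ - cos θ₊)`; both `|1 - z|²` and `|1 + z|²` are
affine functions of `t` on the circle. -/
noncomputable def circleHeight (σ τ x θ : ℝ) : ℝ :=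
  saddleRadius σ τ x * (1 + σ) * (Real.cos θ - Real.cos (saddleAngle σ τ x))

lemma circlePt_re (σ τ x θ : ℝ) :
    (circlePt σ τ x θ).re = x + saddleRadius σ τ x * Real.cos θ := by
  rw [circlePt, Complex.add_re, Complex.re_ofReal_mul, Complex.exp_ofReal_mul_I_re,
    Complex.ofReal_re]

lemma circlePt_im (σ τ x θ : ℝ) :
    (circlePt σ τ x θ).im = saddleRadius σ τ x * Real.sin θ := by
  rw [circlePt, Complex.add_im, Complex.im_ofReal_mul, Complex.exp_ofReal_mul_I_im,
    Complex.ofReal_im, zero_add]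

lemma circlePt_saddleAngle (σ τ x : ℝ) : circlePt σ τ x (saddleAngle σ τ x) = zPlus σ τ x := by
  rw [circlePt, saddleRadius, saddleAngle, ← norm_neg, neg_sub, Complex.norm_mul_exp_arg_mul_I]
  ring

lemma norm_sub_circlePt (σ τ x θ : ℝ) : ‖(x : ℂ) - circlePt σ τ x θ‖ = saddleRadius σ τ x := by
  rw [circlePt, sub_add_cancel_left, norm_neg, norm_mul, Complex.norm_exp_ofReal_mul_I, mul_one,
    Complex.norm_real, saddleRadius, norm_norm]

/-- Second order refinement of `1 + u ≤ exp u`, which holds for nonpositive `u` only. -/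
lemma one_add_le_exp_sub_sq {u : ℝ} (h1 : -1 ≤ u) (h0 : u ≤ 0) :
    1 + u ≤ Real.exp (u - u ^ 2 / 2) := by
  rcases h1.eq_or_lt with rfl | h1
  · simpa using (Real.exp_pos _).le
  have hs := Real.hasSum_pow_div_log_of_abs_lt_one (x := -u)
    (by rw [abs_lt]; constructor <;> linarith)
  have hu : 0 ≤ -u := by linarith
  have := sum_le_hasSum (Finset.range 2) (fun i _ => by positivity) hs
  rw [← Real.log_le_iff_le_exp (by linarith)]
  simp [Finset.sum_range_succ] at this
  norm_num at this
  linarith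

/-- The exponent in `1 + u ≤ exp (expBound u)`, quadratically improved for `u ≤ 0`. -/
noncomputable def expBound (u : ℝ) : ℝ := if u ≤ 0 then u - u ^ 2 / 2 else u

lemma one_add_le_exp_expBound {u : ℝ} (h1 : -1 ≤ u) : 1 + u ≤ Real.exp (expBound u) := by
  unfold expBound
  split_ifs with h0
  · exact one_add_le_exp_sub_sq h1 h0
  · linarith [Real.add_one_le_exp u]

lemma neg_expBound_le (u : ℝ) : -expBound u ≤ |u| + u ^ 2 / 2 := by
  unfold expBound
  split_ifs <;> linarith [neg_abs_le u, sq_nonneg u]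

/-- A sum of two concave functions with cancelling first order terms. -/
lemma weighted_expBound_le {τ t : ℝ} (h1 : 0 < 1 + τ) (h2 : 0 < 1 - τ) :
    (1 + τ) * expBound (-(t / (1 + τ))) + (1 - τ) * expBound (t / (1 - τ)) ≤ -(t ^ 2 / 4) := by
  have key : ∀ s : ℝ, 0 < s → s ≤ 2 → ∀ y : ℝ, s * (y / s - (y / s) ^ 2 / 2) ≤ y - y ^ 2 / 4 := by
    intro s hs hs2 y
    have : s * (y / s - (y / s) ^ 2 / 2) = y - y ^ 2 / (2 * s) := by field_simp
    rw [this]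
    have : y ^ 2 / 4 ≤ y ^ 2 / (2 * s) := by gcongr; linarith
    linarith
  have key' : ∀ s : ℝ, 0 < s → ∀ y : ℝ, s * expBound (y / s) ≤ y := by
    intro s hs y
    have hle : expBound (y / s) ≤ y / s := by
      unfold expBound; split_ifs <;> linarith [sq_nonneg (y / s)]
    calc _ ≤ s * (y / s) := by gcongr
      _ = y := by field_simp
  rw [← neg_div]
  rcases le_total 0 t with ht | ht
  · have e1 := key (1 + τ) h1 (by linarith) (-t)
    have e2 := key' (1 - τ) h2 t
    rw [expBound, if_pos (div_nonpos_of_nonpos_of_nonneg (by linarith) h1.le)]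
    linarith
  · have e1 := key (1 - τ) h2 (by linarith) t
    have e2 := key' (1 + τ) h1 (-t)
    nth_rw 2 [expBound]
    rw [if_pos (div_nonpos_of_nonpos_of_nonneg ht h2.le)]
    linarith

lemma sq_le_abs_cos_sub_cos {θ θ' : ℝ} (h0 : 0 ≤ θ) (h1 : θ ≤ Real.pi) (h0' : 0 ≤ θ')
    (h1' : θ' ≤ Real.pi) :
    2 * ((θ - θ') / Real.pi) ^ 2 ≤ |Real.cos θ - Real.cos θ'| := by
  wlog hle : θ ≤ θ' generalizing θ θ'
  · have := this h0' h1' h0 h1 (le_of_not_ge hle)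
    rw [abs_sub_comm]
    convert this using 1
    ring
  have hpi := Real.pi_pos
  set s := (θ' - θ) / 2 with hs
  have hs0 : 0 ≤ s := by rw [hs]; linarith
  have hsin0 : 2 / Real.pi * s ≤ Real.sin s := Real.mul_le_sin hs0 (by rw [hs]; linarith)
  have hm : Real.sin s ≤ Real.sin ((θ + θ') / 2) := by
    have := Real.sin_sub_sin ((θ + θ') / 2) s
    have e1 : ((θ + θ') / 2 - s) / 2 = θ / 2 := by rw [hs]; ring
    have e2 : ((θ + θ') / 2 + s) / 2 = θ' / 2 := by rw [hs]; ring
    rw [e1, e2] at this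
    have p1 : 0 ≤ Real.sin (θ / 2) :=
      Real.sin_nonneg_of_nonneg_of_le_pi (by linarith) (by linarith)
    have p2 : 0 ≤ Real.cos (θ' / 2) := Real.cos_nonneg_of_mem_Icc ⟨by linarith, by linarith⟩
    nlinarith [mul_nonneg p1 p2]
  have hq : 0 ≤ 2 / Real.pi * s := by positivity
  have hcos : Real.cos θ - Real.cos θ' = 2 * Real.sin ((θ + θ') / 2) * Real.sin s := by
    rw [Real.cos_sub_cos, show (θ - θ') / 2 = -s by rw [hs]; ring, Real.sin_neg]; ring
  rw [hcos]
  calc 2 * ((θ - θ') / Real.pi) ^ 2 = 2 * ((2 / Real.pi * s) * (2 / Real.pi * s)) := by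
        rw [hs]; ring
    _ ≤ 2 * (Real.sin ((θ + θ') / 2) * Real.sin s) := by
        gcongr 2 * ?_
        exact mul_le_mul (hsin0.trans hm) hsin0 hq (hq.trans (hsin0.trans hm))
    _ = 2 * Real.sin ((θ + θ') / 2) * Real.sin s := by ring
    _ ≤ _ := le_abs_self _

namespace Regular

variable {d σ τ x : ℝ} (h : Regular d σ τ x)
include h

lemma saddleRadius_pos : 0 < saddleRadius σ τ x :=
  norm_pos_iff.2 (ofReal_sub_ne_zero_of_im_pos h.zPlus_im_pos x)

lemma saddleRadius_le_one : saddleRadius σ τ x ≤ 1 := h.norm_sub_zPlus_le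

lemma saddleRadius_mul_sq :
    (saddleRadius σ τ x * (1 + σ)) ^ 2 = (1 - σ ^ 2) * (1 - x ^ 2) := by
  rw [mul_pow, saddleRadius, h.normSq_sub_zPlus]
  have := h.one_add_sigma_pos.ne'
  field_simp
  ring

lemma le_saddleRadius_mul : d ≤ saddleRadius σ τ x * (1 + σ) := by
  refine le_of_sq_le_sq ?_ (mul_pos h.saddleRadius_pos h.one_add_sigma_pos).le
  rw [h.saddleRadius_mul_sq, pow_two]
  have h1 : d ≤ 1 - σ ^ 2 := by nlinarith [h.le_one_sub_sigma, h.sigma_nonneg, h.one_sub_sigma_pos]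
  have := h.le_one_sub_sq
  have := h.pos
  gcongr
  linarith

lemma saddleRadius_mul_le : saddleRadius σ τ x * (1 + σ) ≤ 1 := by
  refine le_of_sq_le_sq ?_ zero_le_one
  rw [h.saddleRadius_mul_sq]
  have h1 : 0 ≤ 1 - σ ^ 2 := by nlinarith [h.sigma_nonneg, h.one_sub_sigma_pos]
  nlinarith [sq_nonneg σ, sq_nonneg x, h.le_one_sub_sq, h.pos]

lemma half_le_saddleRadius : d / 2 ≤ saddleRadius σ τ x := by
  have := h.le_saddleRadius_mul
  nlinarith [h.saddleRadius_pos, h.one_sub_sigma_pos]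

lemma saddleAngle_mem : d ≤ saddleAngle σ τ x ∧ saddleAngle σ τ x ≤ Real.pi - d := by
  have hsin : d ≤ Real.sin (saddleAngle σ τ x) := by
    have e := circlePt_im σ τ x (saddleAngle σ τ x)
    rw [circlePt_saddleAngle, h.zPlus_im, div_eq_iff h.one_add_sigma_pos.ne'] at e
    have p : 0 < Real.sin (saddleAngle σ τ x) := by
      have := h.U_pos
      rw [e] at this
      by_contra hc
      have : saddleRadius σ τ x * Real.sin (saddleAngle σ τ x) * (1 + σ) ≤ 0 := by
        apply mul_nonpos_of_nonpos_of_nonneg _ h.one_add_sigma_pos.le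
        exact mul_nonpos_of_nonneg_of_nonpos h.saddleRadius_pos.le (not_lt.1 hc)
      linarith
    have := h.le_U
    rw [e] at this
    nlinarith [h.saddleRadius_mul_le]
  have h0 : 0 ≤ saddleAngle σ τ x := by
    rw [saddleAngle, Complex.arg_nonneg_iff]
    simpa using h.zPlus_im_pos.le
  have h1 : saddleAngle σ τ x ≤ Real.pi := Complex.arg_le_pi _
  refine ⟨hsin.trans (Real.sin_le h0), ?_⟩
  rw [← Real.sin_pi_sub] at hsin
  linarith [Real.sin_le (sub_nonneg.2 h1)]

lemma normSq_one_sub_circlePt (θ : ℝ) : ‖1 - circlePt σ τ x θ‖ ^ 2 =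
    ‖1 - zPlus σ τ x‖ ^ 2 * (1 + -(circleHeight σ τ x θ / (1 + τ))) := by
  have e : ∀ θ, ‖1 - circlePt σ τ x θ‖ ^ 2 =
      (1 - x) ^ 2 - 2 * (1 - x) * saddleRadius σ τ x * Real.cos θ + saddleRadius σ τ x ^ 2 := by
    intro θ
    rw [← Complex.normSq_eq_norm_sq, Complex.normSq_apply, Complex.sub_re, Complex.sub_im,
      circlePt_re, circlePt_im, Complex.one_re, Complex.one_im]
    linear_combination saddleRadius σ τ x ^ 2 * Real.sin_sq_add_cos_sq θ
  have e2 := e (saddleAngle σ τ x)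
  rw [circlePt_saddleAngle] at e2
  have e3 : ‖1 - zPlus σ τ x‖ ^ 2 * (circleHeight σ τ x θ / (1 + τ)) =
      2 * (1 - x) * saddleRadius σ τ x * (Real.cos θ - Real.cos (saddleAngle σ τ x)) := by
    rw [h.normSq_one_sub_zPlus, circleHeight]
    have := h.one_add_tau_pos.ne'
    have := h.one_add_sigma_pos.ne'
    field_simp
  rw [e θ]
  linear_combination -e2 + e3

lemma normSq_one_add_circlePt (θ : ℝ) : ‖1 + circlePt σ τ x θ‖ ^ 2 =
    ‖1 + zPlus σ τ x‖ ^ 2 * (1 + circleHeight σ τ x θ / (1 - τ)) := by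
  have e : ∀ θ, ‖1 + circlePt σ τ x θ‖ ^ 2 =
      (1 + x) ^ 2 + 2 * (1 + x) * saddleRadius σ τ x * Real.cos θ + saddleRadius σ τ x ^ 2 := by
    intro θ
    rw [← Complex.normSq_eq_norm_sq, Complex.normSq_apply, Complex.add_re, Complex.add_im,
      circlePt_re, circlePt_im, Complex.one_re, Complex.one_im]
    linear_combination saddleRadius σ τ x ^ 2 * Real.sin_sq_add_cos_sq θ
  have e2 := e (saddleAngle σ τ x)
  rw [circlePt_saddleAngle] at e2
  have e3 : ‖1 + zPlus σ τ x‖ ^ 2 * (circleHeight σ τ x θ / (1 - τ)) =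
      2 * (1 + x) * saddleRadius σ τ x * (Real.cos θ - Real.cos (saddleAngle σ τ x)) := by
    rw [h.normSq_one_add_zPlus, circleHeight]
    have := h.one_sub_tau_pos.ne'
    have := h.one_add_sigma_pos.ne'
    field_simp
  rw [e θ]
  linear_combination -e2 - e3

lemma norm_one_sub_zPlus_pos : 0 < ‖1 - zPlus σ τ x‖ :=
  norm_pos_iff.2 (one_sub_ne_zero_of_im_pos h.zPlus_im_pos)

lemma norm_one_add_zPlus_pos : 0 < ‖1 + zPlus σ τ x‖ :=
  norm_pos_iff.2 (one_add_ne_zero_of_im_pos h.zPlus_im_pos)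

lemma norm_one_sub_circlePt_le (θ : ℝ) : ‖1 - circlePt σ τ x θ‖ ≤
    ‖1 - zPlus σ τ x‖ * Real.exp (expBound (-(circleHeight σ τ x θ / (1 + τ))) / 2) := by
  have hp := h.norm_one_sub_zPlus_pos
  refine le_of_sq_le_sq ?_ (by positivity)
  have e := h.normSq_one_sub_circlePt θ
  have h1 : 0 ≤ 1 + -(circleHeight σ τ x θ / (1 + τ)) :=
    nonneg_of_mul_nonneg_right (e ▸ sq_nonneg _) (by positivity)
  rw [e, mul_pow, ← Real.exp_nat_mul]
  gcongr
  refine (one_add_le_exp_expBound (by linarith : -1 ≤ -(circleHeight σ τ x θ / (1 + τ)))).trans_eq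
    ?_
  rw [Nat.cast_ofNat, mul_div_cancel₀ _ two_ne_zero]

lemma norm_one_add_circlePt_le (θ : ℝ) : ‖1 + circlePt σ τ x θ‖ ≤
    ‖1 + zPlus σ τ x‖ * Real.exp (expBound (circleHeight σ τ x θ / (1 - τ)) / 2) := by
  have hp := h.norm_one_add_zPlus_pos
  refine le_of_sq_le_sq ?_ (by positivity)
  have e := h.normSq_one_add_circlePt θ
  have h1 : 0 ≤ 1 + circleHeight σ τ x θ / (1 - τ) :=
    nonneg_of_mul_nonneg_right (e ▸ sq_nonneg _) (by positivity)
  rw [e, mul_pow, ← Real.exp_nat_mul]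
  gcongr
  refine (one_add_le_exp_expBound (by linarith : -1 ≤ circleHeight σ τ x θ / (1 - τ))).trans_eq ?_
  rw [Nat.cast_ofNat, mul_div_cancel₀ _ two_ne_zero]

lemma abs_circleHeight_le (θ : ℝ) : |circleHeight σ τ x θ| ≤ 2 := by
  rw [circleHeight, abs_mul, abs_of_pos (mul_pos h.saddleRadius_pos h.one_add_sigma_pos)]
  have : |Real.cos θ - Real.cos (saddleAngle σ τ x)| ≤ 2 := by
    rw [abs_le]
    constructor <;> linarith [Real.cos_le_one θ, Real.neg_one_le_cos θ,
      Real.cos_le_one (saddleAngle σ τ x), Real.neg_one_le_cos (saddleAngle σ τ x)]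
  calc _ ≤ 1 * (2 : ℝ) := by gcongr; exact h.saddleRadius_mul_le
    _ = 2 := by norm_num

/-- The circle is a path of steepest-descent type: the modulus of the integrand has its only
maximum on the upper half of the circle at the saddle point, with a quantitative drop. -/
lemma rpow_mul_rpow_circlePt_le {κ a b : ℝ} (hκ : 0 ≤ κ) (ha : a = κ * (1 + τ) - 1 / 2)
    (hb : b = κ * (1 - τ) - 1 / 2) (ha0 : 0 ≤ a) (hb0 : 0 ≤ b) (θ : ℝ) :
    ‖1 - circlePt σ τ x θ‖ ^ a * ‖1 + circlePt σ τ x θ‖ ^ b ≤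
      ‖1 - zPlus σ τ x‖ ^ a * ‖1 + zPlus σ τ x‖ ^ b *
        (Real.exp (1 / d + 1 / d ^ 2) * Real.exp (-(κ * circleHeight σ τ x θ ^ 2 / 8))) := by
  have hp1 := h.norm_one_sub_zPlus_pos
  have hp2 := h.norm_one_add_zPlus_pos
  have hd := h.pos
  set t := circleHeight σ τ x θ with ht
  set u := expBound (-(t / (1 + τ))) with hu
  set v := expBound (t / (1 - τ)) with hv
  have main := weighted_expBound_le (t := t) h.one_add_tau_pos h.one_sub_tau_pos
  have ht2 := h.abs_circleHeight_le θ
  have bnd : ∀ s : ℝ, d ≤ s → |t / s| + (t / s) ^ 2 / 2 ≤ 2 / d + 2 / d ^ 2 := by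
    intro s hs
    have h1 : |t / s| ≤ 2 / d := by
      rw [abs_div, abs_of_pos (hd.trans_le hs)]; gcongr
    have h2 : (t / s) ^ 2 ≤ (2 / d) ^ 2 := by rw [← sq_abs]; gcongr
    have : (2 / d) ^ 2 / 2 = 2 / d ^ 2 := by field_simp
    linarith
  have bu : -u ≤ 2 / d + 2 / d ^ 2 := by
    have := neg_expBound_le (-(t / (1 + τ)))
    rw [abs_neg, neg_sq] at this
    exact this.trans (bnd _ h.le_one_add_tau)
  have bv : -v ≤ 2 / d + 2 / d ^ 2 := (neg_expBound_le _).trans (bnd _ h.le_one_sub_tau)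
  have hexp : u / 2 * a + v / 2 * b ≤ 1 / d + 1 / d ^ 2 + -(κ * t ^ 2 / 8) := by
    have := mul_le_mul_of_nonneg_left main hκ
    have e1 : (2 : ℝ) / d = 2 * (1 / d) := by ring
    have e2 : (2 : ℝ) / d ^ 2 = 2 * (1 / d ^ 2) := by ring
    rw [ha, hb]
    nlinarith
  calc ‖1 - circlePt σ τ x θ‖ ^ a * ‖1 + circlePt σ τ x θ‖ ^ b
      ≤ (‖1 - zPlus σ τ x‖ * Real.exp (u / 2)) ^ a *
          (‖1 + zPlus σ τ x‖ * Real.exp (v / 2)) ^ b := by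
        gcongr
        · exact h.norm_one_sub_circlePt_le θ
        · exact h.norm_one_add_circlePt_le θ
    _ = ‖1 - zPlus σ τ x‖ ^ a * ‖1 + zPlus σ τ x‖ ^ b * Real.exp (u / 2 * a + v / 2 * b) := by
        rw [Real.mul_rpow hp1.le (Real.exp_pos _).le, Real.mul_rpow hp2.le (Real.exp_pos _).le,
          ← Real.exp_mul, ← Real.exp_mul, Real.exp_add]
        ring
    _ ≤ _ := by
        rw [← Real.exp_add]
        gcongr

lemma sq_le_re_phi_circlePt_sub {θ : ℝ} (h0 : 0 < θ) (h1 : θ < Real.pi) :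
    circleHeight σ τ x θ ^ 2 / 8 ≤
      (phi σ τ x (circlePt σ τ x θ) - phi σ τ x (zPlus σ τ x)).re := by
  have him : 0 < (circlePt σ τ x θ).im := by
    rw [circlePt_im]; exact mul_pos h.saddleRadius_pos (Real.sin_pos_of_pos_of_lt_pi h0 h1)
  have hre : ∀ z, (phi σ τ x z).re = -(1 + τ) * Real.log ‖1 - z‖ - (1 - τ) * Real.log ‖1 + z‖
      + (1 - σ) * Real.log ‖(x : ℂ) - z‖ := by
    intro z
    have e1 : (-(1 + τ) : ℂ) = ((-(1 + τ) : ℝ) : ℂ) := by push_cast; ring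
    have e2 : ((1 - τ) : ℂ) = ((1 - τ : ℝ) : ℂ) := by push_cast; ring
    have e3 : ((1 - σ) : ℂ) = ((1 - σ : ℝ) : ℂ) := by push_cast; ring
    rw [phi, e1, e2, e3, Complex.add_re, Complex.sub_re, Complex.re_ofReal_mul,
      Complex.re_ofReal_mul, Complex.re_ofReal_mul, Complex.log_re, Complex.log_re, Complex.log_re]
  have n1 : 0 < ‖1 - circlePt σ τ x θ‖ := norm_pos_iff.2 (one_sub_ne_zero_of_im_pos him)
  have n2 : 0 < ‖1 + circlePt σ τ x θ‖ := norm_pos_iff.2 (one_add_ne_zero_of_im_pos him)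
  have l1 := Real.log_le_log n1 (h.norm_one_sub_circlePt_le θ)
  have l2 := Real.log_le_log n2 (h.norm_one_add_circlePt_le θ)
  rw [Real.log_mul h.norm_one_sub_zPlus_pos.ne' (Real.exp_pos _).ne', Real.log_exp] at l1
  rw [Real.log_mul h.norm_one_add_zPlus_pos.ne' (Real.exp_pos _).ne', Real.log_exp] at l2
  rw [Complex.sub_re, hre, hre, norm_sub_circlePt, ← saddleRadius]
  have main := weighted_expBound_le (t := circleHeight σ τ x θ) h.one_add_tau_pos h.one_sub_tau_pos
  have m1 := mul_le_mul_of_nonneg_left l1 h.one_add_tau_pos.le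
  have m2 := mul_le_mul_of_nonneg_left l2 h.one_sub_tau_pos.le
  linarith

lemma le_circleHeight_sq {θ : ℝ} (h0 : 0 ≤ θ) (h1 : θ ≤ Real.pi) :
    4 * d ^ 2 * ((θ - saddleAngle σ τ x) / Real.pi) ^ 4 ≤ circleHeight σ τ x θ ^ 2 := by
  have hm := h.saddleAngle_mem
  have hd := h.pos
  have := sq_le_abs_cos_sub_cos h0 h1 (by linarith : 0 ≤ saddleAngle σ τ x) (by linarith)
  rw [circleHeight, mul_pow, ← sq_abs (Real.cos θ - _)]
  calc 4 * d ^ 2 * ((θ - saddleAngle σ τ x) / Real.pi) ^ 4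
      = d ^ 2 * (2 * ((θ - saddleAngle σ τ x) / Real.pi) ^ 2) ^ 2 := by ring
    _ ≤ _ := by
      gcongr
      exact h.le_saddleRadius_mul

end Regular

/-! ### The contour integral -/

/-- The function `(1 - z)^a (1 + z)^b` in the closed upper half plane, continuous up to the
boundary: on the cuts `|z| > 1` it takes the boundary values from above. The factors `±i` turn the
principal cuts of the powers into the lower half plane. -/
noncomputable def upperPow (a b : ℝ) (z : ℂ) : ℂ :=
  Complex.exp (-(Complex.I * Real.pi * a / 2)) * (Complex.I * (1 - z)) ^ (a : ℂ) *
    (Complex.exp (Complex.I * Real.pi * b / 2) * (-Complex.I * (1 + z)) ^ (b : ℂ))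

/-- The integrand of the Cauchy integral for the `n`-th Taylor coefficient of
`(1 - z)^a (1 + z)^b` at `x`, in the logarithmic coordinate `z = x + e^ζ`. -/
noncomputable def logIntegrand (n : ℕ) (a b x : ℝ) (ζ : ℂ) : ℂ :=
  upperPow a b (x + Complex.exp ζ) * Complex.exp (-(n * ζ))

lemma continuousAt_cpow_const_of_re_nonneg {a : ℝ} (ha : 0 ≤ a) {f : ℂ → ℂ} {z : ℂ}
    (hf : ContinuousAt f z) (hre : 0 ≤ (f z).re) :
    ContinuousAt (fun z => f z ^ (a : ℂ)) z := by
  rcases ha.eq_or_lt with rfl | ha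
  · simpa using continuousAt_const
  · exact (Complex.continuousAt_cpow_const_of_re_pos (Or.inl hre) (by simpa using ha)).comp hf

lemma continuousAt_upperPow {a b : ℝ} (ha : 0 ≤ a) (hb : 0 ≤ b) {z : ℂ} (hz : 0 ≤ z.im) :
    ContinuousAt (upperPow a b) z := by
  unfold upperPow
  refine (continuousAt_const.mul (continuousAt_cpow_const_of_re_nonneg ha (by fun_prop) ?_)).mul
    (continuousAt_const.mul (continuousAt_cpow_const_of_re_nonneg hb (by fun_prop) ?_))
  · simpa using hz
  · simpa using hz

lemma differentiableAt_upperPow (a b : ℝ) {z : ℂ} (hz : 0 < z.im) :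
    DifferentiableAt ℂ (upperPow a b) z := by
  unfold upperPow
  refine ((DifferentiableAt.cpow (by fun_prop) (by fun_prop) ?_).const_mul _).fun_mul
    ((DifferentiableAt.cpow (by fun_prop) (by fun_prop) ?_).const_mul _)
  · exact Or.inl (by simpa using hz)
  · exact Or.inl (by simpa using hz)

lemma exp_mul_I_mul_cpow {w : ℂ} (a : ℝ) (hw : w ≠ 0) (h1 : -Real.pi < w.arg + Real.pi / 2)
    (h2 : w.arg + Real.pi / 2 ≤ Real.pi) :
    Complex.exp (-(Complex.I * Real.pi * a / 2)) * (Complex.I * w) ^ (a : ℂ) = w ^ (a : ℂ) := by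
  have hl : Complex.log (Complex.I * w) = Complex.log Complex.I + Complex.log w := by
    refine Complex.log_mul Complex.I_ne_zero hw ⟨?_, ?_⟩ <;> rw [Complex.arg_I] <;> linarith
  rw [Complex.cpow_def_of_ne_zero (mul_ne_zero Complex.I_ne_zero hw),
    Complex.cpow_def_of_ne_zero hw, hl, Complex.log_I, ← Complex.exp_add]
  congr 1
  ring

lemma exp_mul_neg_I_mul_cpow {w : ℂ} (a : ℝ) (hw : w ≠ 0) (h1 : -Real.pi < w.arg - Real.pi / 2)
    (h2 : w.arg - Real.pi / 2 ≤ Real.pi) :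
    Complex.exp (Complex.I * Real.pi * a / 2) * (-Complex.I * w) ^ (a : ℂ) = w ^ (a : ℂ) := by
  have hI : -Complex.I ≠ 0 := neg_ne_zero.2 Complex.I_ne_zero
  have hl : Complex.log (-Complex.I * w) = Complex.log (-Complex.I) + Complex.log w := by
    refine Complex.log_mul hI hw ⟨?_, ?_⟩ <;> rw [Complex.arg_neg_I] <;> linarith
  rw [Complex.cpow_def_of_ne_zero (mul_ne_zero hI hw),
    Complex.cpow_def_of_ne_zero hw, hl, Complex.log_neg_I, ← Complex.exp_add]
  congr 1
  ring

lemma upperPow_of_im_pos (a b : ℝ) {z : ℂ} (hz : 0 < z.im) :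
    upperPow a b z = (1 - z) ^ (a : ℂ) * (1 + z) ^ (b : ℂ) := by
  have hpi := Real.pi_pos
  have a2 : (1 - z).arg < 0 := Complex.arg_neg_iff.2 (by simpa using hz)
  have a2' := Complex.neg_pi_lt_arg (1 - z)
  have a3 : 0 ≤ (1 + z).arg := Complex.arg_nonneg_iff.2 (by simpa using hz.le)
  have a3' := Complex.arg_le_pi (1 + z)
  rw [upperPow, exp_mul_I_mul_cpow a (one_sub_ne_zero_of_im_pos hz) (by linarith) (by linarith),
    exp_mul_neg_I_mul_cpow b (one_add_ne_zero_of_im_pos hz) (by linarith) (by linarith)]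

lemma upperPow_ofReal (a b : ℝ) {t : ℝ} (h1 : 0 < 1 - t) (h2 : 0 < 1 + t) :
    upperPow a b t = (((1 - t) ^ a * (1 + t) ^ b : ℝ) : ℂ) := by
  have hpi := Real.pi_pos
  have e1 : (1 - t : ℂ) = ((1 - t : ℝ) : ℂ) := by push_cast; rfl
  have e2 : (1 + t : ℂ) = ((1 + t : ℝ) : ℂ) := by push_cast; rfl
  have b1 : ((1 - t : ℝ) : ℂ).arg = 0 := Complex.arg_ofReal_of_nonneg h1.le
  have b2 : ((1 + t : ℝ) : ℂ).arg = 0 := Complex.arg_ofReal_of_nonneg h2.le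
  rw [upperPow, e1, e2, exp_mul_I_mul_cpow a (by exact_mod_cast h1.ne') (by linarith) (by linarith),
    exp_mul_neg_I_mul_cpow b (by exact_mod_cast h2.ne') (by linarith) (by linarith),
    ← Complex.ofReal_cpow h1.le, ← Complex.ofReal_cpow h2.le, Complex.ofReal_mul]

lemma norm_upperPow (a b : ℝ) (z : ℂ) : ‖upperPow a b z‖ = ‖1 - z‖ ^ a * ‖1 + z‖ ^ b := by
  have e1 : ‖Complex.exp (-(Complex.I * Real.pi * a / 2))‖ = 1 := by
    rw [Complex.norm_exp]; simp
  have e2 : ‖Complex.exp (Complex.I * Real.pi * b / 2)‖ = 1 := by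
    rw [Complex.norm_exp]; simp
  rw [upperPow, norm_mul, norm_mul, norm_mul, e1, e2, Complex.norm_cpow_real,
    Complex.norm_cpow_real, norm_mul, norm_mul, norm_neg, Complex.norm_I]
  simp only [one_mul]

section Contour

variable {a b : ℝ} (ha : 0 ≤ a) (hb : 0 ≤ b) (n : ℕ) (x : ℝ)

lemma norm_logIntegrand (a b : ℝ) (n : ℕ) (x : ℝ) (ζ : ℂ) : ‖logIntegrand n a b x ζ‖ =
    ‖1 - (x + Complex.exp ζ)‖ ^ a * ‖1 + (x + Complex.exp ζ)‖ ^ b * Real.exp (-(n * ζ.re)) := by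
  rw [logIntegrand, norm_mul, norm_upperPow, Complex.norm_exp]
  simp

include ha hb in
/-- Cauchy's theorem for the half annulus `e^l ≤ |z - x| ≤ e^L`, `0 ≤ Im z`. -/
lemma half_annulus_integral_eq (l L : ℝ) :
    ∫ θ in (0 : ℝ)..Real.pi, logIntegrand n a b x (l + θ * Complex.I) =
      (∫ θ in (0 : ℝ)..Real.pi, logIntegrand n a b x (L + θ * Complex.I)) -
        Complex.I * (∫ u in l..L, logIntegrand n a b x u) +
        Complex.I * (∫ u in l..L, logIntegrand n a b x (u + Real.pi * Complex.I)) := by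
  have hpi := Real.pi_pos
  have hc : ContinuousOn (logIntegrand n a b x)
      ((Set.uIcc l L) ×ℂ (Set.uIcc 0 Real.pi)) := by
    intro ζ hζ
    have hi : ζ.im ∈ Set.uIcc 0 Real.pi := hζ.2
    rw [Set.uIcc_of_le hpi.le] at hi
    have him : 0 ≤ ((x : ℂ) + Complex.exp ζ).im := by
      rw [Complex.add_im, Complex.ofReal_im, zero_add, Complex.exp_im]
      exact mul_nonneg (Real.exp_pos _).le (Real.sin_nonneg_of_nonneg_of_le_pi hi.1 hi.2)
    refine ContinuousAt.continuousWithinAt (ContinuousAt.mul ?_ (by fun_prop))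
    exact ContinuousAt.comp (f := fun ζ : ℂ => (x : ℂ) + Complex.exp ζ)
      (continuousAt_upperPow ha hb him) (by fun_prop)
  have hd : DifferentiableOn ℂ (logIntegrand n a b x)
      ((Set.Ioo (min l L) (max l L)) ×ℂ (Set.Ioo (min 0 Real.pi) (max 0 Real.pi))) := by
    intro ζ hζ
    have hi : ζ.im ∈ Set.Ioo (min 0 Real.pi) (max 0 Real.pi) := hζ.2
    rw [min_eq_left hpi.le, max_eq_right hpi.le] at hi
    have him : 0 < ((x : ℂ) + Complex.exp ζ).im := by
      rw [Complex.add_im, Complex.ofReal_im, zero_add, Complex.exp_im]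
      exact mul_pos (Real.exp_pos _) (Real.sin_pos_of_pos_of_lt_pi hi.1 hi.2)
    refine DifferentiableAt.differentiableWithinAt (DifferentiableAt.mul ?_ (by fun_prop))
    exact DifferentiableAt.comp (f := fun ζ : ℂ => (x : ℂ) + Complex.exp ζ) ζ
      (differentiableAt_upperPow a b him) (by fun_prop)
  have := Complex.integral_boundary_rect_eq_zero_of_continuousOn_of_differentiableOn
    (logIntegrand n a b x) l (L + Real.pi * Complex.I) (by simpa using hc) (by simpa using hd)
  simp only [Complex.ofReal_re, Complex.ofReal_im, Complex.add_re, Complex.add_im,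
    Complex.mul_re, Complex.mul_im, Complex.I_re, Complex.I_im, smul_eq_mul, mul_zero, mul_one,
    sub_zero, add_zero, zero_add, zero_mul, Complex.ofReal_zero] at this
  have e := congrArg (Complex.I * ·) this
  simp only [mul_zero] at e
  linear_combination e + (-(∫ θ in (0 : ℝ)..Real.pi, logIntegrand n a b x (L + θ * Complex.I)) +
    (∫ θ in (0 : ℝ)..Real.pi, logIntegrand n a b x (l + θ * Complex.I))) * Complex.I_sq

/-- Monotonicity along the cut: beyond the branch point the modulus of the integrand grows. -/
lemma cut_monotone {y y' p q u L : ℝ} (hp : 0 ≤ p) (hq : 0 ≤ q) (hy : 0 ≤ y) (hy' : 0 ≤ y')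
    (hu : y ≤ Real.exp u) (huL : u ≤ L) :
    (Real.exp u - y) ^ (n + p) * (y' + Real.exp u) ^ q * Real.exp (-(n * u)) ≤
      (Real.exp L - y) ^ (n + p) * (y' + Real.exp L) ^ q * Real.exp (-(n * L)) := by
  have hL : Real.exp u ≤ Real.exp L := Real.exp_le_exp.2 huL
  -- the decreasing factor `e^{-nv}` is absorbed by `n` of the factors `e^v - y`
  have e : ∀ v, y ≤ Real.exp v →
      (Real.exp v - y) ^ (n + p) * (y' + Real.exp v) ^ q * Real.exp (-(n * v)) =
      (1 - y * Real.exp (-v)) ^ n * (Real.exp v - y) ^ p * (y' + Real.exp v) ^ q := by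
    intro v hv
    have h1 : 1 - y * Real.exp (-v) = (Real.exp v - y) * Real.exp (-v) := by
      rw [sub_mul, ← Real.exp_add]; simp
    rw [h1, mul_pow, ← Real.exp_nat_mul, Real.rpow_add_of_nonneg (by linarith) (by positivity) hp,
      Real.rpow_natCast, mul_neg]
    ring
  rw [e u hu, e L (hu.trans hL)]
  have h0 : 0 ≤ 1 - y * Real.exp (-u) := by
    have : y * Real.exp (-u) ≤ Real.exp u * Real.exp (-u) := by gcongr
    rw [← Real.exp_add] at this
    simpa using this
  have hA : 1 - y * Real.exp (-u) ≤ 1 - y * Real.exp (-L) := by gcongr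
  have hB0 : 0 ≤ Real.exp u - y := sub_nonneg.2 hu
  have hB : Real.exp u - y ≤ Real.exp L - y := by gcongr
  have hA0' := h0.trans hA
  have hB0' := hB0.trans hB
  gcongr

end Contour

section Cut

variable {n : ℕ} {α β x u L : ℝ} (hα : 0 ≤ α) (hβ : 0 ≤ β) (h1 : 0 < 1 - x) (h2 : 0 < 1 + x)
  (huL : u ≤ L)
include hα hβ h1 h2 huL

lemma abs_im_logIntegrand_right_le :
    |(logIntegrand n (n + α) (n + β) x u).im| ≤ ‖logIntegrand n (n + α) (n + β) x L‖ := by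
  have hz : ∀ v : ℝ, (x : ℂ) + Complex.exp v = ((x + Real.exp v : ℝ) : ℂ) := by
    intro v; push_cast; rfl
  rcases lt_or_ge (x + Real.exp u) 1 with h | h
  · have he : Complex.exp (-(n * (u : ℂ))) = ((Real.exp (-(n * u)) : ℝ) : ℂ) := by push_cast; rfl
    rw [logIntegrand, hz, upperPow_ofReal _ _ (by linarith) (by linarith [Real.exp_pos u]), he,
      ← Complex.ofReal_mul, Complex.ofReal_im, abs_zero]
    exact norm_nonneg _
  · refine (Complex.abs_im_le_norm _).trans ?_
    have hL := Real.exp_le_exp.2 huL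
    have key : ∀ v, 1 ≤ x + Real.exp v → ‖logIntegrand n (n + α) (n + β) x (v : ℝ)‖ =
        (Real.exp v - (1 - x)) ^ (n + α) * ((1 + x) + Real.exp v) ^ (n + β) *
          Real.exp (-(n * v)) := by
      intro v hv
      have e1 : (1 : ℂ) - ((x + Real.exp v : ℝ) : ℂ) = ((1 - (x + Real.exp v) : ℝ) : ℂ) := by
        push_cast; rfl
      have e2 : (1 : ℂ) + ((x + Real.exp v : ℝ) : ℂ) = ((1 + (x + Real.exp v) : ℝ) : ℂ) := by
        push_cast; rfl
      rw [norm_logIntegrand, hz, e1, e2, Complex.norm_real, Complex.norm_real, Real.norm_eq_abs,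
        Real.norm_eq_abs, abs_of_nonpos (by linarith), abs_of_nonneg (by linarith),
        Complex.ofReal_re, add_assoc]
      congr 3
      ring
    rw [key u h, key L (by linarith)]
    exact cut_monotone n hα (by positivity) h1.le h2.le (by linarith) huL

lemma abs_im_logIntegrand_left_le :
    |(logIntegrand n (n + α) (n + β) x (u + Real.pi * Complex.I)).im| ≤
      ‖logIntegrand n (n + α) (n + β) x (L + Real.pi * Complex.I)‖ := by
  have hz : ∀ v : ℝ, (x : ℂ) + Complex.exp (v + Real.pi * Complex.I) =
      ((x - Real.exp v : ℝ) : ℂ) := by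
    intro v; rw [Complex.exp_add, Complex.exp_pi_mul_I]; push_cast; ring
  rcases lt_or_ge (-1) (x - Real.exp u) with h | h
  · have he : Complex.exp (-(n * ((u : ℂ) + Real.pi * Complex.I))) =
        ((Real.exp (-(n * u)) * (-1) ^ n : ℝ) : ℂ) := by
      have : Complex.exp (-(Real.pi * Complex.I)) = -1 := by
        rw [Complex.exp_neg, Complex.exp_pi_mul_I]; norm_num
      rw [mul_add, neg_add, Complex.exp_add, ← mul_neg (n : ℂ) (Real.pi * Complex.I),
        Complex.exp_nat_mul (-(Real.pi * Complex.I)), this]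
      push_cast
      rfl
    rw [logIntegrand, hz, upperPow_ofReal _ _ (by linarith [Real.exp_pos u]) (by linarith), he,
      ← Complex.ofReal_mul, Complex.ofReal_im, abs_zero]
    exact norm_nonneg _
  · refine (Complex.abs_im_le_norm _).trans ?_
    have hL := Real.exp_le_exp.2 huL
    have key : ∀ v : ℝ, x - Real.exp v ≤ -1 →
        ‖logIntegrand n (n + α) (n + β) x (v + Real.pi * Complex.I)‖ =
        (Real.exp v - (1 + x)) ^ (n + β) * ((1 - x) + Real.exp v) ^ (n + α) *
          Real.exp (-(n * v)) := by
      intro v hv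
      have e1 : (1 : ℂ) - ((x - Real.exp v : ℝ) : ℂ) = ((1 - (x - Real.exp v) : ℝ) : ℂ) := by
        push_cast; rfl
      have e2 : (1 : ℂ) + ((x - Real.exp v : ℝ) : ℂ) = ((1 + (x - Real.exp v) : ℝ) : ℂ) := by
        push_cast; rfl
      rw [norm_logIntegrand, hz, e1, e2, Complex.norm_real, Complex.norm_real, Real.norm_eq_abs,
        Real.norm_eq_abs, abs_of_nonneg (by linarith), abs_of_nonpos (by linarith)]
      have e3 : ((v : ℂ) + Real.pi * Complex.I).re = v := by simp
      rw [e3, mul_comm (_ ^ (n + α))]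
      congr 3 <;> ring
    rw [key u h, key L (by linarith)]
    exact cut_monotone n hβ (by positivity) h2.le h1.le (by linarith) huL

end Cut

/-- Passing from a small half circle to a large one: only the real parts of the half circle
integrals are compared, so the cuts contribute through the imaginary part of the integrand, which
vanishes between the branch points. -/
lemma abs_re_half_circle_sub_le {n : ℕ} {α β x l L : ℝ} (hα : 0 ≤ α) (hβ : 0 ≤ β)
    (h1 : 0 < 1 - x) (h2 : 0 < 1 + x) (hlL : l ≤ L) :
    |(∫ θ in (0 : ℝ)..Real.pi, logIntegrand n (n + α) (n + β) x (l + θ * Complex.I)).re -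
      (∫ θ in (0 : ℝ)..Real.pi, logIntegrand n (n + α) (n + β) x (L + θ * Complex.I)).re| ≤
    (‖logIntegrand n (n + α) (n + β) x L‖ +
      ‖logIntegrand n (n + α) (n + β) x (L + Real.pi * Complex.I)‖) * (L - l) := by
  have ha : 0 ≤ n + α := by positivity
  have hb : 0 ≤ n + β := by positivity
  have hpi := Real.pi_pos
  have hcont : ∀ y : ℝ, 0 ≤ y → y ≤ Real.pi → Continuous fun u : ℝ =>
      logIntegrand n (n + α) (n + β) x (u + y * Complex.I) := by
    intro y hy0 hy1
    rw [continuous_iff_continuousAt]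
    intro u
    refine ContinuousAt.mul ?_ (by fun_prop)
    refine ContinuousAt.comp (f := fun u : ℝ => (x : ℂ) + Complex.exp (u + y * Complex.I))
      (continuousAt_upperPow ha hb ?_) (by fun_prop)
    rw [Complex.add_im, Complex.ofReal_im, zero_add, Complex.exp_im]
    refine mul_nonneg (Real.exp_pos _).le (Real.sin_nonneg_of_nonneg_of_le_pi ?_ ?_) <;> simpa
  have c0 : Continuous fun u : ℝ => logIntegrand n (n + α) (n + β) x u := by
    simpa using hcont 0 le_rfl hpi.le
  have cpi := hcont Real.pi hpi.le le_rfl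
  have im_int : ∀ g : ℝ → ℂ, Continuous g →
      (∫ u in l..L, g u).im = ∫ u in l..L, (g u).im := fun g hg =>
    (Complex.imCLM.intervalIntegral_comp_comm (hg.intervalIntegrable _ _)).symm
  rw [half_annulus_integral_eq ha hb n x l L]
  simp only [Complex.add_re, Complex.sub_re, Complex.mul_re, Complex.I_re, Complex.I_im, zero_mul,
    one_mul, zero_sub]
  rw [im_int _ c0, im_int _ cpi]
  have b1 := intervalIntegral.norm_integral_le_of_norm_le_const (a := l) (b := L)
    (f := fun u : ℝ => (logIntegrand n (n + α) (n + β) x u).im) (fun u hu => by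
      rw [Set.uIoc_of_le hlL] at hu
      exact abs_im_logIntegrand_right_le hα hβ h1 h2 hu.2)
  have b2 := intervalIntegral.norm_integral_le_of_norm_le_const (a := l) (b := L)
    (f := fun u : ℝ => (logIntegrand n (n + α) (n + β) x (u + Real.pi * Complex.I)).im)
    (fun u hu => by
      rw [Set.uIoc_of_le hlL] at hu
      exact abs_im_logIntegrand_left_le hα hβ h1 h2 hu.2)
  rw [Real.norm_eq_abs, abs_of_nonneg (sub_nonneg.2 hlL)] at b1 b2
  rw [abs_le] at b1 b2 ⊢
  constructor <;> linarith [b1.1, b1.2, b2.1, b2.2]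

/-! ### The Rodrigues formula as a half circle integral -/

/-- Real iterated derivatives of the restriction of a holomorphic function to the real line. -/
lemma iteratedDeriv_eq_re {f : ℝ → ℝ} {g : ℂ → ℂ} {s : Set ℝ} (hs : IsOpen s)
    (hg : ∀ t ∈ s, AnalyticAt ℂ g t) (hf : ∀ t ∈ s, f t = (g t).re) (k : ℕ) :
    ∀ t ∈ s, iteratedDeriv k f t = (iteratedDeriv k g t).re := by
  induction k with
  | zero => simpa using hf
  | succ k ih =>
    intro t ht
    have hev : iteratedDeriv k f =ᶠ[𝓝 t] fun t : ℝ => (iteratedDeriv k g t).re := by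
      filter_upwards [hs.mem_nhds ht] with u hu using ih u hu
    rw [iteratedDeriv_succ, iteratedDeriv_succ, hev.deriv_eq]
    have han : AnalyticAt ℂ (iteratedDeriv k g) t := by
      rw [iteratedDeriv_eq_iterate]; exact (hg t ht).iterated_deriv k
    exact han.differentiableAt.hasDerivAt.real_of_complex.deriv

section HalfCircle

variable {a b x r : ℝ} (hr : 0 < r) (h1 : r < 1 - x) (h2 : r < 1 + x)
include h1 h2

lemma one_sub_mem_slitPlane_of_mem_closedBall {z : ℂ} (hz : z ∈ Metric.closedBall (x : ℂ) r) :
    1 - z ∈ Complex.slitPlane ∧ 1 + z ∈ Complex.slitPlane := by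
  have h3 := Complex.abs_re_le_norm (z - x)
  rw [Metric.mem_closedBall, dist_eq_norm] at hz
  rw [Complex.sub_re, Complex.ofReal_re] at h3
  have h4 := abs_le.1 (h3.trans hz)
  constructor <;> refine Or.inl ?_ <;> simp <;> linarith [h4.1, h4.2]

include hr in
/-- Cauchy's integral formula for the derivatives of `(1 - z)^a (1 + z)^b`; by symmetry under
conjugation the upper half of the circle suffices. -/
lemma re_half_circle_eq (n : ℕ) :
    (∫ θ in (0 : ℝ)..Real.pi, logIntegrand n a b x (Real.log r + θ * Complex.I)).re =
      Real.pi / n.factorial *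
        (iteratedDeriv n (fun z : ℂ => (1 - z) ^ (a : ℂ) * (1 + z) ^ (b : ℂ)) x).re := by
  set g : ℂ → ℂ := fun z : ℂ => (1 - z) ^ (a : ℂ) * (1 + z) ^ (b : ℂ) with hg
  have hpi := Real.pi_pos
  have hdiff : DifferentiableOn ℂ g (Metric.closedBall (x : ℂ) r) := by
    intro z hz
    have hm := one_sub_mem_slitPlane_of_mem_closedBall h1 h2 hz
    exact ((DifferentiableAt.cpow (by fun_prop) (by fun_prop) hm.1).mul
      (DifferentiableAt.cpow (by fun_prop) (by fun_prop) hm.2)).differentiableWithinAt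
  have hC := hdiff.circleIntegral_one_div_sub_center_pow_smul hr n
  set h : ℝ → ℂ := fun θ => g (circleMap x r θ) * (r * Complex.exp (θ * Complex.I))⁻¹ ^ n with hh
  have hr0 : (r : ℂ) ≠ 0 := by exact_mod_cast hr.ne'
  have hmem : ∀ θ, circleMap x r θ ∈ Metric.closedBall (x : ℂ) r :=
    circleMap_mem_closedBall _ hr.le
  have hint : ∮ z in C((x : ℂ), r), (1 / (z - x) ^ (n + 1)) • g z =
      Complex.I * ∫ θ in (0 : ℝ)..2 * Real.pi, h θ := by
    rw [circleIntegral, ← intervalIntegral.integral_const_mul]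
    refine intervalIntegral.integral_congr fun θ _ => ?_
    simp only [deriv_circleMap, circleMap_sub_center, smul_eq_mul, hh]
    rw [circleMap_zero]
    have : (r * Complex.exp (θ * Complex.I)) ≠ 0 := mul_ne_zero hr0 (Complex.exp_ne_zero _)
    rw [inv_pow]
    field_simp
    ring
  have hcont : Continuous h := by
    refine Continuous.mul (hdiff.continuousOn.comp_continuous (continuous_circleMap _ _) hmem) ?_
    refine Continuous.pow (Continuous.inv₀ (by fun_prop) fun θ => ?_) n
    exact mul_ne_zero hr0 (Complex.exp_ne_zero _)
  have hsymm : ∀ θ, h (2 * Real.pi - θ) = (starRingEnd ℂ) (h θ) := by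
    intro θ
    have hexp : Complex.exp (((2 * Real.pi - θ : ℝ) : ℂ) * Complex.I) =
        (starRingEnd ℂ) (Complex.exp (θ * Complex.I)) := by
      rw [← Complex.exp_conj, map_mul, Complex.conj_I, Complex.conj_ofReal]
      push_cast
      rw [sub_mul, sub_eq_add_neg, Complex.exp_add, Complex.exp_two_pi_mul_I, one_mul, mul_neg]
    have hmap : circleMap x r (2 * Real.pi - θ) = (starRingEnd ℂ) (circleMap x r θ) := by
      rw [circleMap, circleMap, hexp]; simp
    obtain ⟨m1, m2⟩ := one_sub_mem_slitPlane_of_mem_closedBall h1 h2 (hmem θ)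
    simp only [hh, hg, hexp, hmap, map_mul, map_pow, map_inv₀, Complex.conj_ofReal]
    have c1 := Complex.conj_cpow (1 - circleMap x r θ) (a : ℂ) (Complex.slitPlane_arg_ne_pi m1)
    have c2 := Complex.conj_cpow (1 + circleMap x r θ) (b : ℂ) (Complex.slitPlane_arg_ne_pi m2)
    rw [map_sub, map_one, Complex.conj_ofReal] at c1
    rw [map_add, map_one, Complex.conj_ofReal] at c2
    rw [c1, c2]
  have hhalf : (∫ θ in (0 : ℝ)..2 * Real.pi, h θ) =
      ((2 * (∫ θ in (0 : ℝ)..Real.pi, h θ).re : ℝ) : ℂ) := by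
    have e1 : ∫ θ in Real.pi..2 * Real.pi, h θ =
        (starRingEnd ℂ) (∫ θ in (0 : ℝ)..Real.pi, h θ) := by
      rw [intervalIntegral.integral_of_le hpi.le, ← integral_conj,
        ← intervalIntegral.integral_of_le hpi.le]
      simp only [← hsymm]
      rw [intervalIntegral.integral_comp_sub_left]
      congr 1 <;> ring
    rw [← intervalIntegral.integral_add_adjacent_intervals (hcont.intervalIntegrable _ _)
      (hcont.intervalIntegrable _ _), e1, Complex.add_conj]
  have hlog : ∫ θ in (0 : ℝ)..Real.pi, logIntegrand n a b x (Real.log r + θ * Complex.I) =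
      ∫ θ in (0 : ℝ)..Real.pi, h θ := by
    rw [intervalIntegral.integral_of_le hpi.le, intervalIntegral.integral_of_le hpi.le,
      MeasureTheory.integral_Ioc_eq_integral_Ioo, MeasureTheory.integral_Ioc_eq_integral_Ioo]
    refine MeasureTheory.setIntegral_congr_fun measurableSet_Ioo fun θ hθ => ?_
    have hexp : Complex.exp (Real.log r + θ * Complex.I) = r * Complex.exp (θ * Complex.I) := by
      rw [Complex.exp_add, ← Complex.ofReal_exp, Real.exp_log hr]
    have him : 0 < ((x : ℂ) + r * Complex.exp (θ * Complex.I)).im := by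
      rw [Complex.add_im, Complex.im_ofReal_mul, Complex.exp_ofReal_mul_I_im, Complex.ofReal_im,
        zero_add]
      exact mul_pos hr (Real.sin_pos_of_pos_of_lt_pi hθ.1 hθ.2)
    simp only [logIntegrand, hh, hg]
    rw [← mul_neg, Complex.exp_nat_mul, Complex.exp_neg, hexp, upperPow_of_im_pos _ _ him,
      circleMap]
  rw [hint, hhalf, smul_eq_mul] at hC
  have hC' : iteratedDeriv n g x * Real.pi / n.factorial =
      ((∫ θ in (0 : ℝ)..Real.pi, h θ).re : ℂ) := by
    apply mul_left_cancel₀ (mul_ne_zero two_ne_zero Complex.I_ne_zero)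
    push_cast at hC
    linear_combination -hC
  have hC'' := congrArg Complex.re hC'
  have e : iteratedDeriv n g x * Real.pi / n.factorial =
      ((Real.pi / n.factorial : ℝ) : ℂ) * iteratedDeriv n g x := by push_cast; ring
  rw [hlog, ← Complex.ofReal_re (∫ θ in (0 : ℝ)..Real.pi, h θ).re, ← hC', e, Complex.re_ofReal_mul]

end HalfCircle

/-- The Jacobi polynomial as the real part of a half circle integral. The radius `e^l` is small
enough for the circle to avoid both cuts. -/
lemma jacobiP_eq {n : ℕ} {α β x l : ℝ} (h1 : Real.exp l < 1 - x) (h2 : Real.exp l < 1 + x) :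
    jacobiP n α β x = (-1) ^ n / (2 ^ n * weight α β x * Real.pi) *
      (∫ θ in (0 : ℝ)..Real.pi, logIntegrand n (n + α) (n + β) x (l + θ * Complex.I)).re := by
  have hpi := Real.pi_pos
  have hl := Real.exp_pos l
  have hre := re_half_circle_eq (a := n + α) (b := n + β) hl h1 h2 n
  rw [Real.log_exp] at hre
  have hw : weight α β x ≠ 0 := by
    have : 0 < 1 - x := hl.trans h1
    have : 0 < 1 + x := hl.trans h2
    unfold weight; positivity
  have hf : (n.factorial : ℝ) ≠ 0 := by positivity
  rw [hre, jacobiP, iteratedDeriv_eq_re (s := Set.Ioo (-1) 1) isOpen_Ioo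
    (g := fun z : ℂ => (1 - z) ^ ((n + α : ℝ) : ℂ) * (1 + z) ^ ((n + β : ℝ) : ℂ)) _ _ n x
    ⟨by linarith, by linarith⟩]
  · field_simp
  · intro t ht
    refine AnalyticAt.mul (AnalyticAt.cpow (by fun_prop) (by fun_prop) (Or.inl ?_))
      (AnalyticAt.cpow (by fun_prop) (by fun_prop) (Or.inl ?_)) <;> simp <;> linarith [ht.1, ht.2]
  · intro t ht
    have p1 : 0 < 1 - t := by linarith [ht.2]
    have p2 : 0 < 1 + t := by linarith [ht.1]
    have e1 : (1 - t : ℂ) = ((1 - t : ℝ) : ℂ) := by push_cast; rfl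
    have e2 : (1 + t : ℂ) = ((1 + t : ℝ) : ℂ) := by push_cast; rfl
    rw [e1, e2, ← Complex.ofReal_cpow p1.le, ← Complex.ofReal_cpow p2.le, ← Complex.ofReal_mul,
      Complex.ofReal_re, weight, Real.rpow_add p1, Real.rpow_add p2, Real.rpow_natCast,
      Real.rpow_natCast, show 1 - t ^ 2 = (1 - t) * (1 + t) by ring, mul_pow]
    ring

/-! ### The local coordinate at a nondegenerate critical point -/

lemma re_cpow_half_nonneg (z : ℂ) : 0 ≤ (z ^ (1 / 2 : ℂ)).re := by
  rcases eq_or_ne z 0 with rfl | hz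
  · simp
  rw [Complex.cpow_def_of_ne_zero hz, Complex.exp_re]
  refine mul_nonneg (Real.exp_pos _).le (Real.cos_nonneg_of_mem_Icc ?_)
  have : (Complex.log z * (1 / 2 : ℂ)).im = z.arg / 2 := by
    rw [show (1 / 2 : ℂ) = ((1 / 2 : ℝ) : ℂ) by push_cast; rfl, Complex.im_mul_ofReal,
      Complex.log_im]; ring
  rw [this]
  constructor <;> linarith [Complex.neg_pi_lt_arg z, Complex.arg_le_pi z]

lemma cpow_half_sq (z : ℂ) : (z ^ (1 / 2 : ℂ)) ^ 2 = z := by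
  rw [← Complex.cpow_nat_mul]; norm_num

lemma norm_cpow_half_sub_one_le (z : ℂ) : ‖z ^ (1 / 2 : ℂ) - 1‖ ≤ ‖z - 1‖ := by
  have h1 : (1 : ℝ) ≤ ‖z ^ (1 / 2 : ℂ) + 1‖ := by
    have := Complex.re_le_norm (z ^ (1 / 2 : ℂ) + 1)
    rw [Complex.add_re, Complex.one_re] at this
    linarith [re_cpow_half_nonneg z]
  have h2 : z - 1 = (z ^ (1 / 2 : ℂ) - 1) * (z ^ (1 / 2 : ℂ) + 1) := by
    linear_combination -cpow_half_sq z
  rw [h2, norm_mul]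
  exact le_mul_of_one_le_right (norm_nonneg _) h1

/-- A holomorphic function with a double zero, divided by the square of the variable. -/
lemma exists_sq_mul_eq {r B : ℝ} (hr : 0 < r) {Φ k : ℂ → ℂ}
    (hΦ : ∀ ζ ∈ Metric.ball (0 : ℂ) r, HasDerivAt Φ (ζ * k ζ) ζ)
    (hk : ContinuousAt k 0) (hB : ∀ ζ ∈ Metric.ball (0 : ℂ) r, ‖k ζ‖ ≤ B) (h0 : Φ 0 = 0) :
    ∃ Ψ : ℂ → ℂ, DifferentiableOn ℂ Ψ (Metric.ball 0 r) ∧ (∀ ζ, Φ ζ = ζ ^ 2 * Ψ ζ) ∧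
      Ψ 0 = k 0 / 2 ∧ ∀ ζ ∈ Metric.ball (0 : ℂ) r, ‖Ψ ζ‖ ≤ B := by
  have hball : Metric.ball (0 : ℂ) r ∈ 𝓝 (0 : ℂ) := Metric.ball_mem_nhds _ hr
  have h00 : (0 : ℂ) ∈ Metric.ball (0 : ℂ) r := Metric.mem_ball_self hr
  set Ψ := dslope (dslope Φ 0) 0 with hΨ
  have hd : DifferentiableOn ℂ Ψ (Metric.ball 0 r) := by
    rw [hΨ, Complex.differentiableOn_dslope hball, Complex.differentiableOn_dslope hball]
    exact fun ζ hζ => (hΦ ζ hζ).differentiableAt.differentiableWithinAt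
  have hd0 : dslope Φ 0 0 = 0 := by
    rw [dslope_same, (hΦ 0 h00).deriv, zero_mul]
  have hsq : ∀ ζ, Φ ζ = ζ ^ 2 * Ψ ζ := by
    intro ζ
    have e1 := sub_smul_dslope Φ 0 ζ
    have e2 := sub_smul_dslope (dslope Φ 0) 0 ζ
    rw [hd0] at e2
    simp only [sub_zero, smul_eq_mul, h0] at e1 e2
    rw [← e1, ← e2, hΨ]
    ring
  have hB0 : 0 ≤ B := (norm_nonneg _).trans (hB 0 h00)
  have hΨ0 : Ψ 0 = k 0 / 2 := by
    have hda : ∀ ζ ∈ Metric.ball (0 : ℂ) r, DifferentiableAt ℂ Ψ ζ := fun ζ hζ =>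
      hd.differentiableAt (Metric.isOpen_ball.mem_nhds hζ)
    have hcd : ContinuousAt (deriv Ψ) 0 :=
      ((hd.analyticAt hball).deriv).continuousAt
    have hc1 : ContinuousAt (fun ζ => 2 * Ψ ζ + ζ * deriv Ψ ζ) 0 :=
      ((hda 0 h00).continuousAt.const_mul 2).add (continuousAt_id.mul hcd)
    have hev : (fun ζ => 2 * Ψ ζ + ζ * deriv Ψ ζ) =ᶠ[𝓝[≠] 0] k := by
      filter_upwards [nhdsWithin_le_nhds hball, self_mem_nhdsWithin] with ζ hζ hne
      have h1 := hΦ ζ hζ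
      have h2 : HasDerivAt Φ (((2 : ℕ) : ℂ) * ζ ^ (2 - 1) * Ψ ζ + ζ ^ 2 * deriv Ψ ζ) ζ := by
        have := (hasDerivAt_pow 2 ζ).mul (hda ζ hζ).hasDerivAt
        have he : Φ = (fun x => x ^ 2) * Ψ := funext hsq
        rw [he]; exact this
      have h3 := h1.unique h2
      apply mul_left_cancel₀ (show ζ ≠ 0 from hne)
      rw [h3]
      push_cast
      ring
    have := tendsto_nhds_unique_of_eventuallyEq
      (hc1.tendsto.mono_left nhdsWithin_le_nhds) (hk.tendsto.mono_left nhdsWithin_le_nhds) hev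
    simp only [zero_mul, add_zero] at this
    rw [← this]; ring
  refine ⟨Ψ, hd, hsq, hΨ0, fun ζ hζ => ?_⟩
  rcases eq_or_ne ζ 0 with rfl | hne
  · rw [hΨ0, norm_div, Complex.norm_ofNat]
    linarith [hB 0 h00]
  · have hζr : ‖ζ‖ < r := by simpa using hζ
    have hbd := (convex_closedBall (0 : ℂ) ‖ζ‖).norm_image_sub_le_of_norm_hasDerivWithin_le
      (f := Φ) (f' := fun z => z * k z) (C := ‖ζ‖ * B) (x := 0) (y := ζ)
      (fun z hz => (hΦ z (by simp at hz ⊢; linarith)).hasDerivWithinAt)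
      (fun z hz => by
        rw [norm_mul]
        have hz' : ‖z‖ ≤ ‖ζ‖ := by simpa using hz
        have := hB z (by simp; linarith)
        gcongr) (by simp) (by simp)
    rw [h0, sub_zero, sub_zero, hsq, norm_mul, norm_pow] at hbd
    have : 0 < ‖ζ‖ := norm_pos_iff.2 hne
    have h2 : ‖ζ‖ ^ 2 * ‖Ψ ζ‖ ≤ ‖ζ‖ ^ 2 * B := by linarith
    exact le_of_mul_le_mul_left h2 (by positivity)

/-- A perturbation of the identity by a function with small derivative has an inverse on a ball
of controlled radius. -/
lemma exists_inverse_of_norm_deriv_le {r : ℝ} (hr : 0 < r) {E : ℂ → ℂ}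
    (hE : DifferentiableOn ℂ E (Metric.ball 0 r)) (h0 : E 0 = 0)
    (hb : ∀ ζ ∈ Metric.ball (0 : ℂ) r, ‖deriv E ζ‖ ≤ 1 / 8) :
    ∃ G : ℂ → ℂ, (∀ ζ ∈ Metric.ball (0 : ℂ) r, G (ζ + E ζ) = ζ) ∧
      ∀ w ∈ Metric.ball (0 : ℂ) (r / 4), G w ∈ Metric.ball (0 : ℂ) r ∧ G w + E (G w) = w ∧
        HasDerivAt G (1 + deriv E (G w))⁻¹ w := by
  have hda : ∀ ζ ∈ Metric.ball (0 : ℂ) r, DifferentiableAt ℂ E ζ := fun ζ hζ =>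
    hE.differentiableAt (Metric.isOpen_ball.mem_nhds hζ)
  have hlip : ∀ x ∈ Metric.ball (0 : ℂ) r, ∀ y ∈ Metric.ball (0 : ℂ) r,
      ‖E x - E y‖ ≤ 1 / 8 * ‖x - y‖ := fun x hx y hy =>
    (convex_ball (0 : ℂ) r).norm_image_sub_le_of_norm_deriv_le hda hb hy hx
  have happ : ApproximatesLinearOn (fun ζ => ζ + E ζ)
      ((ContinuousLinearEquiv.refl ℂ ℂ : ℂ ≃L[ℂ] ℂ) : ℂ →L[ℂ] ℂ) (Metric.ball 0 r) (1 / 8) := by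
    intro x hx y hy
    have := hlip x hx y hy
    simp only [ContinuousLinearEquiv.coe_refl, ContinuousLinearMap.id_apply]
    push_cast
    rw [show x + E x - (y + E y) - (x - y) = E x - E y by ring]
    exact this
  have hN : ‖((ContinuousLinearEquiv.refl ℂ ℂ).symm : ℂ →L[ℂ] ℂ)‖₊ = 1 := by
    have : ((ContinuousLinearEquiv.refl ℂ ℂ).symm : ℂ →L[ℂ] ℂ) = ContinuousLinearMap.id ℂ ℂ := rfl
    rw [this]
    ext
    simp
  have hc : Subsingleton ℂ ∨ (1 / 8 : NNReal) <
      ‖((ContinuousLinearEquiv.refl ℂ ℂ).symm : ℂ →L[ℂ] ℂ)‖₊⁻¹ := by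
    right; rw [hN, inv_one, ← NNReal.coe_lt_coe]; push_cast; norm_num
  set e := happ.toOpenPartialHomeomorph _ _ hc Metric.isOpen_ball with he
  have hcoe : ∀ ζ, e ζ = ζ + E ζ := fun ζ => rfl
  have htar : ∀ w ∈ Metric.ball (0 : ℂ) (r / 4), w ∈ e.target := by
    intro w hw
    refine happ.closedBall_subset_target hc Metric.isOpen_ball (b := 0) (ε := r / 2)
      (by positivity) (Metric.closedBall_subset_ball (by linarith)) ?_
    rw [hN]
    simp only [h0, add_zero]
    push_cast
    have hw' : ‖w‖ < r / 4 := by simpa using hw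
    rw [mem_closedBall_zero_iff]
    linarith
  refine ⟨e.symm, fun ζ hζ => ?_, fun w hw => ?_⟩
  · rw [← hcoe]; exact e.left_inv hζ
  · have hmem : e.symm w ∈ Metric.ball (0 : ℂ) r := e.map_target (htar w hw)
    refine ⟨hmem, by rw [← hcoe]; exact e.right_inv (htar w hw), ?_⟩
    refine OpenPartialHomeomorph.hasDerivAt_symm e (htar w hw) ?_ ?_
    · intro hcon
      have h1 := hb _ hmem
      have h2 : deriv E (e.symm w) = -1 := by linear_combination hcon
      rw [h2] at h1
      norm_num at h1
    · exact (hasDerivAt_id _).add (hda _ hmem).hasDerivAt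

/-- Morse lemma in one complex variable with uniform constants: if `Φ' = ζ k(ζ)` with `k` bounded by
`B` on the ball of radius `r` and `k 0 = c²` is bounded below, then `Φ = W² / 2` for a coordinate
`W` with inverse `Z`, where the domains and the bounds depend on `r`, `B` and the lower bound `m`
only. -/
lemma exists_morse_coordinate {r B m : ℝ} (hr : 0 < r) (hm : 0 < m) (hB0 : 0 < B) :
    ∃ ρ r' : ℝ, 0 < ρ ∧ 0 < r' ∧ r' ≤ r ∧ ∀ (Φ k : ℂ → ℂ) (c : ℂ),
      (∀ ζ ∈ Metric.ball (0 : ℂ) r, HasDerivAt Φ (ζ * k ζ) ζ) → ContinuousAt k 0 →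
      (∀ ζ ∈ Metric.ball (0 : ℂ) r, ‖k ζ‖ ≤ B) → Φ 0 = 0 → k 0 = c ^ 2 → m ≤ ‖c‖ →
      ∃ W Z : ℂ → ℂ,
        (∀ ζ ∈ Metric.ball (0 : ℂ) r', W ζ ∈ Metric.ball (0 : ℂ) ρ ∧ Z (W ζ) = ζ ∧
          W ζ ^ 2 / 2 = Φ ζ ∧ DifferentiableAt ℂ W ζ ∧ ‖W ζ - c * ζ‖ ≤ ‖c‖ * ‖ζ‖ / 8) ∧
        (∀ w ∈ Metric.ball (0 : ℂ) ρ, Z w ∈ Metric.ball (0 : ℂ) r ∧ DifferentiableAt ℂ Z w ∧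
          Φ (Z w) = w ^ 2 / 2 ∧ ‖deriv Z w‖ ≤ 2 / m) ∧
        Z 0 = 0 ∧ deriv Z 0 = c⁻¹ := by
  set K : ℝ := 2 * B / m ^ 2 + 1 with hK
  have hKpos : 0 < K := by positivity
  set r₁ : ℝ := r / (16 * K) with hr₁
  have hr₁pos : 0 < r₁ := by positivity
  have hr₁le : r₁ ≤ r := by
    rw [hr₁]
    apply div_le_self hr.le
    have : 1 ≤ K := by rw [hK]; linarith [show 0 ≤ 2 * B / m ^ 2 by positivity]
    linarith
  refine ⟨m * (r₁ / 8), min (r₁ / 2) (m * r₁ / (9 * (B + 1))), by positivity, by positivity,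
    (min_le_left _ _).trans (by linarith), ?_⟩
  intro Φ k c hΦ hk hB h0 hkc hmc
  have hc : c ≠ 0 := norm_pos_iff.1 (hm.trans_le hmc)
  obtain ⟨Ψ, hΨd, hΨ, hΨ0, hΨB⟩ := exists_sq_mul_eq hr hΦ hk hB h0
  -- `Φ = (c ζ)² Θ / 2` with `Θ 0 = 1`, so the coordinate is `W = c ζ √Θ = c (ζ + E)`
  set Θ : ℂ → ℂ := fun ζ => 2 * Ψ ζ / c ^ 2 with hΘ
  have hΘ0 : Θ 0 = 1 := by
    simp only [hΘ, hΨ0, hkc]; field_simp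
  have hΘd : DifferentiableOn ℂ Θ (Metric.ball 0 r) := (hΨd.const_mul 2).div_const _
  have hΘK : ∀ ζ ∈ Metric.ball (0 : ℂ) r, ‖Θ ζ - 1‖ ≤ K := by
    intro ζ hζ
    refine (norm_sub_le _ _).trans ?_
    rw [norm_one, hK]
    gcongr
    simp only [hΘ, norm_div, norm_mul, Complex.norm_ofNat, norm_pow]
    have := hΨB ζ hζ
    gcongr
  have hsub : Metric.ball (0 : ℂ) r₁ ⊆ Metric.ball 0 r := Metric.ball_subset_ball hr₁le
  have hΘ1 : ∀ ζ ∈ Metric.ball (0 : ℂ) r₁, ‖Θ ζ - 1‖ ≤ 1 / 16 := by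
    intro ζ hζ
    have := Complex.dist_le_div_mul_dist_of_mapsTo_ball hΘd (R₂ := K) (fun z hz => by
      rw [hΘ0, Metric.mem_closedBall, dist_eq_norm]; exact hΘK z hz) (hsub hζ)
    rw [hΘ0, dist_eq_norm, dist_zero_right] at this
    have hζ' : ‖ζ‖ < r₁ := by simpa using hζ
    calc ‖Θ ζ - 1‖ ≤ K / r * ‖ζ‖ := this
      _ ≤ K / r * r₁ := by gcongr
      _ = 1 / 16 := by rw [hr₁]; field_simp
  set V : ℂ → ℂ := fun ζ => Θ ζ ^ (1 / 2 : ℂ) with hV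
  have hVd : DifferentiableOn ℂ V (Metric.ball 0 r₁) := by
    refine (hΘd.mono hsub).cpow (differentiableOn_const _) fun ζ hζ => Or.inl ?_
    have h1 := (Complex.abs_re_le_norm (Θ ζ - 1)).trans (hΘ1 ζ hζ)
    rw [Complex.sub_re, Complex.one_re] at h1
    linarith [(abs_le.1 h1).1]
  have hV1 : ∀ ζ ∈ Metric.ball (0 : ℂ) r₁, ‖V ζ - 1‖ ≤ 1 / 16 := fun ζ hζ =>
    (norm_cpow_half_sub_one_le _).trans (hΘ1 ζ hζ)
  set E : ℂ → ℂ := fun ζ => ζ * (V ζ - 1) with hE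
  have hEd : DifferentiableOn ℂ E (Metric.ball 0 r₁) := differentiableOn_id.mul (hVd.sub_const 1)
  have hEle : ∀ ζ ∈ Metric.ball (0 : ℂ) r₁, ‖E ζ‖ ≤ ‖ζ‖ / 16 := by
    intro ζ hζ
    rw [hE, norm_mul]
    have := hV1 ζ hζ
    calc _ ≤ ‖ζ‖ * (1 / 16) := by gcongr
      _ = _ := by ring
  have hE0 : E 0 = 0 := by simp [hE]
  have hE'0 : deriv E 0 = 0 := by
    have h1 : HasDerivAt V (deriv V 0) 0 :=
      (hVd.differentiableAt (Metric.ball_mem_nhds _ hr₁pos)).hasDerivAt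
    have := ((hasDerivAt_id (0 : ℂ)).mul (h1.sub_const 1)).deriv
    have e : E = id * fun ζ => V ζ - 1 := rfl
    rw [e, this]
    simp [hV, hΘ0]
  have hsub2 : Metric.ball (0 : ℂ) (r₁ / 2) ⊆ Metric.ball 0 r₁ :=
    Metric.ball_subset_ball (by linarith)
  have hE' : ∀ ζ ∈ Metric.ball (0 : ℂ) (r₁ / 2), ‖deriv E ζ‖ ≤ 1 / 8 := by
    intro ζ hζ
    have hζ' : ‖ζ‖ < r₁ / 2 := by simpa using hζ
    have hin : Metric.closedBall ζ (r₁ / 2) ⊆ Metric.ball 0 r₁ := by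
      intro z hz
      rw [mem_ball_zero_iff]
      rw [Metric.mem_closedBall, dist_eq_norm] at hz
      have : ‖z‖ ≤ ‖z - ζ‖ + ‖ζ‖ := by simpa using norm_add_le (z - ζ) ζ
      linarith
    have := Complex.norm_deriv_le_of_forall_mem_sphere_norm_le (f := E) (c := ζ) (R := r₁ / 2)
      (C := r₁ / 16) (by positivity)
      ((hEd.mono (Metric.closure_ball_subset_closedBall.trans hin)).diffContOnCl) (fun z hz => by
        have hz2 := hin (Metric.sphere_subset_closedBall hz)
        have hz3 : ‖z‖ < r₁ := by simpa using hz2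
        linarith [hEle z hz2])
    refine this.trans_eq ?_
    field_simp
    norm_num
  obtain ⟨G, hG1, hG2⟩ := exists_inverse_of_norm_deriv_le (by positivity : 0 < r₁ / 2)
    (hEd.mono hsub2) hE0 hE'
  have hWΦ : ∀ ζ, (c * (ζ + E ζ)) ^ 2 / 2 = Φ ζ := by
    intro ζ
    have : V ζ ^ 2 = 2 * Ψ ζ / c ^ 2 := cpow_half_sq _
    have e : (c * (ζ + E ζ)) ^ 2 / 2 = c ^ 2 * ζ ^ 2 * V ζ ^ 2 / 2 := by simp only [hE]; ring
    rw [e, this, hΨ ζ]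
    field_simp
  have hwc : ∀ w ∈ Metric.ball (0 : ℂ) (m * (r₁ / 8)),
      w / c ∈ Metric.ball (0 : ℂ) (r₁ / 2 / 4) := by
    intro w hw
    rw [mem_ball_zero_iff] at hw ⊢
    rw [norm_div, div_lt_iff₀ (hm.trans_le hmc)]
    calc ‖w‖ < m * (r₁ / 8) := hw
      _ ≤ ‖c‖ * (r₁ / 8) := by gcongr
      _ = _ := by ring
  have hZder : ∀ w ∈ Metric.ball (0 : ℂ) (m * (r₁ / 8)), HasDerivAt (fun w => G (w / c))
      ((1 + deriv E (G (w / c)))⁻¹ * (1 / c)) w := by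
    intro w hw
    exact (hG2 _ (hwc w hw)).2.2.comp w ((hasDerivAt_id w).div_const c)
  have hG0 : G (0 / c) = 0 := by
    rw [zero_div]
    have := hG1 0 (Metric.mem_ball_self (by positivity))
    rwa [hE0, add_zero] at this
  refine ⟨fun ζ => c * (ζ + E ζ), fun w => G (w / c), ?_, ?_, hG0, ?_⟩
  · intro ζ hζ
    rw [mem_ball_zero_iff, lt_min_iff] at hζ
    have hζ2 : ζ ∈ Metric.ball (0 : ℂ) (r₁ / 2) := by simpa using hζ.1
    have hEζ := hEle ζ (hsub2 hζ2)
    refine ⟨?_, ?_, hWΦ ζ, ?_, ?_⟩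
    · rw [mem_ball_zero_iff, norm_mul]
      have hcB : ‖c‖ ≤ B + 1 := by
        have := hB 0 (Metric.mem_ball_self hr)
        rw [hkc, norm_pow] at this
        nlinarith [sq_nonneg (‖c‖ - 1)]
      have h2 : ‖ζ + E ζ‖ ≤ 9 / 8 * ‖ζ‖ := by linarith [norm_add_le ζ (E ζ), norm_nonneg ζ]
      calc ‖c‖ * ‖ζ + E ζ‖ ≤ (B + 1) * (9 / 8 * ‖ζ‖) := by gcongr
        _ < (B + 1) * (9 / 8 * (m * r₁ / (9 * (B + 1)))) := by gcongr; exact hζ.2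
        _ = m * (r₁ / 8) := by field_simp
    · simp only
      rw [mul_div_cancel_left₀ _ hc, hG1 ζ hζ2]
    · exact (differentiableAt_id.add (hEd.differentiableAt
        (Metric.isOpen_ball.mem_nhds (hsub2 hζ2)))).const_mul c
    · have : c * (ζ + E ζ) - c * ζ = c * E ζ := by ring
      rw [this, norm_mul, mul_div_assoc]
      gcongr
      linarith [norm_nonneg ζ]
  · intro w hw
    have hw2 := hG2 _ (hwc w hw)
    refine ⟨hsub (hsub2 hw2.1), (hZder w hw).differentiableAt, ?_, ?_⟩
    · rw [← hWΦ, hw2.2.1, mul_div_cancel₀ _ hc]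
    · rw [(hZder w hw).deriv, norm_mul, norm_inv, norm_div, norm_one]
      have h1 : 1 / 2 ≤ ‖1 + deriv E (G (w / c))‖ := by
        have h2 := hE' _ hw2.1
        have h3 := norm_sub_norm_le (1 : ℂ) (-deriv E (G (w / c)))
        rw [norm_neg, norm_one, sub_neg_eq_add] at h3
        linarith
      calc _ ≤ (1 / 2)⁻¹ * (1 / m) := by gcongr
        _ = 2 / m := by ring
  · have := (hZder 0 (Metric.mem_ball_self (by positivity))).deriv
    rw [this, hG0, hE'0]
    simp

/-! ### Laplace's method for a Gaussian weight -/

lemma norm_taylorCoeff_le {G : ℂ → ℂ} {ρ M : ℝ} (hρ : 0 < ρ)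
    (hG : DifferentiableOn ℂ G (Metric.ball 0 ρ)) (hM : ∀ w ∈ Metric.ball (0 : ℂ) ρ, ‖G w‖ ≤ M)
    (k : ℕ) : ‖iteratedDeriv k G 0 / (k.factorial : ℂ)‖ ≤ M * (2 / ρ) ^ k := by
  have hsub : Metric.closedBall (0 : ℂ) (ρ / 2) ⊆ Metric.ball 0 ρ :=
    Metric.closedBall_subset_ball (by linarith)
  have := Complex.norm_iteratedDeriv_le_of_forall_mem_sphere_norm_le k (c := (0 : ℂ)) (f := G)
    (R := ρ / 2) (C := M) (by positivity)
    ((hG.mono (Metric.closure_ball_subset_closedBall.trans hsub)).diffContOnCl)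
    (fun z hz => hM z (hsub (Metric.sphere_subset_closedBall hz)))
  rw [norm_div, Complex.norm_natCast, div_le_iff₀ (by positivity)]
  refine this.trans_eq ?_
  have : (ρ / 2) ^ k * (2 / ρ) ^ k = 1 := by rw [← mul_pow]; field_simp; exact one_pow k
  rw [div_eq_iff (by positivity)]
  linear_combination (-(k.factorial * M) : ℝ) * this

/-- The Taylor remainder of a bounded holomorphic function, with a constant depending only on the
bound and the number of terms: the Schwarz lemma for a function with a zero of high order. -/
lemma norm_sub_taylor_le {G : ℂ → ℂ} {ρ M : ℝ} (hρ : 0 < ρ)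
    (hG : DifferentiableOn ℂ G (Metric.ball 0 ρ)) (hM : ∀ w ∈ Metric.ball (0 : ℂ) ρ, ‖G w‖ ≤ M)
    (n : ℕ) {w : ℂ} (hw : w ∈ Metric.ball (0 : ℂ) ρ) :
    ‖G w - ∑ k ∈ Finset.range n, iteratedDeriv k G 0 / (k.factorial : ℂ) * w ^ k‖ ≤
      M * (1 + ∑ k ∈ Finset.range n, 2 ^ k) * (‖w‖ / ρ) ^ n := by
  have hsup : ∀ w ∈ Metric.ball (0 : ℂ) ρ,
      ‖G w - ∑ k ∈ Finset.range n, iteratedDeriv k G 0 / (k.factorial : ℂ) * w ^ k‖ ≤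
      M * (1 + ∑ k ∈ Finset.range n, 2 ^ k) := by
    intro w hw
    have hw' : ‖w‖ < ρ := by simpa using hw
    rw [mul_add, mul_one, Finset.mul_sum]
    refine (norm_sub_le _ _).trans (add_le_add (hM w hw) ((norm_sum_le _ _).trans
      (Finset.sum_le_sum fun k _ => ?_)))
    rw [norm_mul, norm_pow]
    have hM0 : 0 ≤ M := (norm_nonneg _).trans (hM w hw)
    calc _ ≤ (M * (2 / ρ) ^ k) * ρ ^ k := by gcongr; exact norm_taylorCoeff_le hρ hG hM k
      _ = M * 2 ^ k := by rw [div_pow]; field_simp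
  rcases n with _ | n
  · simpa using hM w hw
  have han : AnalyticAt ℂ G 0 := hG.analyticAt (Metric.ball_mem_nhds _ hρ)
  have hO := han.hasFPowerSeriesAt.isBigO_sub_partialSum_pow (n + 1)
  simp only [FormalMultilinearSeries.partialSum, FormalMultilinearSeries.ofScalars_apply_eq,
    zero_add, smul_eq_mul] at hO
  set D : ℂ → ℂ := fun w =>
    G w - ∑ k ∈ Finset.range (n + 1), iteratedDeriv k G 0 / (k.factorial : ℂ) * w ^ k with hD
  have hD0 : D 0 = 0 := by
    simp [hD, Finset.sum_range_succ']
  have hDd : DifferentiableOn ℂ D (Metric.ball 0 ρ) := hG.sub (by fun_prop)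
  have ho : (fun w : ℂ => ‖w‖ ^ (n + 1)) =o[𝓝 0] fun w : ℂ => ‖w‖ ^ n := by
    have h1 : (fun w : ℂ => ‖w‖) =o[𝓝 0] fun _ => (1 : ℝ) := by
      rw [Asymptotics.isLittleO_one_iff]; exact tendsto_norm_zero
    simpa [pow_succ] using (Asymptotics.isBigO_refl (fun w : ℂ => ‖w‖ ^ n) (𝓝 0)).mul_isLittleO h1
  have := Complex.dist_le_mul_div_pow_of_mapsTo_ball_of_isLittleO (n := n) hDd
    (R₂ := M * (1 + ∑ k ∈ Finset.range (n + 1), 2 ^ k))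
    (fun z hz => by rw [hD0, mem_closedBall_zero_iff]; exact hsup z hz)
    (by simpa [hD0] using hO.trans_isLittleO ho) hw
  simpa [hD0] using this

/-- The Gaussian moment `∫ w^{2j} e^{-κ w² / 2} dw`. -/
noncomputable def gaussMoment (κ : ℝ) (j : ℕ) : ℝ :=
  √(2 * Real.pi / κ) * (2 ^ j * (ascPochhammer ℝ j).eval (1 / 2) / κ ^ j)

lemma Gamma_add_half_eq (j : ℕ) :
    Real.Gamma (j + 1 / 2) = (ascPochhammer ℝ j).eval (1 / 2) * √Real.pi := by
  induction j with
  | zero => simp [-one_div, Real.Gamma_one_half_eq]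
  | succ j ih =>
    rw [ascPochhammer_succ_eval, Nat.cast_succ, add_right_comm,
      Real.Gamma_add_one (by positivity), ih]
    ring

lemma integrable_pow_mul_gauss {κ : ℝ} (hκ : 0 < κ) (k : ℕ) :
    MeasureTheory.Integrable fun w : ℝ => w ^ k * Real.exp (-κ * w ^ 2 / 2) := by
  have := integrable_rpow_mul_exp_neg_mul_sq (b := κ / 2) (by positivity) (s := k)
    (by have : (0 : ℝ) ≤ k := by positivity
        linarith)
  simp only [Real.rpow_natCast] at this
  convert this using 4
  ring

lemma integral_even_pow_mul_gauss {κ : ℝ} (hκ : 0 < κ) (j : ℕ) :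
    ∫ w : ℝ, w ^ (2 * j) * Real.exp (-κ * w ^ 2 / 2) = gaussMoment κ j := by
  have h1 := integral_comp_abs (f := fun w : ℝ => w ^ (2 * j) * Real.exp (-κ * w ^ 2 / 2))
  have h2 : ∀ w : ℝ, |w| ^ (2 * j) * Real.exp (-κ * |w| ^ 2 / 2) =
      w ^ (2 * j) * Real.exp (-κ * w ^ 2 / 2) := by
    intro w; rw [pow_mul, pow_mul, sq_abs]
  simp only [h2] at h1
  rw [h1]
  have h3 := integral_rpow_mul_exp_neg_mul_rpow (p := 2) (q := (2 * j : ℕ)) (b := κ / 2)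
    two_pos (by have : (0 : ℝ) ≤ (2 * j : ℕ) := by positivity
                linarith) (by positivity)
  have h4 : ∫ w in Set.Ioi (0 : ℝ), w ^ (2 * j) * Real.exp (-κ * w ^ 2 / 2) =
      ∫ w in Set.Ioi (0 : ℝ), w ^ ((2 * j : ℕ) : ℝ) * Real.exp (-(κ / 2) * w ^ (2 : ℝ)) := by
    refine MeasureTheory.setIntegral_congr_fun measurableSet_Ioi fun w _ => ?_
    simp only [Real.rpow_natCast, Real.rpow_two]
    congr 2
    ring
  have h5 : (((2 * j : ℕ) : ℝ) + 1) / 2 = j + 1 / 2 := by push_cast; ring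
  have h6 : -(((2 * j : ℕ) : ℝ) + 1) / 2 = -(j + 1 / 2) := by push_cast; ring
  rw [h4, h3, h5, h6, Gamma_add_half_eq, gaussMoment, Real.rpow_neg (by positivity),
    Real.rpow_add (by positivity), Real.rpow_natCast, ← Real.sqrt_eq_rpow,
    show 2 * Real.pi / κ = Real.pi / (κ / 2) by field_simp, Real.sqrt_div Real.pi_pos.le, div_pow]
  field_simp

lemma integral_odd_pow_mul_gauss (κ : ℝ) (j : ℕ) :
    ∫ w : ℝ, w ^ (2 * j + 1) * Real.exp (-κ * w ^ 2 / 2) = 0 := by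
  have := MeasureTheory.integral_neg_eq_self
    (fun w : ℝ => w ^ (2 * j + 1) * Real.exp (-κ * w ^ 2 / 2)) MeasureTheory.volume
  have h2 : ∀ w : ℝ, (-w) ^ (2 * j + 1) * Real.exp (-κ * (-w) ^ 2 / 2) =
      -(w ^ (2 * j + 1) * Real.exp (-κ * w ^ 2 / 2)) := by
    intro w
    rw [Odd.neg_pow ⟨j, rfl⟩, neg_sq, neg_mul]
  simp only [h2] at this
  rw [MeasureTheory.integral_neg] at this
  linarith

lemma integral_taylor_mul_gauss {κ : ℝ} (hκ : 0 < κ) (f : ℕ → ℂ) (N : ℕ) :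
    ∫ w : ℝ, (∑ k ∈ Finset.range (2 * N), f k * (w : ℂ) ^ k) *
      ((Real.exp (-κ * w ^ 2 / 2) : ℝ) : ℂ) =
    ∑ j ∈ Finset.range N, f (2 * j) * (gaussMoment κ j : ℂ) := by
  have hint : ∀ k, MeasureTheory.Integrable fun w : ℝ =>
      f k * (w : ℂ) ^ k * ((Real.exp (-κ * w ^ 2 / 2) : ℝ) : ℂ) := by
    intro k
    have := ((integrable_pow_mul_gauss hκ k).ofReal (𝕜 := ℂ)).const_mul (f k)
    refine this.congr (Filter.Eventually.of_forall fun w => ?_)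
    simp only [RCLike.ofReal_mul, RCLike.ofReal_pow,
      Complex.coe_algebraMap, mul_assoc]
  have hval : ∀ k, ∫ w : ℝ, f k * (w : ℂ) ^ k * ((Real.exp (-κ * w ^ 2 / 2) : ℝ) : ℂ) =
      f k * ((∫ w : ℝ, w ^ k * Real.exp (-κ * w ^ 2 / 2) : ℝ) : ℂ) := by
    intro k
    rw [← integral_complex_ofReal, ← MeasureTheory.integral_const_mul]
    congr 1
    ext w
    push_cast
    ring
  simp only [Finset.sum_mul]
  rw [MeasureTheory.integral_finsetSum _ fun k _ => hint k]
  simp only [hval]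
  induction N with
  | zero => simp
  | succ N ih =>
    rw [show 2 * (N + 1) = 2 * N + 1 + 1 by ring, Finset.sum_range_succ, Finset.sum_range_succ, ih,
      Finset.sum_range_succ, integral_even_pow_mul_gauss hκ, integral_odd_pow_mul_gauss]
    simp

/-- Laplace's method on a real interval around the critical point, for amplitudes which are
holomorphic and bounded by `M` on the complex ball of radius `ρ`. The constant depends neither on
the amplitude nor on the end points, as long as these keep the distance `m` from the origin. -/
lemma norm_integral_mul_gauss_sub_le {ρ M m : ℝ} (hρ : 0 < ρ) (hM0 : 0 ≤ M) (hm : 0 < m) (N : ℕ) :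
    ∃ C : ℝ, 0 ≤ C ∧ ∀ (G : ℂ → ℂ) (a b κ : ℝ), DifferentiableOn ℂ G (Metric.ball 0 ρ) →
      (∀ w ∈ Metric.ball (0 : ℂ) ρ, ‖G w‖ ≤ M) → -ρ < a → a ≤ -m → m ≤ b → b < ρ → 0 < κ →
      ‖(∫ w in a..b, G w * ((Real.exp (-κ * w ^ 2 / 2) : ℝ) : ℂ)) -
        ∑ j ∈ Finset.range N, iteratedDeriv (2 * j) G 0 / ((2 * j).factorial : ℂ) *
          (gaussMoment κ j : ℂ)‖ ≤ C * gaussMoment κ N := by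
  set C₁ := M * (1 + ∑ k ∈ Finset.range (2 * N), 2 ^ k) * (1 / ρ) ^ (2 * N) with hC₁
  set C₂ := ∑ k ∈ Finset.range (2 * N), M * (2 / ρ) ^ k * (1 / m) ^ (2 * N - k) with hC₂
  have hC₁0 : 0 ≤ C₁ := by positivity
  have hC₂0 : 0 ≤ C₂ := by positivity
  refine ⟨C₁ + C₂, by positivity, ?_⟩
  intro G a b κ hG hM ha1 ha2 hb1 hb2 hκ
  set f : ℕ → ℂ := fun k => iteratedDeriv k G 0 / (k.factorial : ℂ) with hf
  set T : ℂ → ℂ := fun w => ∑ k ∈ Finset.range (2 * N), f k * w ^ k with hT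
  set e : ℝ → ℂ := fun w => ((Real.exp (-κ * w ^ 2 / 2) : ℝ) : ℂ) with he
  have hab : a ≤ b := by linarith
  have hball : ∀ w ∈ Set.Icc a b, (w : ℂ) ∈ Metric.ball (0 : ℂ) ρ := by
    intro w hw
    rw [mem_ball_zero_iff, Complex.norm_real, Real.norm_eq_abs, abs_lt]
    exact ⟨by linarith [hw.1], by linarith [hw.2]⟩
  -- outside `(a, b]` the Taylor polynomial itself is of order `w ^ (2 N)`, since `m ≤ |w|` there,
  -- so the integrals of its terms can be extended to the whole line
  have hbd : ∀ w : ℝ, ‖(Set.Ioc a b).indicator (fun w : ℝ => G w) w - T w‖ ≤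
      (C₁ + C₂) * w ^ (2 * N) := by
    intro w
    have hw2 : 0 ≤ w ^ (2 * N) := by rw [pow_mul]; positivity
    by_cases hw : w ∈ Set.Ioc a b
    · rw [Set.indicator_of_mem hw]
      have := norm_sub_taylor_le hρ hG hM (2 * N) (hball w ⟨hw.1.le, hw.2⟩)
      have e1 : (‖(w : ℂ)‖ / ρ) ^ (2 * N) = (1 / ρ) ^ (2 * N) * w ^ (2 * N) := by
        rw [div_pow, Complex.norm_real, Real.norm_eq_abs, pow_mul, sq_abs, one_div, inv_pow,
          pow_mul, pow_mul]
        ring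
      rw [e1, ← mul_assoc] at this
      refine this.trans ?_
      rw [add_mul]
      have : 0 ≤ C₂ * w ^ (2 * N) := by positivity
      linarith
    · rw [Set.indicator_of_notMem hw, zero_sub, norm_neg]
      have hwm : m ≤ |w| := by
        rw [Set.mem_Ioc, not_and_or, not_lt, not_le] at hw
        rcases hw with hw | hw
        · rw [abs_of_nonpos (by linarith)]; linarith
        · rw [abs_of_nonneg (by linarith)]; linarith
      have : ‖T w‖ ≤ C₂ * w ^ (2 * N) := by
        rw [hC₂, Finset.sum_mul]
        refine (norm_sum_le _ _).trans (Finset.sum_le_sum fun k hk => ?_)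
        have hk' : k ≤ 2 * N := (Finset.mem_range.1 hk).le
        have e1 : w ^ (2 * N) = |w| ^ k * |w| ^ (2 * N - k) := by
          rw [← pow_add, Nat.add_sub_cancel' hk', pow_mul, pow_mul, sq_abs]
        rw [norm_mul, norm_pow, Complex.norm_real, Real.norm_eq_abs, e1]
        have e2 : 1 ≤ (1 / m) ^ (2 * N - k) * |w| ^ (2 * N - k) := by
          rw [← mul_pow]
          refine one_le_pow₀ ?_
          rw [one_div, inv_mul_eq_div, one_le_div hm]
          exact hwm
        calc ‖f k‖ * |w| ^ k ≤ M * (2 / ρ) ^ k * |w| ^ k * 1 := by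
              rw [mul_one]; gcongr; exact norm_taylorCoeff_le hρ hG hM k
          _ ≤ M * (2 / ρ) ^ k * |w| ^ k * ((1 / m) ^ (2 * N - k) * |w| ^ (2 * N - k)) := by gcongr
          _ = _ := by ring
      refine this.trans ?_
      rw [add_mul]
      have : 0 ≤ C₁ * w ^ (2 * N) := by positivity
      linarith
  have hGc : ContinuousOn (fun w : ℝ => G w * e w) (Set.Icc a b) := by
    refine ContinuousOn.mul (hG.continuousOn.comp (by fun_prop) hball) ?_
    exact Continuous.continuousOn (by rw [he]; fun_prop)
  have hint1 : MeasureTheory.Integrable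
      ((Set.Ioc a b).indicator (fun w : ℝ => G w * e w)) := by
    rw [MeasureTheory.integrable_indicator_iff measurableSet_Ioc]
    exact (hGc.integrableOn_Icc).mono_set Set.Ioc_subset_Icc_self
  have hint2 : MeasureTheory.Integrable fun w : ℝ => T w * e w := by
    simp only [hT, Finset.sum_mul]
    refine MeasureTheory.integrable_finsetSum _ fun k _ => ?_
    have := ((integrable_pow_mul_gauss hκ k).ofReal (𝕜 := ℂ)).const_mul (f k)
    refine this.congr (Filter.Eventually.of_forall fun w => ?_)
    simp only [he, RCLike.ofReal_mul, RCLike.ofReal_pow,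
      Complex.coe_algebraMap, mul_assoc]
  have hI1 : ∫ w in a..b, G w * e w =
      ∫ w : ℝ, (Set.Ioc a b).indicator (fun w : ℝ => G w * e w) w := by
    rw [intervalIntegral.integral_of_le hab, MeasureTheory.integral_indicator measurableSet_Ioc]
  have hI2 := integral_taylor_mul_gauss hκ f N
  rw [hI1, ← hI2, ← MeasureTheory.integral_sub hint1 hint2, ← integral_even_pow_mul_gauss hκ,
    ← MeasureTheory.integral_const_mul]
  refine MeasureTheory.norm_integral_le_of_norm_le
    ((integrable_pow_mul_gauss hκ (2 * N)).const_mul _) (Filter.Eventually.of_forall fun w => ?_)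
  have e1 : (Set.Ioc a b).indicator (fun w : ℝ => G w * e w) w - T w * e w =
      ((Set.Ioc a b).indicator (fun w : ℝ => G w) w - T w) * e w := by
    by_cases hw : w ∈ Set.Ioc a b
    · rw [Set.indicator_of_mem hw, Set.indicator_of_mem hw, sub_mul]
    · rw [Set.indicator_of_notMem hw, Set.indicator_of_notMem hw, sub_mul, zero_mul]
  have e2 : ‖e w‖ = Real.exp (-κ * w ^ 2 / 2) := by
    simp only [he, Complex.norm_real, Real.norm_eq_abs, abs_of_pos (Real.exp_pos _)]
  rw [e1, norm_mul, e2, ← mul_assoc]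
  gcongr
  exact hbd w

/-! ### Saddle branches and their Taylor coefficients -/

/-- The derivative at `z₊` of the local coordinate `w`, normalised so that the circle through the
saddle point is traversed in the direction of increasing `Re w`. -/
noncomputable def saddleScale (σ τ x : ℝ) : ℂ :=
  -2 * √(U σ τ x) * saddleAmp x (zPlus σ τ x) / (1 + Complex.I)

lemma one_add_I_ne_zero : (1 + Complex.I : ℂ) ≠ 0 := by
  intro h; simpa using congrArg Complex.re h

lemma one_add_I_sq : (1 + Complex.I : ℂ) ^ 2 = 2 * Complex.I := by
  linear_combination Complex.I_sq

/-- A local inverse pair for the saddle point: `W` is a coordinate on the ball of radius `r` around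
`z₊` in which the phase is `φ(z₊) + W² / 2`, and `z` is its inverse on the ball of radius `ρ`. -/
structure SaddleChart (d ρ r σ τ x : ℝ) (W z : ℂ → ℂ) : Prop where
  map_ball : ∀ ζ ∈ Metric.ball (zPlus σ τ x) r, W ζ ∈ Metric.ball (0 : ℂ) ρ
  left_inv : ∀ ζ ∈ Metric.ball (zPlus σ τ x) r, z (W ζ) = ζ
  sq_eq : ∀ ζ ∈ Metric.ball (zPlus σ τ x) r,
    W ζ ^ 2 / 2 = phi σ τ x ζ - phi σ τ x (zPlus σ τ x)
  differentiableAt : ∀ ζ ∈ Metric.ball (zPlus σ τ x) r, DifferentiableAt ℂ W ζ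
  approx : ∀ ζ ∈ Metric.ball (zPlus σ τ x) r,
    ‖W ζ - saddleScale σ τ x * (ζ - zPlus σ τ x)‖ ≤
      ‖saddleScale σ τ x‖ * ‖ζ - zPlus σ τ x‖ / 8
  inv_mem : ∀ w ∈ Metric.ball (0 : ℂ) ρ, z w ∈ Metric.ball (zPlus σ τ x) (d / 4)
  inv_differentiableAt : ∀ w ∈ Metric.ball (0 : ℂ) ρ, DifferentiableAt ℂ z w
  inv_eq : ∀ w ∈ Metric.ball (0 : ℂ) ρ,
    phi σ τ x (z w) - phi σ τ x (zPlus σ τ x) = w ^ 2 / 2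
  norm_deriv_inv_le : ∀ w ∈ Metric.ball (0 : ℂ) ρ, ‖deriv z w‖ ≤ 4 / d
  inv_zero : z 0 = zPlus σ τ x
  deriv_inv_zero : deriv z 0 = (saddleScale σ τ x)⁻¹

namespace Regular

variable {d σ τ x : ℝ} (h : Regular d σ τ x)
include h

lemma saddleScale_sq : saddleScale σ τ x ^ 2 = phiQuot σ τ x (zPlus σ τ x) := by
  have hU : ((√(U σ τ x) : ℝ) : ℂ) ^ 2 = U σ τ x := by
    rw [← Complex.ofReal_pow, Real.sq_sqrt h.U_pos.le]
  rw [h.phiQuot_zPlus, saddleScale, div_pow, one_add_I_sq, mul_pow, mul_pow, hU]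
  have := Complex.I_ne_zero
  field_simp
  linear_combination (U σ τ x : ℂ) * saddleAmp x (zPlus σ τ x) ^ 2 * Complex.I_sq

lemma le_norm_saddleScale : d / 2 ≤ ‖saddleScale σ τ x‖ := by
  have h1 := h.le_norm_phiQuot_zPlus
  rw [← h.saddleScale_sq, norm_pow] at h1
  have := h.le_one
  have := h.pos
  refine le_of_sq_le_sq ?_ (norm_nonneg _)
  nlinarith

end Regular

lemma exists_saddleChart {d : ℝ} (hd : 0 < d) : ∃ ρ r : ℝ, 0 < ρ ∧ 0 < r ∧ r ≤ d / 4 ∧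
    ∀ σ τ x : ℝ, Regular d σ τ x → ∃ W z : ℂ → ℂ, SaddleChart d ρ r σ τ x W z := by
  obtain ⟨ρ, r, hρ, hr, hr', hmorse⟩ := exists_morse_coordinate (r := d / 4)
    (B := 6 * ((d / 4)⁻¹) ^ 3) (m := d / 2) (by positivity) (by positivity) (by positivity)
  refine ⟨ρ, r, hρ, hr, hr', fun σ τ x h => ?_⟩
  set p := zPlus σ τ x with hp
  have hshift : ∀ ζ ∈ Metric.ball (0 : ℂ) (d / 4), p + ζ ∈ Metric.ball p (d / 4) := by
    intro ζ hζ
    rw [mem_ball_zero_iff] at hζ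
    rw [Metric.mem_ball, dist_eq_norm, add_sub_cancel_left]
    exact hζ
  obtain ⟨W, Z, hW, hZ, hZ0, hZ1⟩ := hmorse (fun ζ => phi σ τ x (p + ζ) - phi σ τ x p)
    (fun ζ => phiQuot σ τ x (p + ζ)) (saddleScale σ τ x)
    (fun ζ hζ => by
      have := (h.hasDerivAt_phi (h.im_pos_of_mem_ball (hshift ζ hζ))).comp_const_add p ζ
      refine (this.sub_const (phi σ τ x p)).congr_deriv ?_
      rw [hp, add_sub_cancel_left])
    (by
      have h1 : 0 < (p + 0).im := by rw [add_zero]; exact h.zPlus_im_pos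
      exact ContinuousAt.comp (f := fun ζ : ℂ => p + ζ)
        (differentiableAt_phiQuot h1 σ τ x).continuousAt (by fun_prop))
    (fun ζ hζ => h.norm_phiQuot_le (hshift ζ hζ)) (by simp)
    (by rw [add_zero, h.saddleScale_sq]) h.le_norm_saddleScale
  have hsub : ∀ ζ ∈ Metric.ball p r, ζ - p ∈ Metric.ball (0 : ℂ) r := by
    intro ζ hζ
    rw [mem_ball_zero_iff, ← dist_eq_norm]
    exact hζ
  refine ⟨fun ζ => W (ζ - p), fun w => p + Z w, ?_⟩
  exact
    { map_ball := fun ζ hζ => (hW _ (hsub ζ hζ)).1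
      left_inv := fun ζ hζ => by rw [(hW _ (hsub ζ hζ)).2.1, add_sub_cancel]
      sq_eq := fun ζ hζ => by rw [(hW _ (hsub ζ hζ)).2.2.1, add_sub_cancel]
      differentiableAt := fun ζ hζ => by
        exact (hW _ (hsub ζ hζ)).2.2.2.1.comp ζ (by fun_prop)
      approx := fun ζ hζ => (hW _ (hsub ζ hζ)).2.2.2.2
      inv_mem := fun w hw => hshift _ (hZ w hw).1
      inv_differentiableAt := fun w hw => (hZ w hw).2.1.const_add p
      inv_eq := fun w hw => (hZ w hw).2.2.1
      norm_deriv_inv_le := fun w hw => by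
        rw [deriv_const_add]
        refine (hZ w hw).2.2.2.trans_eq ?_
        field_simp
        norm_num
      inv_zero := by rw [hZ0, add_zero]
      deriv_inv_zero := by rw [deriv_const_add]; exact hZ1 }

namespace SaddleChart

variable {d ρ r σ τ x : ℝ} {W z : ℂ → ℂ} (hc : SaddleChart d ρ r σ τ x W z)
  (h : Regular d σ τ x)
include hc

lemma differentiableOn_inv : DifferentiableOn ℂ z (Metric.ball 0 ρ) := fun w hw =>
  (hc.inv_differentiableAt w hw).differentiableWithinAt

lemma isSaddleBranch (hρ : 0 < ρ) : IsSaddleBranch σ τ x z := by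
  refine ⟨hc.differentiableOn_inv.analyticAt (Metric.ball_mem_nhds _ hρ), hc.inv_zero, ?_⟩
  filter_upwards [Metric.ball_mem_nhds (0 : ℂ) hρ] with w hw using hc.inv_eq w hw

include h

lemma differentiableOn_fPlus : DifferentiableOn ℂ (fPlus x z) (Metric.ball 0 ρ) := by
  intro w hw
  have h1 : DifferentiableAt ℂ (deriv z) w :=
    (hc.differentiableOn_inv.deriv Metric.isOpen_ball).differentiableAt
      (Metric.isOpen_ball.mem_nhds hw)
  have h2 := (differentiableAt_saddleAmp (h.im_pos_of_mem_ball (hc.inv_mem w hw)) x).comp w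
    (hc.inv_differentiableAt w hw)
  have h3 : fPlus x z = fun w => deriv z w * saddleAmp x (z w) := funext (fPlus_eq x z)
  rw [h3]
  exact (h1.mul h2).differentiableWithinAt

lemma norm_fPlus_le {w : ℂ} (hw : w ∈ Metric.ball (0 : ℂ) ρ) :
    ‖fPlus x z w‖ ≤ 4 / d * √(((d / 4)⁻¹) ^ 3) := by
  have := h.pos
  rw [fPlus_eq, norm_mul]
  have h1 := hc.norm_deriv_inv_le w hw
  have h2 := Real.le_sqrt_of_sq_le (h.norm_saddleAmp_sq_le (hc.inv_mem w hw))
  gcongr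

lemma fCoeff_zero : fCoeff x z 0 = -(1 + Complex.I) / (2 * √(U σ τ x)) := by
  have hs := saddleAmp_ne_zero h.zPlus_im_pos x
  have hU : ((√(U σ τ x) : ℝ) : ℂ) ≠ 0 := by
    exact_mod_cast (Real.sqrt_pos.2 h.U_pos).ne'
  have := one_add_I_ne_zero
  rw [fCoeff, iteratedDeriv_zero, fPlus_eq, hc.deriv_inv_zero, hc.inv_zero, saddleScale]
  simp only [Nat.factorial_zero, Nat.cast_one, div_one]
  field_simp

omit h in
/-- Saddle branches are unique up to `w ↦ -w`, since `W(z(w))² = w²`. -/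
lemma eventuallyEq_or_of_isSaddleBranch (hr : 0 < r) {z' : ℂ → ℂ}
    (hz' : IsSaddleBranch σ τ x z') :
    z' =ᶠ[𝓝 0] z ∨ z' =ᶠ[𝓝 0] fun w => z (-w) := by
  obtain ⟨han, h0, hev⟩ := hz'
  have hball : ∀ᶠ w in 𝓝 (0 : ℂ), z' w ∈ Metric.ball (zPlus σ τ x) r := by
    apply han.continuousAt.eventually_mem
    rw [h0]
    exact Metric.ball_mem_nhds _ hr
  have hWan : AnalyticAt ℂ W (z' 0) := by
    rw [h0]
    exact DifferentiableOn.analyticAt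
      (fun ζ hζ => (hc.differentiableAt ζ hζ).differentiableWithinAt) (Metric.ball_mem_nhds _ hr)
  have hu : AnalyticAt ℂ (fun w => W (z' w)) 0 := AnalyticAt.fun_comp hWan han
  have hsq : ∀ᶠ w in 𝓝 (0 : ℂ), (W (z' w) - w) * (W (z' w) + w) = 0 := by
    filter_upwards [hball, hev] with w h1 h2
    rw [← hc.sq_eq _ h1] at h2
    linear_combination 2 * h2
  have hfin : ∀ᶠ w in 𝓝 (0 : ℂ), z (W (z' w)) = z' w := by
    filter_upwards [hball] with w h1 using hc.left_inv _ h1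
  rcases (hu.sub analyticAt_id).eventually_eq_zero_or_eventually_ne_zero with h1 | h1
  · left
    filter_upwards [h1, hfin] with w h1 h2
    have e : W (z' w) = w := sub_eq_zero.1 h1
    rw [← h2, e]
  · right
    have h2 : ∀ᶠ w in 𝓝[≠] (0 : ℂ), W (z' w) + w = 0 := by
      filter_upwards [h1, nhdsWithin_le_nhds hsq] with w h3 h4
      exact (mul_eq_zero.1 h4).resolve_left h3
    have h3 := (hu.add analyticAt_id).frequently_zero_iff_eventually_zero.1 h2.frequently
    filter_upwards [h3, hfin] with w h4 h5
    have e : W (z' w) = -w := eq_neg_of_add_eq_zero_left h4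
    rw [← h5, e]

omit h in
lemma cCoeff_eq_of_isSaddleBranch (hr : 0 < r) {z' : ℂ → ℂ}
    (hz' : IsSaddleBranch σ τ x z') (j : ℕ) : cCoeff x z' j = cCoeff x z j := by
  rcases hc.eventuallyEq_or_of_isSaddleBranch hr hz' with he | he
  · have hf : fPlus x z' =ᶠ[𝓝 0] fPlus x z := by
      filter_upwards [he, he.deriv] with w h1 h2
      rw [fPlus_eq, fPlus_eq, h1, h2]
    simp only [cCoeff, fCoeff, hf.iteratedDeriv_eq]
  · have hf : fPlus x z' =ᶠ[𝓝 0] fun w => -fPlus x z (-w) := by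
      filter_upwards [he, he.deriv] with w h1 h2
      rw [fPlus_eq, fPlus_eq, h1, h2, deriv_comp_neg, neg_mul]
    have hk : ∀ k, fCoeff x z' (2 * k) = -fCoeff x z (2 * k) := by
      intro k
      rw [fCoeff, fCoeff, hf.iteratedDeriv_eq, iteratedDeriv_fun_neg, iteratedDeriv_comp_neg]
      simp [neg_div]
    have h0 := hk 0
    rw [mul_zero] at h0
    rw [cCoeff, cCoeff, hk, h0, mul_neg, neg_div_neg_eq]

lemma cCoeff_zero : cCoeff x z 0 = 1 := by
  have h0 : fCoeff x z 0 ≠ 0 := by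
    rw [hc.fCoeff_zero h]
    have hU : ((√(U σ τ x) : ℝ) : ℂ) ≠ 0 := by
      exact_mod_cast (Real.sqrt_pos.2 h.U_pos).ne'
    exact div_ne_zero (neg_ne_zero.2 one_add_I_ne_zero) (mul_ne_zero two_ne_zero hU)
  simp [cCoeff, div_self h0]

end SaddleChart

/-! ### The contribution of the saddle point -/

/-- The relations between `n, α, β` and the scaled parameters `κ, σ, τ`. -/
structure ScaledParams (n : ℕ) (α β κ σ τ : ℝ) : Prop where
  alpha_nonneg : 0 ≤ α
  beta_nonneg : 0 ≤ β
  kappa_pos : 0 < κ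
  add_alpha : n + α = κ * (1 + τ) - 1 / 2
  add_beta : n + β = κ * (1 - τ) - 1 / 2
  degree : n = κ * (1 - σ) - 1 / 2

lemma exp_log_saddleRadius {d σ τ x : ℝ} (h : Regular d σ τ x) (θ : ℝ) :
    (x : ℂ) + Complex.exp (Real.log (saddleRadius σ τ x) + θ * Complex.I) =
      circlePt σ τ x θ := by
  rw [Complex.exp_add, ← Complex.ofReal_exp, Real.exp_log h.saddleRadius_pos, circlePt]

lemma circlePt_im_pos {d σ τ x : ℝ} (h : Regular d σ τ x) {θ : ℝ} (h0 : 0 < θ)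
    (h1 : θ < Real.pi) : 0 < (circlePt σ τ x θ).im := by
  rw [circlePt_im]; exact mul_pos h.saddleRadius_pos (Real.sin_pos_of_pos_of_lt_pi h0 h1)

/-- On the circle the integrand is `e^{-κ φ}` times the amplitude of `fPlus`; the factor
`x - z = i dz/dθ` comes from the parametrisation by the angle. -/
lemma logIntegrand_circle {n : ℕ} {α β κ σ τ d x : ℝ} (hp : ScaledParams n α β κ σ τ)
    (h : Regular d σ τ x) {θ : ℝ} (h0 : 0 < θ) (h1 : θ < Real.pi) :
    (-1) ^ n * logIntegrand n (n + α) (n + β) x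
        (Real.log (saddleRadius σ τ x) + θ * Complex.I) =
      Complex.exp (-κ * phi σ τ x (circlePt σ τ x θ)) * saddleAmp x (circlePt σ τ x θ) *
        (x - circlePt σ τ x θ) := by
  have him := circlePt_im_pos h h0 h1
  have hexp := exp_log_saddleRadius h θ
  rw [logIntegrand, hexp, upperPow_of_im_pos _ _ him, ← mul_neg, Complex.exp_nat_mul,
    Complex.exp_neg, eq_sub_of_add_eq' hexp]
  set z := circlePt σ τ x θ with hz
  have n1 := one_sub_ne_zero_of_im_pos him
  have n2 := one_add_ne_zero_of_im_pos him
  have n3 := ofReal_sub_ne_zero_of_im_pos him x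
  have e1 : (-1) ^ n * (z - x : ℂ)⁻¹ ^ n = Complex.exp (-n * Complex.log (x - z)) := by
    rw [← mul_pow, neg_mul, one_mul, neg_inv, neg_sub, neg_mul, ← mul_neg, Complex.exp_nat_mul,
      Complex.exp_neg, Complex.exp_log n3]
  have e2 : (x - z : ℂ) = Complex.exp (Complex.log (x - z)) := (Complex.exp_log n3).symm
  have a1 : (((n : ℝ) + α : ℝ) : ℂ) = κ * (1 + τ) - 1 / 2 := by
    rw [hp.add_alpha]; push_cast; ring
  have a2 : (((n : ℝ) + β : ℝ) : ℂ) = κ * (1 - τ) - 1 / 2 := by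
    rw [hp.add_beta]; push_cast; ring
  have a3 : (n : ℂ) = κ * (1 - σ) - 1 / 2 := by
    have : ((n : ℝ) : ℂ) = ((κ * (1 - σ) - 1 / 2 : ℝ) : ℂ) := congrArg _ hp.degree
    push_cast at this
    exact this
  calc _ = ((1 - z) ^ (((n : ℝ) + α : ℝ) : ℂ) * (1 + z) ^ (((n : ℝ) + β : ℝ) : ℂ)) *
        ((-1) ^ n * (z - x : ℂ)⁻¹ ^ n) := by ring
    _ = _ := by
      rw [e1, saddleAmp, Complex.cpow_def_of_ne_zero n1, Complex.cpow_def_of_ne_zero n2,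
        Complex.cpow_def_of_ne_zero n1, Complex.cpow_def_of_ne_zero n2,
        Complex.cpow_def_of_ne_zero n3, phi, ← Complex.exp_add, ← Complex.exp_add,
        ← Complex.exp_add, ← Complex.exp_add, ← Complex.exp_neg, ← Complex.exp_add]
      nth_rw 4 [e2]
      rw [← Complex.exp_add, a1, a2, a3]
      congr 1
      ring

lemma continuousOn_logIntegrand_circle {n : ℕ} {α β x L : ℝ} (hα : 0 ≤ α) (hβ : 0 ≤ β) :
    ContinuousOn (fun θ : ℝ => logIntegrand n (n + α) (n + β) x (L + θ * Complex.I))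
      (Set.Icc 0 Real.pi) := by
  intro θ hθ
  refine ContinuousAt.continuousWithinAt (ContinuousAt.mul ?_ (by fun_prop))
  refine ContinuousAt.comp (f := fun u : ℝ => (x : ℂ) + Complex.exp (L + u * Complex.I))
    (continuousAt_upperPow (by positivity) (by positivity) ?_) (by fun_prop)
  rw [Complex.add_im, Complex.ofReal_im, zero_add, Complex.exp_im]
  refine mul_nonneg (Real.exp_pos _).le (Real.sin_nonneg_of_nonneg_of_le_pi ?_ ?_)
  · simpa using hθ.1
  · simpa using hθ.2

lemma hasDerivAt_circlePt (σ τ x θ : ℝ) :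
    HasDerivAt (circlePt σ τ x) (Complex.I * (circlePt σ τ x θ - x)) θ := by
  have h1 : HasDerivAt (fun θ : ℝ => (θ : ℂ) * Complex.I) Complex.I θ := by
    simpa using (Complex.ofRealCLM.hasDerivAt (x := θ)).mul_const Complex.I
  have h2 := (h1.cexp.const_mul (saddleRadius σ τ x : ℂ)).const_add (x : ℂ)
  refine h2.congr_deriv ?_
  rw [circlePt]
  ring

/-- The circle near the saddle point, as a perturbation of its tangent. -/
lemma circlePt_sub_zPlus (σ τ x Δ : ℝ) :
    circlePt σ τ x (saddleAngle σ τ x + Δ) - zPlus σ τ x =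
      (zPlus σ τ x - x) * (Complex.exp (Δ * Complex.I) - 1) := by
  rw [← circlePt_saddleAngle, circlePt, circlePt]
  push_cast
  rw [add_mul, Complex.exp_add]
  ring

lemma norm_exp_mul_I_sub_one_le (Δ : ℝ) : ‖Complex.exp (Δ * Complex.I) - 1‖ ≤ |Δ| := by
  have := Real.norm_exp_I_mul_ofReal_sub_one_le (x := Δ)
  rw [mul_comm]
  simpa using this

lemma norm_circlePt_sub_zPlus_le {d σ τ x : ℝ} (h : Regular d σ τ x) (Δ : ℝ) :
    ‖circlePt σ τ x (saddleAngle σ τ x + Δ) - zPlus σ τ x‖ ≤ |Δ| := by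
  rw [circlePt_sub_zPlus, norm_mul, norm_sub_rev]
  calc _ ≤ 1 * |Δ| := by
        gcongr
        · exact h.norm_sub_zPlus_le
        · exact norm_exp_mul_I_sub_one_le Δ
    _ = _ := one_mul _

/-- The velocity of `w` along the circle at the saddle point points into the cone `|arg| ≤ π / 4`
around the positive real axis. -/
lemma norm_le_re_velocity {d σ τ x : ℝ} (h : Regular d σ τ x) :
    0 < ‖saddleScale σ τ x * (Complex.I * (zPlus σ τ x - x))‖ ∧
    ‖saddleScale σ τ x * (Complex.I * (zPlus σ τ x - x))‖ ≤
      2 * (saddleScale σ τ x * (Complex.I * (zPlus σ τ x - x))).re := by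
  set q := ((x : ℂ) - zPlus σ τ x) * saddleAmp x (zPlus σ τ x) with hq
  obtain ⟨q1, q2⟩ := sub_mul_saddleAmp_mem_quadrant h.zPlus_im_pos h.one_sub_pos h.one_add_pos
  rw [← hq] at q1 q2
  have hU : 0 < √(U σ τ x) := Real.sqrt_pos.2 h.U_pos
  have e : saddleScale σ τ x * (Complex.I * (zPlus σ τ x - x)) =
      ((√(U σ τ x) : ℝ) : ℂ) * ((1 + Complex.I) * q) := by
    have := one_add_I_ne_zero
    rw [saddleScale, hq]
    field_simp
    linear_combination (√(U σ τ x) : ℂ) * (saddleAmp x (zPlus σ τ x)) * (zPlus σ τ x - x) *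
      one_add_I_sq
  have hre : ((1 + Complex.I) * q).re = q.re - q.im := by simp [Complex.mul_re]
  have hIm : ((1 + Complex.I) * q).im = q.im + q.re := by simp [Complex.mul_im]
  rw [e, norm_mul, Complex.norm_real, Real.norm_of_nonneg hU.le, Complex.re_ofReal_mul, hre]
  constructor
  · refine mul_pos hU (norm_pos_iff.2 ?_)
    intro h0
    rw [h0] at hre
    simp at hre
    linarith
  · have h2 := Complex.norm_le_abs_re_add_abs_im ((1 + Complex.I) * q)
    rw [hre, hIm, abs_of_pos (by linarith)] at h2
    have h3 : |q.im + q.re| ≤ q.re - q.im := by rw [abs_le]; constructor <;> linarith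
    nlinarith

lemma circlePt_mem_ball {d σ τ x r : ℝ} (h : Regular d σ τ x) {Δ : ℝ} (hΔ : |Δ| < r) :
    circlePt σ τ x (saddleAngle σ τ x + Δ) ∈ Metric.ball (zPlus σ τ x) r := by
  rw [Metric.mem_ball, dist_eq_norm]
  exact (norm_circlePt_sub_zPlus_le h Δ).trans_lt hΔ

/-- Moving the end point of the path to the real axis costs an exponentially small amount, because
`Re w²` increases along the way. -/
lemma norm_primitive_sub_re_le {κ M ρ : ℝ} (hκ : 0 ≤ κ) {G H : ℂ → ℂ}
    (hH : ∀ w ∈ Metric.ball (0 : ℂ) ρ,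
      HasDerivAt H (G w * Complex.exp (-κ * w ^ 2 / 2)) w)
    (hM : ∀ w ∈ Metric.ball (0 : ℂ) ρ, ‖G w‖ ≤ M) {w : ℂ}
    (hw : w ∈ Metric.ball (0 : ℂ) ρ) {ν : ℝ} (hν : ν ≤ (w ^ 2).re) :
    ‖H w - H w.re‖ ≤ M * Real.exp (-(κ * ν / 2)) * ρ := by
  have hw' : ‖w‖ < ρ := by simpa using hw
  set s : Set ℂ := segment ℝ (w.re : ℂ) w with hs
  have hseg : ∀ p ∈ s, p.re = w.re ∧ |p.im| ≤ |w.im| := by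
    intro p hp
    obtain ⟨a, b, ha, hb, hab, rfl⟩ := hp
    constructor
    · simp; rw [← add_mul, hab, one_mul]
    · simp only [Complex.real_smul, Complex.add_im, Complex.im_ofReal_mul, Complex.ofReal_im,
        mul_zero, zero_add, abs_mul]
      rw [abs_of_nonneg hb]
      exact mul_le_of_le_one_left (abs_nonneg _) (by linarith)
  have hsb : ∀ p ∈ s, p ∈ Metric.ball (0 : ℂ) ρ := by
    intro p hp
    obtain ⟨h1, h2⟩ := hseg p hp
    rw [mem_ball_zero_iff]
    refine lt_of_le_of_lt ?_ hw'
    refine le_of_sq_le_sq ?_ (norm_nonneg _)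
    rw [← Complex.normSq_eq_norm_sq, ← Complex.normSq_eq_norm_sq, Complex.normSq_apply,
      Complex.normSq_apply, h1]
    have := sq_le_sq.2 h2
    nlinarith
  have hM0 : 0 ≤ M := (norm_nonneg _).trans (hM w hw)
  have := (convex_segment (𝕜 := ℝ) (w.re : ℂ) w).norm_image_sub_le_of_norm_hasDerivWithin_le
    (f := H) (f' := fun w => G w * Complex.exp (-κ * w ^ 2 / 2))
    (C := M * Real.exp (-(κ * ν / 2))) (x := (w.re : ℂ)) (y := w)
    (fun p hp => (hH p (hsb p hp)).hasDerivWithinAt)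
    (fun p hp => by
      rw [norm_mul, Complex.norm_exp]
      have e : (-κ * p ^ 2 / 2 : ℂ).re = -(κ * (p ^ 2).re / 2) := by
        have : (-κ * p ^ 2 / 2 : ℂ) = ((-κ / 2 : ℝ) : ℂ) * p ^ 2 := by push_cast; ring
        rw [this, Complex.re_ofReal_mul]; ring
      rw [e]
      obtain ⟨h1, h2⟩ := hseg p hp
      have h3 : ν ≤ (p ^ 2).re := by
        refine hν.trans ?_
        rw [pow_two, pow_two, Complex.mul_re, Complex.mul_re, h1]
        have := sq_le_sq.2 h2
        nlinarith
      have := hM p (hsb p hp)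
      gcongr)
    (left_mem_segment _ _ _) (right_mem_segment _ _ _)
  refine this.trans ?_
  have h5 : ‖w - w.re‖ ≤ ρ := by
    have : w - w.re = ((w.im : ℝ) : ℂ) * Complex.I := by
      nth_rw 1 [← Complex.re_add_im w]; ring
    rw [this, norm_mul, Complex.norm_I, mul_one, Complex.norm_real]
    exact (Complex.abs_im_le_norm w).trans hw'.le
  gcongr

lemma primitive_sub_eq_integral {κ ρ : ℝ} {G H : ℂ → ℂ}
    (hfd : DifferentiableOn ℂ G (Metric.ball 0 ρ))
    (hH : ∀ w ∈ Metric.ball (0 : ℂ) ρ,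
      HasDerivAt H (G w * Complex.exp (-κ * w ^ 2 / 2)) w) {a b : ℝ} (ha : -ρ < a)
    (hab : a ≤ b) (hb : b < ρ) :
    H b - H a = ∫ w in a..b, G w * ((Real.exp (-κ * w ^ 2 / 2) : ℝ) : ℂ) := by
  have hball : ∀ w ∈ Set.uIcc a b, (w : ℂ) ∈ Metric.ball (0 : ℂ) ρ := by
    intro w hw
    rw [Set.uIcc_of_le hab] at hw
    rw [mem_ball_zero_iff, Complex.norm_real, Real.norm_eq_abs, abs_lt]
    exact ⟨by linarith [hw.1], by linarith [hw.2]⟩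
  symm
  refine intervalIntegral.integral_eq_sub_of_hasDerivAt (f := fun w : ℝ => H w) ?_ ?_
  · intro w hw
    refine (hH w (hball w hw)).comp_ofReal.congr_deriv ?_
    push_cast
    rfl
  · refine ContinuousOn.intervalIntegrable ?_
    refine ContinuousOn.mul (hfd.continuousOn.comp (by fun_prop) hball) ?_
    exact Continuous.continuousOn (by fun_prop)

namespace SaddleChart

variable {d ρ r σ τ x : ℝ} {W z : ℂ → ℂ} (hc : SaddleChart d ρ r σ τ x W z)
  (h : Regular d σ τ x)
include hc h

/-- Near the saddle point, `Re w` has the sign of the increment of the angle. -/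
lemma abs_re_coord_sub_lt {Δ : ℝ} (hΔ0 : Δ ≠ 0) (hΔ : |Δ| < r) (hΔ1 : |Δ| ≤ 1 / 4) :
    |(W (circlePt σ τ x (saddleAngle σ τ x + Δ))).re -
      Δ * (saddleScale σ τ x * (Complex.I * (zPlus σ τ x - x))).re| <
    |Δ| * (saddleScale σ τ x * (Complex.I * (zPlus σ τ x - x))).re := by
  obtain ⟨v1, v2⟩ := norm_le_re_velocity h
  set v := saddleScale σ τ x * (Complex.I * (zPlus σ τ x - x)) with hv
  have happ := hc.approx _ (circlePt_mem_ball h hΔ)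
  set w := W (circlePt σ τ x (saddleAngle σ τ x + Δ)) with hw
  have hΔpos : 0 < |Δ| := abs_pos.2 hΔ0
  have e1 : ‖w - saddleScale σ τ x * (circlePt σ τ x (saddleAngle σ τ x + Δ) - zPlus σ τ x)‖ ≤
      ‖v‖ * |Δ| / 8 := by
    refine happ.trans ?_
    rw [circlePt_sub_zPlus, hv, norm_mul, norm_mul, norm_mul, Complex.norm_I, one_mul,
      ← mul_assoc]
    gcongr
    exact norm_exp_mul_I_sub_one_le Δ
  have e2 : ‖saddleScale σ τ x * (circlePt σ τ x (saddleAngle σ τ x + Δ) - zPlus σ τ x) -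
      (Δ : ℂ) * v‖ ≤ ‖v‖ * |Δ| ^ 2 := by
    have hx : ‖(Δ : ℂ) * Complex.I‖ = |Δ| := by
      rw [norm_mul, Complex.norm_I, mul_one, Complex.norm_real, Real.norm_eq_abs]
    have := Complex.norm_exp_sub_one_sub_id_le (x := (Δ : ℂ) * Complex.I) (by rw [hx]; linarith)
    rw [hx] at this
    have e3 : saddleScale σ τ x * (circlePt σ τ x (saddleAngle σ τ x + Δ) - zPlus σ τ x) -
        (Δ : ℂ) * v = saddleScale σ τ x * (zPlus σ τ x - x) *
          (Complex.exp (Δ * Complex.I) - 1 - Δ * Complex.I) := by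
      rw [circlePt_sub_zPlus, hv]; ring
    rw [e3, hv, norm_mul, norm_mul, norm_mul, norm_mul, Complex.norm_I, one_mul]
    gcongr
  have e4 : ‖w - (Δ : ℂ) * v‖ ≤ ‖v‖ * |Δ| / 8 + ‖v‖ * |Δ| ^ 2 := by
    have : w - (Δ : ℂ) * v =
        (w - saddleScale σ τ x * (circlePt σ τ x (saddleAngle σ τ x + Δ) - zPlus σ τ x)) +
        (saddleScale σ τ x * (circlePt σ τ x (saddleAngle σ τ x + Δ) - zPlus σ τ x) -
          (Δ : ℂ) * v) := by ring
    rw [this]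
    exact (norm_add_le _ _).trans (add_le_add e1 e2)
  have e5 := Complex.abs_re_le_norm (w - (Δ : ℂ) * v)
  rw [Complex.sub_re, Complex.re_ofReal_mul] at e5
  have e6 : ‖v‖ * |Δ| / 8 + ‖v‖ * |Δ| ^ 2 ≤ 3 / 8 * (|Δ| * ‖v‖) := by
    have : ‖v‖ * |Δ| ^ 2 ≤ ‖v‖ * (|Δ| * (1 / 4)) := by rw [pow_two]; gcongr
    linarith
  have e7 : |Δ| * ‖v‖ ≤ |Δ| * (2 * v.re) := by gcongr
  have e8 : 0 < |Δ| * ‖v‖ := by positivity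
  linarith

lemma re_coord_pos {η : ℝ} (hη : 0 < η) (hηr : η < r) (hη1 : η ≤ 1 / 4) :
    0 < (W (circlePt σ τ x (saddleAngle σ τ x + η))).re := by
  have habs : |η| = η := abs_of_pos hη
  have := hc.abs_re_coord_sub_lt h hη.ne' (by rwa [habs]) (by rwa [habs])
  rw [habs] at this
  linarith [(abs_lt.1 this).1]

lemma re_coord_neg {η : ℝ} (hη : 0 < η) (hηr : η < r) (hη1 : η ≤ 1 / 4) :
    (W (circlePt σ τ x (saddleAngle σ τ x + -η))).re < 0 := by
  have habs : |-η| = η := by rw [abs_neg, abs_of_pos hη]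
  have := hc.abs_re_coord_sub_lt h (neg_ne_zero.2 hη.ne') (by rwa [habs]) (by rwa [habs])
  rw [habs] at this
  linarith [(abs_lt.1 this).2]

/-- The quantitative descent along the circle, in terms of the coordinate `w`. -/
lemma le_re_sq_coord {Δ : ℝ} (hΔ : |Δ| < r) (hΔd : |Δ| < d) :
    (d * (Δ / Real.pi) ^ 2) ^ 2 ≤
      (W (circlePt σ τ x (saddleAngle σ τ x + Δ)) ^ 2).re := by
  obtain ⟨m1, m2⟩ := h.saddleAngle_mem
  obtain ⟨a1, a2⟩ := abs_lt.1 hΔd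
  have h1 := h.sq_le_re_phi_circlePt_sub (θ := saddleAngle σ τ x + Δ) (by linarith) (by linarith)
  have h2 := h.le_circleHeight_sq (θ := saddleAngle σ τ x + Δ) (by linarith) (by linarith)
  rw [← hc.sq_eq _ (circlePt_mem_ball h hΔ)] at h1
  rw [add_sub_cancel_left] at h2
  have h3 : (W (circlePt σ τ x (saddleAngle σ τ x + Δ)) ^ 2 / 2).re =
      (W (circlePt σ τ x (saddleAngle σ τ x + Δ)) ^ 2).re / 2 := by simp
  rw [h3] at h1
  have h4 : (d * (Δ / Real.pi) ^ 2) ^ 2 = d ^ 2 * (Δ / Real.pi) ^ 4 := by ring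
  rw [h4]
  linarith

/-- A primitive of the transformed integrand `fPlus · e^{-κ w² / 2}`. -/
lemma exists_primitive (κ : ℝ) : ∃ H : ℂ → ℂ, ∀ w ∈ Metric.ball (0 : ℂ) ρ,
    HasDerivAt H (fPlus x z w * Complex.exp (-κ * w ^ 2 / 2)) w :=
  ((hc.differentiableOn_fPlus h).mul (by fun_prop)).isExactOn_ball

/-- The integral over the central arc in the coordinate `w`, evaluated by a primitive at the end
points, so that the path between them plays no role. -/
lemma integral_arc_eq {n : ℕ} {α β κ : ℝ} (hp : ScaledParams n α β κ σ τ) {H : ℂ → ℂ}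
    (hH : ∀ w ∈ Metric.ball (0 : ℂ) ρ,
      HasDerivAt H (fPlus x z w * Complex.exp (-κ * w ^ 2 / 2)) w)
    {η : ℝ} (hη : 0 < η) (hηr : η < r) (hηd : η < d) :
    (-1) ^ n * ∫ θ in (saddleAngle σ τ x - η)..(saddleAngle σ τ x + η),
        logIntegrand n (n + α) (n + β) x (Real.log (saddleRadius σ τ x) + θ * Complex.I) =
      Complex.I * Complex.exp (-κ * phi σ τ x (zPlus σ τ x)) *
        (H (W (circlePt σ τ x (saddleAngle σ τ x + η))) -
          H (W (circlePt σ τ x (saddleAngle σ τ x + -η)))) := by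
  obtain ⟨m1, m2⟩ := h.saddleAngle_mem
  rw [← intervalIntegral.integral_const_mul, ← sub_eq_add_neg, mul_sub]
  refine intervalIntegral.integral_eq_sub_of_hasDerivAt
    (f := fun θ => Complex.I * Complex.exp (-κ * phi σ τ x (zPlus σ τ x)) *
      H (W (circlePt σ τ x θ))) ?_ ?_
  · intro θ hθ
    rw [Set.uIcc_of_le (by linarith)] at hθ
    have hmem : circlePt σ τ x θ ∈ Metric.ball (zPlus σ τ x) r := by
      have := circlePt_mem_ball h (Δ := θ - saddleAngle σ τ x) (r := r)
        (by rw [abs_lt]; constructor <;> linarith [hθ.1, hθ.2])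
      rwa [add_sub_cancel] at this
    have hWd := (hc.differentiableAt _ hmem).hasDerivAt
    have hw := hc.map_ball _ hmem
    have hchain : deriv z (W (circlePt σ τ x θ)) * deriv W (circlePt σ τ x θ) = 1 := by
      have h1 := (hc.inv_differentiableAt _ hw).hasDerivAt.comp _ hWd
      have h2 : (z ∘ W) =ᶠ[𝓝 (circlePt σ τ x θ)] id := by
        filter_upwards [Metric.isOpen_ball.mem_nhds hmem] with ζ hζ using hc.left_inv ζ hζ
      exact (h1.congr_of_eventuallyEq h2.symm).unique (hasDerivAt_id _)
    have hd := (((hH _ hw).comp _ hWd).comp θ (hasDerivAt_circlePt σ τ x θ)).const_mul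
      (Complex.I * Complex.exp (-κ * phi σ τ x (zPlus σ τ x)))
    refine hd.congr_deriv ?_
    rw [logIntegrand_circle hp h (by linarith [hθ.1]) (by linarith [hθ.2]), fPlus_eq,
      hc.left_inv _ hmem, mul_div_assoc, hc.sq_eq _ hmem]
    have e : Complex.exp (-κ * phi σ τ x (circlePt σ τ x θ)) =
        Complex.exp (-κ * phi σ τ x (zPlus σ τ x)) *
        Complex.exp (-κ * (phi σ τ x (circlePt σ τ x θ) - phi σ τ x (zPlus σ τ x))) := by
      rw [← Complex.exp_add]; congr 1; ring
    rw [e]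
    set e1 := Complex.exp (-κ * phi σ τ x (zPlus σ τ x))
    set e2 := Complex.exp (-κ * (phi σ τ x (circlePt σ τ x θ) - phi σ τ x (zPlus σ τ x)))
    linear_combination (e1 * e2 * saddleAmp x (circlePt σ τ x θ) * (circlePt σ τ x θ - x)) *
      (Complex.I ^ 2 * hchain + Complex.I_sq)
  · refine ContinuousOn.intervalIntegrable ?_
    rw [Set.uIcc_of_le (by linarith)]
    refine (continuousOn_const.mul (continuousOn_logIntegrand_circle hp.alpha_nonneg
      hp.beta_nonneg)).mono (Set.Icc_subset_Icc (by linarith) (by linarith))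

end SaddleChart

/-! ### Uniform expansion of the half circle integral -/

lemma Regular.mono {d d' σ τ x : ℝ} (h : Regular d σ τ x) (hd' : 0 < d') (hle : d' ≤ d) :
    Regular d' σ τ x :=
  ⟨hd', h.abs_tau_le, hle.trans h.le_one_sub_sigma, hle.trans h.le_one_sub,
    hle.trans h.le_one_add, hle.trans h.le_U⟩

/-- A margin from the turning points is also a margin from `±1`, since `-1 ≤ x₋` and `x₊ ≤ 1`. -/
lemma regular_of_margin {σ τ x δ : ℝ} (hδ : 0 < δ) (hτ : |τ| ≤ σ) (hσ : σ < 1)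
    (h1 : xMinus σ τ + δ ≤ x) (h2 : x ≤ xPlus σ τ - δ) : Regular (min δ (1 - σ)) σ τ x := by
  have hτ' := abs_le.1 hτ
  have hσ0 : 0 ≤ σ := (abs_nonneg _).trans hτ
  have p1 : 0 ≤ 1 - σ ^ 2 := by nlinarith
  have p2 : 0 ≤ 1 - τ ^ 2 := by nlinarith
  set s := √((1 - σ ^ 2) * (1 - τ ^ 2)) with hs
  have hs0 : 0 ≤ s := Real.sqrt_nonneg _
  have hs2 : s ^ 2 = (1 - σ ^ 2) * (1 - τ ^ 2) := Real.sq_sqrt (mul_nonneg p1 p2)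
  rw [xMinus, ← hs] at h1
  rw [xPlus, ← hs] at h2
  have b1 : s ≤ 1 + σ * τ := by
    refine le_of_sq_le_sq ?_ (by nlinarith)
    nlinarith [sq_nonneg (σ + τ)]
  have b2 : s ≤ 1 - σ * τ := by
    refine le_of_sq_le_sq ?_ (by nlinarith)
    nlinarith [sq_nonneg (σ - τ)]
  refine ⟨lt_min hδ (by linarith), hτ, min_le_right _ _, (min_le_left _ _).trans (by linarith),
    (min_le_left _ _).trans (by linarith), (min_le_left _ _).trans (Real.le_sqrt_of_sq_le ?_)⟩
  have e : 1 - 2 * σ * τ * x - τ ^ 2 - σ ^ 2 - x ^ 2 =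
      (s - (x + σ * τ)) * (s + (x + σ * τ)) := by linear_combination -hs2
  rw [e]
  nlinarith

lemma kappa_pos {n : ℕ} {α β : ℝ} (hα : 0 ≤ α) (hβ : 0 ≤ β) : 0 < kappa n α β := by
  unfold kappa; positivity

lemma scaledParams {n : ℕ} {α β : ℝ} (hα : 0 ≤ α) (hβ : 0 ≤ β) :
    ScaledParams n α β (kappa n α β) (sigma n α β) (tau n α β) := by
  have hκ := kappa_pos (n := n) hα hβ
  refine ⟨hα, hβ, hκ, ?_, ?_, ?_⟩
  · rw [tau, mul_add, mul_div_assoc', mul_comm 2, mul_div_mul_left _ _ hκ.ne', kappa]; ring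
  · rw [tau, mul_sub, mul_div_assoc', mul_comm 2, mul_div_mul_left _ _ hκ.ne', kappa]; ring
  · rw [sigma, mul_sub, mul_div_assoc', mul_comm 2, mul_div_mul_left _ _ hκ.ne', kappa]; ring

lemma abs_tau_le_sigma {n : ℕ} {α β : ℝ} (hα : 0 ≤ α) (hβ : 0 ≤ β) :
    |tau n α β| ≤ sigma n α β := by
  have hκ := kappa_pos (n := n) hα hβ
  rw [tau, sigma, abs_div, abs_of_pos (by positivity : 0 < 2 * kappa n α β)]
  gcongr
  rw [abs_le]
  constructor <;> linarith

lemma sigma_lt_one {n : ℕ} {α β : ℝ} (hα : 0 ≤ α) (hβ : 0 ≤ β) : sigma n α β < 1 := by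
  have hκ := kappa_pos (n := n) hα hβ
  rw [sigma, div_lt_one (by positivity), kappa]
  have : (0 : ℝ) ≤ n := by positivity
  linarith

section Bounds

variable {n : ℕ} {α β κ σ τ d x : ℝ} (hp : ScaledParams n α β κ σ τ) (h : Regular d σ τ x)
include hp h

lemma norm_logIntegrand_circle_le (θ : ℝ) :
    ‖logIntegrand n (n + α) (n + β) x (Real.log (saddleRadius σ τ x) + θ * Complex.I)‖ ≤
      ‖Complex.exp (-κ * phi σ τ x (zPlus σ τ x))‖ *
        (√(((d / 4)⁻¹) ^ 3) * Real.exp (1 / d + 1 / d ^ 2) *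
          Real.exp (-(κ * circleHeight σ τ x θ ^ 2 / 8))) := by
  have key : ∀ θ : ℝ, ‖logIntegrand n (n + α) (n + β) x
      (Real.log (saddleRadius σ τ x) + θ * Complex.I)‖ =
      ‖1 - circlePt σ τ x θ‖ ^ (n + α) * ‖1 + circlePt σ τ x θ‖ ^ (n + β) *
        Real.exp (-(n * Real.log (saddleRadius σ τ x))) := by
    intro θ
    rw [norm_logIntegrand, exp_log_saddleRadius h]
    congr 4
    simp
  have hsad : ‖logIntegrand n (n + α) (n + β) x
      (Real.log (saddleRadius σ τ x) + saddleAngle σ τ x * Complex.I)‖ ≤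
      ‖Complex.exp (-κ * phi σ τ x (zPlus σ τ x))‖ * √(((d / 4)⁻¹) ^ 3) := by
    obtain ⟨m1, m2⟩ := h.saddleAngle_mem
    have hd := h.pos
    have e := congrArg norm (logIntegrand_circle hp h (θ := saddleAngle σ τ x)
      (by linarith) (by linarith))
    rw [norm_mul, norm_pow, norm_neg, norm_one, one_pow, one_mul, circlePt_saddleAngle, norm_mul,
      norm_mul] at e
    rw [e]
    have h1 := Real.le_sqrt_of_sq_le (h.norm_saddleAmp_sq_le
      (Metric.mem_ball_self (by linarith : 0 < d / 4)))
    calc _ ≤ ‖Complex.exp (-κ * phi σ τ x (zPlus σ τ x))‖ * √(((d / 4)⁻¹) ^ 3) * 1 := by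
          gcongr
          exact h.norm_sub_zPlus_le
      _ = _ := mul_one _
  rw [key, circlePt_saddleAngle] at hsad
  rw [key]
  have h2 := h.rpow_mul_rpow_circlePt_le hp.kappa_pos.le hp.add_alpha hp.add_beta
    (by have := hp.alpha_nonneg; positivity) (by have := hp.beta_nonneg; positivity) θ
  calc _ ≤ ‖1 - zPlus σ τ x‖ ^ (n + α) * ‖1 + zPlus σ τ x‖ ^ (n + β) *
        (Real.exp (1 / d + 1 / d ^ 2) * Real.exp (-(κ * circleHeight σ τ x θ ^ 2 / 8))) *
        Real.exp (-(n * Real.log (saddleRadius σ τ x))) := by gcongr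
    _ = ‖1 - zPlus σ τ x‖ ^ (n + α) * ‖1 + zPlus σ τ x‖ ^ (n + β) *
        Real.exp (-(n * Real.log (saddleRadius σ τ x))) *
        (Real.exp (1 / d + 1 / d ^ 2) * Real.exp (-(κ * circleHeight σ τ x θ ^ 2 / 8))) := by ring
    _ ≤ ‖Complex.exp (-κ * phi σ τ x (zPlus σ τ x))‖ * √(((d / 4)⁻¹) ^ 3) *
        (Real.exp (1 / d + 1 / d ^ 2) * Real.exp (-(κ * circleHeight σ τ x θ ^ 2 / 8))) := by gcongr
    _ = _ := by ring

lemma norm_logIntegrand_circle_le_of_le {η θ : ℝ} (h0 : 0 ≤ θ) (h1 : θ ≤ Real.pi) (hη : 0 ≤ η)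
    (hθ : η ≤ |θ - saddleAngle σ τ x|) :
    ‖logIntegrand n (n + α) (n + β) x (Real.log (saddleRadius σ τ x) + θ * Complex.I)‖ ≤
      ‖Complex.exp (-κ * phi σ τ x (zPlus σ τ x))‖ *
        (√(((d / 4)⁻¹) ^ 3) * Real.exp (1 / d + 1 / d ^ 2) *
          Real.exp (-(κ * (d * (η / Real.pi) ^ 2) ^ 2 / 2))) := by
  refine (norm_logIntegrand_circle_le hp h θ).trans ?_
  have hpi := Real.pi_pos
  have h2 := h.le_circleHeight_sq h0 h1
  have h3 : (η / Real.pi) ^ 4 ≤ ((θ - saddleAngle σ τ x) / Real.pi) ^ 4 := by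
    have : ((θ - saddleAngle σ τ x) / Real.pi) ^ 4 = (|θ - saddleAngle σ τ x| / Real.pi) ^ 4 := by
      rw [div_pow, div_pow, ← Even.pow_abs (by decide : Even 4)]
    rw [this]
    gcongr
  have h4 : (d * (η / Real.pi) ^ 2) ^ 2 ≤ circleHeight σ τ x θ ^ 2 / 4 := by
    have : (d * (η / Real.pi) ^ 2) ^ 2 = d ^ 2 * (η / Real.pi) ^ 4 := by ring
    rw [this]
    nlinarith [mul_le_mul_of_nonneg_left h3 (sq_nonneg d)]
  gcongr _ * (_ * Real.exp (-?_))
  have h5 := mul_le_mul_of_nonneg_left h4 hp.kappa_pos.le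
  linarith

lemma norm_integral_sub_integral_arc_le {η : ℝ} (hη : 0 < η) (hηd : η < d) :
    ‖(∫ θ in (0 : ℝ)..Real.pi, logIntegrand n (n + α) (n + β) x
        (Real.log (saddleRadius σ τ x) + θ * Complex.I)) -
      ∫ θ in (saddleAngle σ τ x - η)..(saddleAngle σ τ x + η),
        logIntegrand n (n + α) (n + β) x
          (Real.log (saddleRadius σ τ x) + θ * Complex.I)‖ ≤
      ‖Complex.exp (-κ * phi σ τ x (zPlus σ τ x))‖ *
        (√(((d / 4)⁻¹) ^ 3) * Real.exp (1 / d + 1 / d ^ 2) *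
          Real.exp (-(κ * (d * (η / Real.pi) ^ 2) ^ 2 / 2))) * Real.pi := by
  obtain ⟨m1, m2⟩ := h.saddleAngle_mem
  have hpi := Real.pi_pos
  set f : ℝ → ℂ := fun θ => logIntegrand n (n + α) (n + β) x
    (Real.log (saddleRadius σ τ x) + θ * Complex.I) with hf
  set B := ‖Complex.exp (-κ * phi σ τ x (zPlus σ τ x))‖ *
        (√(((d / 4)⁻¹) ^ 3) * Real.exp (1 / d + 1 / d ^ 2) *
          Real.exp (-(κ * (d * (η / Real.pi) ^ 2) ^ 2 / 2))) with hB
  have hcont : ContinuousOn f (Set.Icc 0 Real.pi) :=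
    continuousOn_logIntegrand_circle hp.alpha_nonneg hp.beta_nonneg
  have hint : ∀ a b, 0 ≤ a → a ≤ b → b ≤ Real.pi →
      IntervalIntegrable f MeasureTheory.volume a b := by
    intro a b ha hab hb
    refine ContinuousOn.intervalIntegrable ?_
    rw [Set.uIcc_of_le hab]
    exact hcont.mono (Set.Icc_subset_Icc ha hb)
  have i1 := hint 0 (saddleAngle σ τ x - η) le_rfl (by linarith) (by linarith)
  have i2 := hint (saddleAngle σ τ x - η) (saddleAngle σ τ x + η) (by linarith) (by linarith)
    (by linarith)
  have i3 := hint (saddleAngle σ τ x + η) Real.pi (by linarith) (by linarith) le_rfl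
  rw [← intervalIntegral.integral_add_adjacent_intervals (i1.trans i2) i3,
    ← intervalIntegral.integral_add_adjacent_intervals i1 i2]
  have b1 : ‖∫ θ in (0 : ℝ)..(saddleAngle σ τ x - η), f θ‖ ≤
      B * |saddleAngle σ τ x - η - 0| := by
    refine intervalIntegral.norm_integral_le_of_norm_le_const fun θ hθ => ?_
    rw [Set.uIoc_of_le (by linarith)] at hθ
    refine norm_logIntegrand_circle_le_of_le hp h hθ.1.le (by linarith [hθ.2]) hη.le ?_
    rw [abs_of_nonpos (by linarith [hθ.2])]
    linarith [hθ.2]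
  have b3 : ‖∫ θ in (saddleAngle σ τ x + η)..Real.pi, f θ‖ ≤
      B * |Real.pi - (saddleAngle σ τ x + η)| := by
    refine intervalIntegral.norm_integral_le_of_norm_le_const fun θ hθ => ?_
    rw [Set.uIoc_of_le (by linarith)] at hθ
    refine norm_logIntegrand_circle_le_of_le hp h (by linarith [hθ.1]) hθ.2 hη.le ?_
    rw [abs_of_nonneg (by linarith [hθ.1])]
    linarith [hθ.1]
  rw [abs_of_nonneg (by linarith)] at b1 b3
  have e : ∀ a b c : ℂ, a + b + c - b = a + c := fun a b c => by ring
  rw [e]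
  have hB0 : 0 ≤ B := by positivity
  refine (norm_add_le _ _).trans ((add_le_add b1 b3).trans ?_)
  nlinarith

/-- The cut contribution, relative to the size of the integrand at the saddle point. -/
lemma abs_re_half_circle_sub_saddle_circle_le {η : ℝ} (hη : 0 < η) (hηd : η < d) :
    |(∫ θ in (0 : ℝ)..Real.pi, logIntegrand n (n + α) (n + β) x
        (Real.log (d / 2) + θ * Complex.I)).re -
      (∫ θ in (0 : ℝ)..Real.pi, logIntegrand n (n + α) (n + β) x
        (Real.log (saddleRadius σ τ x) + θ * Complex.I)).re| ≤
      ‖Complex.exp (-κ * phi σ τ x (zPlus σ τ x))‖ *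
        (√(((d / 4)⁻¹) ^ 3) * Real.exp (1 / d + 1 / d ^ 2) *
          Real.exp (-(κ * (d * (η / Real.pi) ^ 2) ^ 2 / 2))) * (2 * -Real.log (d / 2)) := by
  obtain ⟨m1, m2⟩ := h.saddleAngle_mem
  have hd := h.pos
  have hpi := Real.pi_pos
  have hL : Real.log (d / 2) ≤ Real.log (saddleRadius σ τ x) :=
    Real.log_le_log (by positivity) h.half_le_saddleRadius
  have hL0 : Real.log (saddleRadius σ τ x) ≤ 0 :=
    Real.log_nonpos h.saddleRadius_pos.le h.saddleRadius_le_one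
  refine (abs_re_half_circle_sub_le hp.alpha_nonneg hp.beta_nonneg h.one_sub_pos h.one_add_pos
    hL).trans ?_
  have b1 := norm_logIntegrand_circle_le_of_le hp h (θ := 0) (η := η) le_rfl hpi.le hη.le (by
    rw [zero_sub, abs_neg, abs_of_nonneg (by linarith)]; linarith)
  have b2 := norm_logIntegrand_circle_le_of_le hp h (θ := Real.pi) (η := η) hpi.le le_rfl hη.le (by
    rw [abs_of_nonneg (by linarith)]; linarith)
  rw [Complex.ofReal_zero, zero_mul, add_zero] at b1
  set B := ‖Complex.exp (-κ * phi σ τ x (zPlus σ τ x))‖ *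
        (√(((d / 4)⁻¹) ^ 3) * Real.exp (1 / d + 1 / d ^ 2) *
          Real.exp (-(κ * (d * (η / Real.pi) ^ 2) ^ 2 / 2))) with hB
  have hB0 : 0 ≤ B := by positivity
  calc _ ≤ (B + B) * (-Real.log (d / 2)) := by
        gcongr
        linarith
    _ = _ := by ring

end Bounds

/-- Exponentially small terms are negligible against every Gaussian moment. -/
lemma exp_neg_le_mul_moment {ν : ℝ} (hν : 0 < ν) (N : ℕ) {κ : ℝ} (hκ : 1 ≤ κ) :
    Real.exp (-(κ * ν / 2)) ≤
      (N + 1).factorial * (2 / ν) ^ (N + 1) * (√(2 * Real.pi / κ) / κ ^ N) := by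
  have hκ0 : 0 < κ := by linarith
  have h1 := Real.pow_div_factorial_le_exp (x := κ * ν / 2) (by positivity) (N + 1)
  have h2 : Real.exp (-(κ * ν / 2)) ≤
      (N + 1).factorial * (2 / ν) ^ (N + 1) * (1 / κ ^ (N + 1)) := by
    rw [Real.exp_neg]
    refine (inv_anti₀ (by positivity) h1).trans_eq ?_
    rw [inv_div, mul_div_assoc, mul_pow, div_pow, div_pow]
    field_simp
  refine h2.trans (mul_le_mul_of_nonneg_left ?_ (by positivity))
  have h3 : 1 / κ ≤ √(2 * Real.pi / κ) := by
    refine Real.le_sqrt_of_sq_le ?_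
    rw [div_pow, one_pow, div_le_div_iff₀ (by positivity) hκ0]
    nlinarith [Real.pi_gt_three, mul_pos hκ0 hκ0]
  calc 1 / κ ^ (N + 1) = (1 / κ) / κ ^ N := by rw [pow_succ']; field_simp
    _ ≤ _ := by gcongr

lemma ofReal_ascPochhammer_half (j : ℕ) :
    (((ascPochhammer ℝ j).eval (1 / 2) : ℝ) : ℂ) = (ascPochhammer ℂ j).eval (1 / 2) := by
  induction j with
  | zero => simp
  | succ j ih =>
    rw [ascPochhammer_succ_eval, ascPochhammer_succ_eval, ← ih]
    push_cast
    rfl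

/-- The saddle point expansion of the half circle integral, together with the smallness of the
cut contribution, relative to the value `e^{-κ φ(z₊)}` at the saddle point. -/
lemma exists_half_circle_expansion {d : ℝ} (hd : 0 < d) (hd1 : d ≤ 1) (N : ℕ) :
    ∃ C : ℝ, ∀ (n : ℕ) (α β κ σ τ x : ℝ) (z : ℂ → ℂ),
      ScaledParams n α β κ σ τ → Regular d σ τ x → 1 ≤ κ → IsSaddleBranch σ τ x z →
      ‖(-1) ^ n * (∫ θ in (0 : ℝ)..Real.pi, logIntegrand n (n + α) (n + β) x
          (Real.log (saddleRadius σ τ x) + θ * Complex.I)) -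
        Complex.I * Complex.exp (-κ * phi σ τ x (zPlus σ τ x)) *
          (-(1 + Complex.I) / (2 * √(U σ τ x)) * √(2 * Real.pi / κ) *
            ∑ j ∈ Finset.range N, cCoeff x z j / (κ : ℂ) ^ j)‖ +
      |(∫ θ in (0 : ℝ)..Real.pi, logIntegrand n (n + α) (n + β) x
          (Real.log (d / 2) + θ * Complex.I)).re -
        (∫ θ in (0 : ℝ)..Real.pi, logIntegrand n (n + α) (n + β) x
          (Real.log (saddleRadius σ τ x) + θ * Complex.I)).re| ≤
      ‖Complex.exp (-κ * phi σ τ x (zPlus σ τ x))‖ * (C * (√(2 * Real.pi / κ) / κ ^ N)) := by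
  obtain ⟨ρ, r, hρ, hr, hrd, hchart⟩ := exists_saddleChart hd
  have hpi := Real.pi_pos
  -- the half-width of the arc on which the local coordinate is used
  set η := min (r / 2) (1 / 4) with hη
  have hη0 : 0 < η := by positivity
  have hηr : η < r := (min_le_left _ _).trans_lt (by linarith)
  have hη1 : η ≤ 1 / 4 := min_le_right _ _
  have hηd : η < d := by linarith
  set m := d * (η / Real.pi) ^ 2 with hm
  have hm0 : 0 < m := by positivity
  set M := 4 / d * √(((d / 4)⁻¹) ^ 3) with hM
  have hM0 : 0 ≤ M := by positivity
  obtain ⟨C₁, hC₁0, hC₁⟩ := norm_integral_mul_gauss_sub_le hρ hM0 hm0 N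
  set K := √(((d / 4)⁻¹) ^ 3) * Real.exp (1 / d + 1 / d ^ 2) with hK
  have hl : 0 ≤ -Real.log (d / 2) := by
    have := Real.log_nonpos (by positivity : 0 ≤ d / 2) (by linarith)
    linarith
  refine ⟨C₁ * (2 ^ N * (ascPochhammer ℝ N).eval (1 / 2)) +
    (2 * M * ρ + K * Real.pi + K * (2 * -Real.log (d / 2))) *
      ((N + 1).factorial * (2 / m ^ 2) ^ (N + 1)), ?_⟩
  intro n α β κ σ τ x z' hp h hκ hz'
  obtain ⟨W, z, hc⟩ := hchart σ τ x h
  have hκ0 := hp.kappa_pos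
  set E := Complex.exp (-κ * phi σ τ x (zPlus σ τ x)) with hE
  set g := √(2 * Real.pi / κ) / κ ^ N with hg
  have hg0 : 0 ≤ g := by positivity
  set w₁ := W (circlePt σ τ x (saddleAngle σ τ x + η)) with hw₁
  set w₀ := W (circlePt σ τ x (saddleAngle σ τ x + -η)) with hw₀
  have habs : |η| = η := abs_of_pos hη0
  have habs' : |-η| = η := by rw [abs_neg, habs]
  have hw₁b : w₁ ∈ Metric.ball (0 : ℂ) ρ := hc.map_ball _ (circlePt_mem_ball h (by rwa [habs]))
  have hw₀b : w₀ ∈ Metric.ball (0 : ℂ) ρ := hc.map_ball _ (circlePt_mem_ball h (by rwa [habs']))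
  have hν₁ : m ^ 2 ≤ (w₁ ^ 2).re := hc.le_re_sq_coord h (by rwa [habs]) (by rwa [habs])
  have hν₀ : m ^ 2 ≤ (w₀ ^ 2).re := by
    have := hc.le_re_sq_coord h (Δ := -η) (by rwa [habs']) (by rwa [habs'])
    rwa [neg_div, neg_sq] at this
  have hre : ∀ w : ℂ, m ^ 2 ≤ (w ^ 2).re → m ≤ |w.re| := by
    intro w hw
    refine le_of_sq_le_sq ?_ (abs_nonneg _)
    rw [sq_abs]
    rw [pow_two w, Complex.mul_re] at hw
    nlinarith [mul_self_nonneg w.im]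
  have hb : m ≤ w₁.re := by
    have := hre _ hν₁
    rwa [abs_of_pos (hc.re_coord_pos h hη0 hηr hη1)] at this
  have ha : w₀.re ≤ -m := by
    have := hre _ hν₀
    rw [abs_of_neg (hc.re_coord_neg h hη0 hηr hη1)] at this
    linarith
  have hb' : w₁.re < ρ :=
    (Complex.re_le_norm _).trans_lt (by simpa using hw₁b)
  have ha' : -ρ < w₀.re := by
    have h1 := Complex.abs_re_le_norm w₀
    have h2 : ‖w₀‖ < ρ := by simpa using hw₀b
    linarith [(abs_le.1 h1).1]
  have hfM : ∀ w ∈ Metric.ball (0 : ℂ) ρ, ‖fPlus x z w‖ ≤ M := fun w hw => hc.norm_fPlus_le h hw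
  have hfd := hc.differentiableOn_fPlus h
  obtain ⟨H, hH⟩ := hc.exists_primitive h κ
  have q₁ := norm_primitive_sub_re_le hκ0.le hH hfM hw₁b hν₁
  have q₀ := norm_primitive_sub_re_le hκ0.le hH hfM hw₀b hν₀
  have q₂ := hC₁ (fPlus x z) w₀.re w₁.re κ hfd hfM ha' ha hb hb' hκ0
  rw [← primitive_sub_eq_integral hfd hH ha' (by linarith) hb'] at q₂
  set T := ∑ j ∈ Finset.range N, iteratedDeriv (2 * j) (fPlus x z) 0 / ((2 * j).factorial : ℂ) *
          (gaussMoment κ j : ℂ) with hT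
  -- the moments turn the Taylor coefficients `f_{2j}` into `f₀ c_j √(2π/κ) / κ^j`
  have hTc : -(1 + Complex.I) / (2 * √(U σ τ x)) * √(2 * Real.pi / κ) *
      ∑ j ∈ Finset.range N, cCoeff x z' j / (κ : ℂ) ^ j = T := by
    rw [← hc.fCoeff_zero h, Finset.mul_sum]
    refine Finset.sum_congr rfl fun j _ => ?_
    have hf0 : fCoeff x z 0 ≠ 0 := by
      intro h0
      have := hc.cCoeff_zero h
      rw [cCoeff, h0, div_zero] at this
      exact zero_ne_one this
    have hκc : (κ : ℂ) ≠ 0 := by exact_mod_cast hκ0.ne'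
    rw [hc.cCoeff_eq_of_isSaddleBranch hr hz', cCoeff, gaussMoment]
    push_cast
    rw [ofReal_ascPochhammer_half]
    rw [show iteratedDeriv (2 * j) (fPlus x z) 0 / ((2 * j).factorial : ℂ) = fCoeff x z (2 * j)
      from rfl]
    field_simp
  have harc := hc.integral_arc_eq h hp hH hη0 hηr hηd
  rw [← hE, ← hw₁, ← hw₀] at harc
  have hout := norm_integral_sub_integral_arc_le hp h hη0 hηd
  have hcut := abs_re_half_circle_sub_saddle_circle_le hp h hη0 hηd
  rw [← hE, ← hK, ← hm] at hout hcut
  have hexp := exp_neg_le_mul_moment (by positivity : 0 < m ^ 2) N hκ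
  rw [← hg] at hexp
  set e := Real.exp (-(κ * m ^ 2 / 2)) with he
  rw [hTc]
  set I₀ := ∫ θ in (0 : ℝ)..Real.pi, logIntegrand n (n + α) (n + β) x
          (Real.log (saddleRadius σ τ x) + θ * Complex.I) with hI₀
  set I₁ := ∫ θ in (saddleAngle σ τ x - η)..(saddleAngle σ τ x + η),
        logIntegrand n (n + α) (n + β) x
          (Real.log (saddleRadius σ τ x) + θ * Complex.I) with hI₁
  -- the errors: the circle outside the arc, the shift of the end points of the path to the real
  -- axis, and Laplace's method on the real interval
  have hmain : ‖(-1) ^ n * I₀ - Complex.I * E * T‖ ≤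
      ‖E‖ * (K * e) * Real.pi + ‖E‖ * (C₁ * gaussMoment κ N + 2 * (M * e * ρ)) := by
    have e1 : (-1) ^ n * I₀ - Complex.I * E * T = (-1) ^ n * (I₀ - I₁) +
        Complex.I * E * ((H w₁ - H w₁.re) - (H w₀ - H w₀.re) + (H w₁.re - H w₀.re - T)) := by
      linear_combination harc
    rw [e1]
    refine (norm_add_le _ _).trans (add_le_add ?_ ?_)
    · rw [norm_mul, norm_pow, norm_neg, norm_one, one_pow, one_mul]
      exact hout
    · rw [norm_mul, norm_mul, Complex.norm_I, one_mul]
      gcongr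
      refine (norm_add_le _ _).trans ?_
      have := norm_sub_le (H w₁ - H w₁.re) (H w₀ - H w₀.re)
      linarith
  have hgm : gaussMoment κ N = (2 ^ N * (ascPochhammer ℝ N).eval (1 / 2)) * g := by
    rw [gaussMoment, hg]; ring
  refine (add_le_add hmain hcut).trans ?_
  rw [hgm]
  have hk0 : 0 ≤ 2 * M * ρ + K * Real.pi + K * (2 * -Real.log (d / 2)) := by positivity
  calc _ = ‖E‖ * (C₁ * (2 ^ N * (ascPochhammer ℝ N).eval (1 / 2)) * g +
        (2 * M * ρ + K * Real.pi + K * (2 * -Real.log (d / 2))) * e) := by ring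
    _ ≤ ‖E‖ * (C₁ * (2 ^ N * (ascPochhammer ℝ N).eval (1 / 2)) * g +
        (2 * M * ρ + K * Real.pi + K * (2 * -Real.log (d / 2))) *
          ((N + 1).factorial * (2 / m ^ 2) ^ (N + 1) * g)) := by gcongr
    _ = _ := by ring

/-! ### The amplitude -/

lemma exp_neg_pi_div_four_mul_I :
    Complex.exp (-((Real.pi / 4 : ℝ) * Complex.I)) = (1 - Complex.I) * ((√2)⁻¹ : ℝ) := by
  rw [← neg_mul, ← Complex.ofReal_neg, Complex.exp_mul_I, ← Complex.ofReal_cos,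
    ← Complex.ofReal_sin, Real.cos_neg, Real.sin_neg, Real.cos_pi_div_four, Real.sin_pi_div_four]
  have : √2 / 2 = (√2)⁻¹ := by
    rw [div_eq_iff two_ne_zero, eq_inv_mul_iff_mul_eq₀ (by positivity),
      Real.mul_self_sqrt (by norm_num)]
  rw [this]
  push_cast
  ring

section Amplitude

variable {n : ℕ} {α β d x : ℝ} (hα : 0 ≤ α) (hβ : 0 ≤ β)
  (h : Regular d (sigma n α β) (tau n α β) x)
include h

lemma Regular.weight_pos : 0 < weight α β x :=
  mul_pos (Real.rpow_pos_of_pos h.one_sub_pos _) (Real.rpow_pos_of_pos h.one_add_pos _)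

include hα hβ

/-- The amplitude is the leading term of the saddle point contribution, normalised as in the
half circle integral for the Jacobi polynomial. -/
lemma amplitude_eq : amplitude n α β x =
    ((1 / (2 ^ n * weight α β x * Real.pi) : ℝ) : ℂ) *
      (Complex.I * Complex.exp (-kappa n α β *
          phi (sigma n α β) (tau n α β) x (zPlus (sigma n α β) (tau n α β) x)) *
        (-(1 + Complex.I) / (2 * √(U (sigma n α β) (tau n α β) x)) *
          √(2 * Real.pi / kappa n α β))) := by
  have hκ := kappa_pos (n := n) hα hβ
  have hU := h.U_pos
  have hw := h.weight_pos
  have hpi := Real.pi_pos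
  rw [amplitude]
  set κ := kappa n α β
  set u := U (sigma n α β) (tau n α β) x
  have s2 : ((√2 : ℝ) : ℂ) ^ 2 = 2 := by
    rw [← Complex.ofReal_pow, Real.sq_sqrt (by norm_num)]; norm_num
  have sp : ((√Real.pi : ℝ) : ℂ) ^ 2 = Real.pi := by
    rw [← Complex.ofReal_pow, Real.sq_sqrt hpi.le]
  have n2 : ((√2 : ℝ) : ℂ) ≠ 0 := by exact_mod_cast (by positivity : √2 ≠ 0)
  have np : ((√Real.pi : ℝ) : ℂ) ≠ 0 := by exact_mod_cast (by positivity : √Real.pi ≠ 0)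
  have nk : ((√κ : ℝ) : ℂ) ≠ 0 := by exact_mod_cast (Real.sqrt_pos.2 hκ).ne'
  have nu : ((√u : ℝ) : ℂ) ≠ 0 := by exact_mod_cast (Real.sqrt_pos.2 hU).ne'
  have nw : (weight α β x : ℂ) ≠ 0 := by exact_mod_cast hw.ne'
  rw [sub_eq_add_neg, Complex.exp_add, exp_neg_pi_div_four_mul_I,
    Real.sqrt_mul (by positivity), Real.sqrt_mul hpi.le, Real.sqrt_div (by positivity),
    Real.sqrt_mul (by norm_num)]
  push_cast
  rw [← sp, neg_mul]
  field_simp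
  rw [s2]
  linear_combination 2 * Complex.I_sq

lemma amplitude_ne_zero : amplitude n α β x ≠ 0 := by
  have hκ := kappa_pos (n := n) hα hβ
  have hU := h.U_pos
  have hw := h.weight_pos
  have hpi := Real.pi_pos
  refine div_ne_zero (Complex.exp_ne_zero _) ?_
  exact_mod_cast (by positivity : (2 ^ n * weight α β x * √(Real.pi * kappa n α β *
    U (sigma n α β) (tau n α β) x)) ≠ 0)

omit hα hβ in
/-- The leading Taylor coefficient of the transformed integrand is bounded away from zero. -/
lemma half_le_norm_leading : 1 / 2 ≤
    ‖-(1 + Complex.I) / (2 * √(U (sigma n α β) (tau n α β) x) : ℂ)‖ := by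
  have h1 : (1 : ℝ) ≤ ‖1 + Complex.I‖ := by
    simpa using Complex.re_le_norm (1 + Complex.I)
  have h2 := Real.sqrt_pos.2 h.U_pos
  have h3 : √(U (sigma n α β) (tau n α β) x) ≤ 1 := Real.sqrt_le_one.2 h.U_le_one
  rw [norm_div, norm_neg, norm_mul, Complex.norm_real, Complex.norm_ofNat,
    Real.norm_of_nonneg h2.le,
    div_le_div_iff₀ two_pos (by positivity)]
  nlinarith

/-- Polar form of the amplitude. -/
lemma amplitude_eq_polar : amplitude n α β x =
    (((2 : ℝ) ^ ((α + β + 1) / 2) * Real.exp (-kappa n α β * psi (sigma n α β) (tau n α β)) /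
      √(Real.pi * kappa n α β * weight α β x * U (sigma n α β) (tau n α β) x) : ℝ) : ℂ) *
    Complex.exp (((-(kappa n α β * chi (sigma n α β) (tau n α β) x + Real.pi / 4) : ℝ) : ℂ) *
      Complex.I) := by
  have hκ := kappa_pos (n := n) hα hβ
  have hU := h.U_pos
  have hw := h.weight_pos
  have hpi := Real.pi_pos
  have hp := scaledParams (n := n) hα hβ
  rw [amplitude, h.phi_zPlus]
  set κ := kappa n α β with hκd
  set σ := sigma n α β
  set τ := tau n α β
  set u := U σ τ x
  have e1 : κ * (σ + τ) = α := by linear_combination hp.degree - hp.add_alpha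
  have e2 : κ * (σ - τ) = β := by linear_combination hp.degree - hp.add_beta
  have ew : Real.exp (-(κ * xi σ τ x)) = √(weight α β x) := by
    rw [Real.sqrt_eq_rpow, Real.rpow_def_of_pos hw, weight,
      Real.log_mul (Real.rpow_pos_of_pos h.one_sub_pos _).ne'
        (Real.rpow_pos_of_pos h.one_add_pos _).ne',
      Real.log_rpow h.one_sub_pos, Real.log_rpow h.one_add_pos, xi]
    congr 1
    rw [← e1, ← e2]
    ring
  have e2p : Real.exp (κ * Real.log 2) = 2 ^ n * 2 ^ ((α + β + 1) / 2) := by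
    rw [mul_comm, ← Real.rpow_def_of_pos two_pos, hκd, kappa, Real.rpow_add two_pos,
      Real.rpow_natCast]
  have e3 : -(κ : ℂ) * (((-Real.log 2 + psi σ τ + xi σ τ x : ℝ) : ℂ) +
      Complex.I * (chi σ τ x : ℂ)) - (Real.pi / 4 : ℝ) * Complex.I =
      ((κ * Real.log 2 + -κ * psi σ τ + -(κ * xi σ τ x) : ℝ) : ℂ) +
        ((-(κ * chi σ τ x + Real.pi / 4) : ℝ) : ℂ) * Complex.I := by
    push_cast; ring
  rw [e3, Complex.exp_add, mul_div_right_comm, ← Complex.ofReal_exp, ← Complex.ofReal_div,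
    Real.exp_add, Real.exp_add, ew, e2p]
  congr 2
  have e4 : √(Real.pi * κ * weight α β x * u) = √(weight α β x) * √(Real.pi * κ * u) := by
    rw [← Real.sqrt_mul hw.le]; congr 1; ring
  have hs : √(weight α β x) ^ 2 = weight α β x := Real.sq_sqrt hw.le
  have hs0 : √(weight α β x) ≠ 0 := (Real.sqrt_pos.2 hw).ne'
  rw [e4]
  nth_rewrite 2 [← hs]
  have : √(Real.pi * κ * u) ≠ 0 := (Real.sqrt_pos.2 (by positivity)).ne'
  field_simp

end Amplitude

/-! ### The expansion sum -/

/-- The contribution to the Jacobi polynomial of the half circle about `x` through the saddle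
point, as a complex number. -/
noncomputable def arcValue (n : ℕ) (α β x : ℝ) : ℂ :=
  ((1 / (2 ^ n * weight α β x * Real.pi) : ℝ) : ℂ) *
    ((-1) ^ n * ∫ θ in (0 : ℝ)..Real.pi, logIntegrand n (n + α) (n + β) x
      (Real.log (saddleRadius (sigma n α β) (tau n α β) x) + θ * Complex.I))

/-- The complex factor `S` with `P_n^{(α,β)}(x) = Re (A S)`: the half circle contribution, corrected
by the (real) contribution of the cuts and divided by the amplitude `A`. -/
noncomputable def expansionSum (n : ℕ) (α β x : ℝ) : ℂ :=
  (arcValue n α β x + ((jacobiP n α β x - (arcValue n α β x).re : ℝ) : ℂ)) / amplitude n α β x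

lemma jacobiP_eq_re {n : ℕ} {α β x : ℝ} (hA : amplitude n α β x ≠ 0) :
    jacobiP n α β x = (amplitude n α β x * expansionSum n α β x).re := by
  rw [expansionSum, mul_div_cancel₀ _ hA, Complex.add_re, Complex.ofReal_re]
  ring

lemma jacobiP_eq_cos_sin {n : ℕ} {α β d x : ℝ} (hα : 0 ≤ α) (hβ : 0 ≤ β)
    (h : Regular d (sigma n α β) (tau n α β) x) : jacobiP n α β x =
      (2 : ℝ) ^ ((α + β + 1) / 2) * Real.exp (-kappa n α β * psi (sigma n α β) (tau n α β)) /
        √(Real.pi * kappa n α β * weight α β x * U (sigma n α β) (tau n α β) x) *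
      (Real.cos (kappa n α β * chi (sigma n α β) (tau n α β) x + Real.pi / 4) *
          (expansionSum n α β x).re +
        Real.sin (kappa n α β * chi (sigma n α β) (tau n α β) x + Real.pi / 4) *
          (expansionSum n α β x).im) := by
  rw [jacobiP_eq_re (amplitude_ne_zero hα hβ h), amplitude_eq_polar hα hβ h, mul_assoc,
    Complex.re_ofReal_mul, Complex.mul_re, Complex.exp_ofReal_mul_I_re,
    Complex.exp_ofReal_mul_I_im, Real.cos_neg, Real.sin_neg]
  ring

/-- The expansion of the complex factor in inverse powers of `κ`, uniformly over a compact range of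
parameters. -/
lemma exists_norm_expansionSum_sub_le {d : ℝ} (hd : 0 < d) (hd1 : d ≤ 1) (N : ℕ) :
    ∃ C : ℝ, ∀ (n : ℕ) (α β x : ℝ) (z : ℂ → ℂ), 0 ≤ α → 0 ≤ β →
      Regular d (sigma n α β) (tau n α β) x → 1 ≤ kappa n α β →
      IsSaddleBranch (sigma n α β) (tau n α β) x z →
      ‖expansionSum n α β x -
        ∑ j ∈ Finset.range N, cCoeff x z j / (kappa n α β : ℂ) ^ j‖ ≤ C / kappa n α β ^ N := by
  obtain ⟨C, hC⟩ := exists_half_circle_expansion hd hd1 N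
  refine ⟨2 * C, fun n α β x z hα hβ h hκ hz => ?_⟩
  have key := hC n α β _ _ _ x z (scaledParams hα hβ) h hκ hz
  have hA := amplitude_ne_zero hα hβ h
  have hAeq := amplitude_eq hα hβ h
  have hf := half_le_norm_leading h
  have hw := h.weight_pos
  have hpi := Real.pi_pos
  have hJ : jacobiP n α β x = _ := jacobiP_eq (n := n) (α := α) (β := β) (x := x)
    (l := Real.log (d / 2)) (by rw [Real.exp_log (by positivity)]; linarith [h.le_one_sub])
    (by rw [Real.exp_log (by positivity)]; linarith [h.le_one_add])
  set κ := kappa n α β with hκd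
  set A := amplitude n α β x
  set T := ∑ j ∈ Finset.range N, cCoeff x z j / (κ : ℂ) ^ j
  set E := Complex.exp (-κ * phi (sigma n α β) (tau n α β) x
    (zPlus (sigma n α β) (tau n α β) x))
  set f₀ := -(1 + Complex.I) / (2 * √(U (sigma n α β) (tau n α β) x) : ℂ)
  set I₁ := ∫ θ in (0 : ℝ)..Real.pi, logIntegrand n (n + α) (n + β) x
    (Real.log (d / 2) + θ * Complex.I)
  set I₀ := ∫ θ in (0 : ℝ)..Real.pi, logIntegrand n (n + α) (n + β) x
    (Real.log (saddleRadius (sigma n α β) (tau n α β) x) + θ * Complex.I) with hI₀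
  set c := 1 / (2 ^ n * weight α β x * Real.pi) with hc
  set s := √(2 * Real.pi / κ) with hs
  have hc0 : 0 < c := by positivity
  have hκ0 : 0 < κ := by linarith
  have hs0 : 0 < s := Real.sqrt_pos.2 (by positivity)
  have hE0 : 0 < ‖E‖ := norm_pos_iff.2 (Complex.exp_ne_zero _)
  have harc : arcValue n α β x = (c : ℂ) * ((-1) ^ n * I₀) := rfl
  have hre : jacobiP n α β x - (arcValue n α β x).re = c * ((-1) ^ n * (I₁.re - I₀.re)) := by
    have e : ((-1 : ℂ) ^ n) = (((-1) ^ n : ℝ) : ℂ) := by push_cast; rfl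
    rw [hJ, harc, e, Complex.re_ofReal_mul, Complex.re_ofReal_mul, hc]
    ring
  have hS : A * (expansionSum n α β x - T) =
      (c : ℂ) * (((-1) ^ n * I₀ - Complex.I * E * (f₀ * s * T)) +
        (((-1) ^ n * (I₁.re - I₀.re) : ℝ) : ℂ)) := by
    rw [mul_sub, expansionSum, mul_div_cancel₀ _ hA, hre, harc, hAeq]
    push_cast
    ring
  have hCg : 0 ≤ C * (s / κ ^ N) :=
    nonneg_of_mul_nonneg_right (le_trans (by positivity) key) hE0
  have hnA : ‖A‖ = c * (‖E‖ * (‖f₀‖ * s)) := by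
    rw [hAeq, norm_mul, norm_mul, norm_mul, norm_mul, Complex.norm_I, one_mul, Complex.norm_real,
      Complex.norm_real, Real.norm_of_nonneg hc0.le, Real.norm_of_nonneg hs0.le]
  have hA0 : 0 < ‖A‖ := norm_pos_iff.2 hA
  -- the error bound is compared with `‖A‖ = c ‖E‖ ‖f₀‖ √(2π/κ)`, where `‖f₀‖` is at least `1/2`
  have hbound : ‖A‖ * ‖expansionSum n α β x - T‖ ≤ ‖A‖ * (2 * C / κ ^ N) := by
    rw [← norm_mul, hS, norm_mul, Complex.norm_real, Real.norm_of_nonneg hc0.le, hnA]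
    have h1 : ‖((-1) ^ n * I₀ - Complex.I * E * (f₀ * s * T)) +
        (((-1) ^ n * (I₁.re - I₀.re) : ℝ) : ℂ)‖ ≤ ‖E‖ * (C * (s / κ ^ N)) := by
      refine (norm_add_le _ _).trans ?_
      rw [Complex.norm_real, norm_mul, norm_pow, norm_neg, norm_one, one_pow, one_mul,
        Real.norm_eq_abs]
      exact key
    have h2 : C * (s / κ ^ N) ≤ 2 * ‖f₀‖ * (C * (s / κ ^ N)) :=
      le_mul_of_one_le_left hCg (by linarith)
    calc _ ≤ c * (‖E‖ * (C * (s / κ ^ N))) := by gcongr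
      _ ≤ c * (‖E‖ * (2 * ‖f₀‖ * (C * (s / κ ^ N)))) := by gcongr
      _ = _ := by ring
  exact le_of_mul_le_mul_left hbound hA0

end JacobiAsymptotics

open JacobiAsymptotics

theorem mainTheorem1 :
    ∃ P Q : ℕ → ℝ → ℝ → ℝ → ℝ,
      -- exact representation, saddle value, and the coefficients with index `0`
      (∀ (n : ℕ) (α β x κ σ τ : ℝ), 0 ≤ α → 0 ≤ β →
        κ = kappa n α β → σ = sigma n α β → τ = tau n α β →
        x ∈ Set.Ioo (xMinus σ τ) (xPlus σ τ) →
          jacobiP n α β x =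
            (2 : ℝ) ^ ((α + β + 1) / 2) * Real.exp (-κ * psi σ τ) /
                Real.sqrt (Real.pi * κ * weight α β x * U σ τ x) *
              (Real.cos (κ * chi σ τ x + Real.pi / 4) * P n α β x
                + Real.sin (κ * chi σ τ x + Real.pi / 4) * Q n α β x) ∧
          phi σ τ x (zPlus σ τ x) =
            ((-Real.log 2 + psi σ τ + xi σ τ x : ℝ) : ℂ) + Complex.I * (chi σ τ x : ℂ) ∧
          (∃ z : ℂ → ℂ, IsSaddleBranch σ τ x z) ∧
          ∀ z : ℂ → ℂ, IsSaddleBranch σ τ x z →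
            cCoeff x z 0 = 1 ∧ pCoeff x z 0 = 1 ∧ qCoeff x z 0 = 0) ∧
      -- the asymptotic expansions, uniformly in the parameters
      ∀ σ₀ τ₀ δ : ℝ, 0 < σ₀ → σ₀ < 1 → 0 < τ₀ → τ₀ < 1 → 0 < δ →
        ∀ N : ℕ, ∃ C κ₀ : ℝ,
          ∀ (n : ℕ) (α β x κ σ τ : ℝ) (z : ℂ → ℂ), 0 ≤ α → 0 ≤ β →
            κ = kappa n α β → σ = sigma n α β → τ = tau n α β →
            κ₀ ≤ κ → σ ∈ Set.Icc 0 σ₀ → |τ| ≤ τ₀ →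
            x ∈ Set.Icc (xMinus σ τ + δ) (xPlus σ τ - δ) →
            IsSaddleBranch σ τ x z →
              |P n α β x - ∑ j ∈ Finset.range N, pCoeff x z j / κ ^ j| ≤ C / κ ^ N ∧
              |Q n α β x - ∑ j ∈ Finset.range N, qCoeff x z j / κ ^ j| ≤ C / κ ^ N ∧
              |jacobiP n α β x -
                  (amplitude n α β x *
                    ∑ j ∈ Finset.range N, cCoeff x z j / (κ : ℂ) ^ j).re| ≤
                C / κ ^ N * ‖amplitude n α β x‖ := by
  refine ⟨fun n α β x => (expansionSum n α β x).re, fun n α β x => (expansionSum n α β x).im,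
    ?_, ?_⟩
  · rintro n α β x κ σ τ hα hβ rfl rfl rfl ⟨hx1, hx2⟩
    have hδ : 0 < min (x - xMinus (sigma n α β) (tau n α β))
        (xPlus (sigma n α β) (tau n α β) - x) := lt_min (by linarith) (by linarith)
    have h := regular_of_margin hδ (abs_tau_le_sigma hα hβ) (sigma_lt_one hα hβ)
      (le_sub_iff_add_le'.1 (min_le_left _ _)) (le_sub_comm.1 (min_le_right _ _))
    obtain ⟨ρ, r, hρ, hr, -, hchart⟩ := exists_saddleChart h.pos
    obtain ⟨W, z, hc⟩ := hchart _ _ _ h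
    refine ⟨jacobiP_eq_cos_sin hα hβ h, h.phi_zPlus, ⟨z, hc.isSaddleBranch hρ⟩, fun z' hz' => ?_⟩
    have h0 : cCoeff x z' 0 = 1 := by
      rw [hc.cCoeff_eq_of_isSaddleBranch hr hz', hc.cCoeff_zero h]
    simp [pCoeff, qCoeff, h0]
  · intro σ₀ τ₀ δ hσ0 hσ1 _ _ hδ N
    -- `σ ≤ σ₀` keeps `1 - σ` away from zero, and `1 ± τ` as well, because `|τ| ≤ σ`
    have hd : 0 < min δ (1 - σ₀) := lt_min hδ (by linarith)
    obtain ⟨C, hC⟩ := exists_norm_expansionSum_sub_le hd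
      ((min_le_right _ _).trans (by linarith)) N
    refine ⟨C, 1, ?_⟩
    rintro n α β x κ σ τ z hα hβ rfl rfl rfl hκ hσ _ hx hz
    have h : Regular (min δ (1 - σ₀)) (sigma n α β) (tau n α β) x :=
      (regular_of_margin hδ (abs_tau_le_sigma hα hβ) (sigma_lt_one hα hβ) hx.1 hx.2).mono hd
        (min_le_min_left _ (by linarith [hσ.2]))
    have hS := hC n α β x z hα hβ h hκ hz
    have hterm : ∀ j, cCoeff x z j / (kappa n α β : ℂ) ^ j =
        cCoeff x z j / ((kappa n α β ^ j : ℝ) : ℂ) := fun j => by push_cast; rfl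
    refine ⟨?_, ?_, ?_⟩
    · refine le_trans (le_of_eq ?_) ((Complex.abs_re_le_norm _).trans hS)
      simp only [Complex.sub_re, Complex.re_sum, hterm, Complex.div_ofReal_re, pCoeff]
    · refine le_trans (le_of_eq ?_) ((Complex.abs_im_le_norm _).trans hS)
      simp only [Complex.sub_im, Complex.im_sum, hterm, Complex.div_ofReal_im, qCoeff]
    · rw [jacobiP_eq_re (amplitude_ne_zero hα hβ h), ← Complex.sub_re, ← mul_sub]
      refine (Complex.abs_re_le_norm _).trans ?_
      rw [norm_mul, mul_comm]
      gcongr
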